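/- Let $u$ be a rational function that is analytic in the closed upper half-plane and tends to zero at infinity. Let $H^2=H^2(\mathbb C_+)$ be the Hardy space of the upper half-plane, identified through boundary values with a closed subspace of $L^2(\mathbb R)$, with inner product $\langle\cdot,\cdot\rangle$ linear in the first factor, and let $\mathbb P_+$ be the orthogonal projection of $L^2(\mathbb R)$ onto $H^2$. Then $u\in H^2$. Let $H_u f=\mathbb P_+(u\overline f)$, $f\in H^2$, be the anti-linear Hankel operator with symbol $u$. A number $\lambda>0$ is a singular value of $H_u$ if its Schmidt subspace $E_{H_u}(\lambda)=\mathrm{Ker}(H_u^2-\lambda^2 I)$ is non-trivial. There are finitely many singular values; denote them by $\lambda_1>\dots>\lambda_N>0$. For a finite Blaschke product $\theta(x)=e^{i\alpha}\prod_{j=1}^m\frac{x-a_j}{x-\overline{a_j}}$ with $\mathrm{Im}\,a_j>0$ (repetitions and $m=0$ allowed), let $K_\theta=H^2\cap(\theta H^2)^\perp$, let $P_\theta$ be the orthogonal projection onto $K_\theta$, and let $S_\theta(\tau)f=P_\theta(e^{i\tau x}f)$ for $f\in K_\theta$, $\tau>0$. There is a finite Blaschke product $\theta$ with $\theta(\infty)=1$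 and $\mathrm{Ran}\,H_u=K_\theta$, together with a bounded operator $A_\theta$ on $K_\theta$ such that $S_\theta(\tau)=e^{i\tau A_\theta}$ for all $\tau>0$. For every such $\theta$ and $A_\theta$ the following holds. 1. For all $n$, the vector $u\in H^2$ is not orthogonal to $E_{H_u}(\lambda_n)$. 2. Denoting by $u_n$ the orthogonal projection of $u$ onto $E_{H_u}(\lambda_n)$, we have $H_u u_n=\lambda_n e^{i\varphi_n}u_n$ for some unimodular constant $e^{i\varphi_n}$. 3. For all $n$, $u_n\in K_\theta$, and the number $\omega_n:=\langle A_\theta u_n,u_n\rangle$ has strictly positive imaginary part. -/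

import Mathlib

namespace Szego

open MeasureTheory Filter Topology Complex Set
open scoped ENNReal NNReal ComplexConjugate

/-- `L²(ℝ)`, complex valued. -/
abbrev L2R : Type := Lp ℂ 2 (volume : Measure ℝ)

/-- `L^∞(ℝ)`, complex valued. -/
abbrev LinfR : Type := Lp ℂ ∞ (volume : Measure ℝ)

/-- The open upper half-plane. -/
def upperHalf : Set ℂ := {z | 0 < z.im}

/-- The restriction of `F` to the horizontal line of height `y`. -/
def hline (F : ℂ → ℂ) (y : ℝ) : ℝ → ℂ := fun x => F (x + y * I)

/-- `F` is a holomorphic function in the upper half-plane of the Hardy class `H²`: its `L²` norms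
over the horizontal lines are bounded. -/
structure IsHardy (F : ℂ → ℂ) : Prop where
  holo : DifferentiableOn ℂ F upperHalf
  bdd : ∃ M : ℝ≥0, ∀ y : ℝ, 0 < y → eLpNorm (hline F y) 2 volume ≤ M

/-- `f` is the boundary value of `F` on the real line (in the `L²` sense). -/
def HasBoundary (F : ℂ → ℂ) (f : ℝ → ℂ) : Prop :=
  Tendsto (fun y : ℝ => eLpNorm (fun x => hline F y x - f x) 2 volume) (𝓝[>] 0) (𝓝 0)

theorem isOpen_upperHalf : IsOpen upperHalf :=
  isOpen_lt continuous_const Complex.continuous_im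

theorem continuous_hline {F : ℂ → ℂ} (hF : DifferentiableOn ℂ F upperHalf) {y : ℝ} (hy : 0 < y) :
    Continuous (hline F y) := by
  apply hF.continuousOn.comp_continuous (f := fun x : ℝ => (x : ℂ) + y * I) (by fun_prop)
  intro x
  simpa [upperHalf] using hy

theorem aesm_hline {F : ℂ → ℂ} (hF : DifferentiableOn ℂ F upperHalf) {y : ℝ} (hy : 0 < y) :
    AEStronglyMeasurable (hline F y) volume :=
  (continuous_hline hF hy).aestronglyMeasurable

theorem HasBoundary.congr {F : ℂ → ℂ} {f g : ℝ → ℂ} (h : HasBoundary F f) (hfg : f =ᵐ[volume] g) :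
    HasBoundary F g := by
  refine Tendsto.congr (fun y => eLpNorm_congr_ae ?_) h
  filter_upwards [hfg] with x hx
  rw [hx]

theorem IsHardy.add {F G : ℂ → ℂ} (hF : IsHardy F) (hG : IsHardy G) : IsHardy (F + G) := by
  refine ⟨hF.holo.add hG.holo, ?_⟩
  obtain ⟨M, hM⟩ := hF.bdd
  obtain ⟨N, hN⟩ := hG.bdd
  refine ⟨M + N, fun y hy => ?_⟩
  refine (eLpNorm_add_le (aesm_hline hF.holo hy) (aesm_hline hG.holo hy) (by norm_num)).trans ?_
  push_cast
  exact add_le_add (hM y hy) (hN y hy)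

theorem IsHardy.const_smul {F : ℂ → ℂ} (c : ℂ) (hF : IsHardy F) : IsHardy (c • F) := by
  refine ⟨hF.holo.const_smul c, ?_⟩
  obtain ⟨M, hM⟩ := hF.bdd
  refine ⟨‖c‖₊ * M, fun y hy => ?_⟩
  refine (eLpNorm_const_smul_le (c := c) (f := hline F y)).trans ?_
  push_cast
  exact mul_le_mul_right (hM y hy) _

theorem HasBoundary.add {F G : ℂ → ℂ} {f g : ℝ → ℂ} (hF : IsHardy F) (hG : IsHardy G)
    (hf : AEStronglyMeasurable f volume) (hg : AEStronglyMeasurable g volume)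
    (h : HasBoundary F f) (h' : HasBoundary G g) : HasBoundary (F + G) (f + g) := by
  have h0 := Tendsto.add h h'
  rw [add_zero] at h0
  refine tendsto_of_tendsto_of_tendsto_of_le_of_le' tendsto_const_nhds h0
    (Eventually.of_forall fun _ => bot_le) ?_
  filter_upwards [self_mem_nhdsWithin] with y hy
  refine le_trans (le_of_eq ?_) (eLpNorm_add_le ((aesm_hline hF.holo hy).sub hf)
    ((aesm_hline hG.holo hy).sub hg) (by norm_num))
  congr 1
  funext x
  simp only [hline, Pi.add_apply]
  ring

theorem HasBoundary.const_smul {F : ℂ → ℂ} {f : ℝ → ℂ} (c : ℂ) (h : HasBoundary F f) :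
    HasBoundary (c • F) (c • f) := by
  have h0 : Tendsto (fun y : ℝ => ‖c‖ₑ * eLpNorm (fun x => hline F y x - f x) 2 volume)
      (𝓝[>] 0) (𝓝 (‖c‖ₑ * 0)) := ENNReal.Tendsto.const_mul h (Or.inr (by simp))
  rw [mul_zero] at h0
  refine Tendsto.congr (fun y => ?_) h0
  rw [← eLpNorm_const_smul]
  congr 1
  funext x
  simp [hline, mul_sub]

/-- The Hardy space `H²` of the upper half-plane, identified with a subspace of `L²(ℝ)` through
boundary values. -/
def hardySpace : Submodule ℂ L2R where
  carrier := {f | ∃ F : ℂ → ℂ, IsHardy F ∧ HasBoundary F f}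
  zero_mem' := by
    refine ⟨0, ⟨differentiableOn_const 0, 0, fun y _ => ?_⟩, ?_⟩
    · have : hline 0 y = 0 := rfl
      simp [this]
    · have h : (0 : ℝ → ℂ) =ᵐ[volume] ((0 : L2R) : ℝ → ℂ) := (Lp.coeFn_zero ℂ 2 volume).symm
      refine HasBoundary.congr ?_ h
      have h0 : ∀ y : ℝ, (fun x => hline 0 y x - (0 : ℝ → ℂ) x) = 0 := fun y => by
        funext x; simp [hline]
      unfold HasBoundary
      simp only [h0, eLpNorm_zero]
      exact tendsto_const_nhds
  add_mem' := by
    rintro f g ⟨F, hF, hf⟩ ⟨G, hG, hg⟩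
    exact ⟨F + G, hF.add hG, (hf.add hF hG (Lp.aestronglyMeasurable f) (Lp.aestronglyMeasurable g)
      hg).congr (Lp.coeFn_add f g).symm⟩
  smul_mem' := by
    rintro c f ⟨F, hF, hf⟩
    exact ⟨c • F, hF.const_smul c, (hf.const_smul c).congr (Lp.coeFn_smul c f).symm⟩

theorem eLpNorm_hline_add (F : ℂ → ℂ) (hF : DifferentiableOn ℂ F upperHalf) {w : ℂ}
    (hw : 0 < w.im) :
    eLpNorm (fun x : ℝ => F (x + w)) 2 volume = eLpNorm (hline F w.im) 2 volume := by
  have h := eLpNorm_comp_measurePreserving (p := 2) (aesm_hline hF hw)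
    (measurePreserving_add_right (volume : Measure ℝ) w.re)
  rw [← h]
  congr 1
  funext x
  simp only [hline, Function.comp_apply]
  congr 1
  apply Complex.ext <;> simp

theorem differentiableOn_pairing {F : ℂ → ℂ} (hF : DifferentiableOn ℂ F upperHalf) {h : ℝ → ℂ}
    (hh : Continuous h) (R : ℝ) :
    DifferentiableOn ℂ (fun w : ℂ => ∫ x in (-R)..R, F (x + w) * h x) upperHalf := by
  intro w₀ hw₀
  apply DifferentiableAt.differentiableWithinAt
  have hw₀' : 0 < w₀.im := hw₀
  set r := w₀.im / 2 with hr
  have hball : ∀ w ∈ Metric.closedBall w₀ r, ∀ x : ℝ, (x + w : ℂ) ∈ upperHalf := by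
    intro w hw x
    have h1 : |(w - w₀).im| ≤ r := (Complex.abs_im_le_norm _).trans (by
      simpa [dist_eq_norm] using hw)
    have h2 := (abs_le.1 h1).1
    simp only [Complex.sub_im] at h2
    simp only [upperHalf, mem_ofPred_eq, Complex.add_im, Complex.ofReal_im, zero_add]
    linarith
  have hd : ContinuousOn (deriv F) upperHalf :=
    (hF.deriv isOpen_upperHalf).continuousOn
  have hK : IsCompact ((fun p : ℝ × ℂ => (p.1 : ℂ) + p.2) ''
      (uIcc (-R) R ×ˢ Metric.closedBall w₀ r)) :=
    (isCompact_uIcc.prod (isCompact_closedBall w₀ r)).image (by fun_prop)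
  obtain ⟨C, hC⟩ := hK.exists_bound_of_continuousOn (f := deriv F) (hd.mono (by
    rintro _ ⟨⟨x, w⟩, ⟨_, hw⟩, rfl⟩
    exact hball w hw x))
  have hcont : ∀ w ∈ Metric.closedBall w₀ r, Continuous fun x : ℝ => F (x + w) := fun w hw =>
    hF.continuousOn.comp_continuous (f := fun x : ℝ => (x : ℂ) + w) (by fun_prop) (hball w hw)
  have hmem : w₀ ∈ Metric.closedBall w₀ r := Metric.mem_closedBall_self (by positivity)
  refine (intervalIntegral.hasDerivAt_integral_of_dominated_loc_of_deriv_le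
    (F := fun (w : ℂ) (x : ℝ) => F (x + w) * h x)
    (F' := fun (w : ℂ) (x : ℝ) => deriv F (x + w) * h x)
    (s := Metric.closedBall w₀ r) (bound := fun x => C * ‖h x‖)
    (Metric.closedBall_mem_nhds w₀ (by positivity)) ?_ ?_ ?_ ?_ ?_ ?_).2.differentiableAt
  · filter_upwards [Metric.closedBall_mem_nhds w₀ (show 0 < r by positivity)] with w hw
    exact ((hcont w hw).mul hh).aestronglyMeasurable
  · exact ((hcont w₀ hmem).mul hh).intervalIntegrable _ _
  · exact ((hd.comp_continuous (f := fun x : ℝ => (x : ℂ) + w₀) (by fun_prop)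
      (hball w₀ hmem)).mul hh).aestronglyMeasurable
  · refine Eventually.of_forall fun x hx w hw => ?_
    rw [norm_mul]
    refine mul_le_mul_of_nonneg_right (hC _ ⟨(x, w), ⟨uIoc_subset_uIcc hx, hw⟩, rfl⟩)
      (norm_nonneg _)
  · exact (continuous_const.mul hh.norm).intervalIntegrable _ _
  · refine Eventually.of_forall fun x _ w hw => ?_
    have h1 : HasDerivAt F (deriv F (x + w)) (x + w) :=
      ((hF _ (hball w hw x)).differentiableAt (isOpen_upperHalf.mem_nhds (hball w hw x))).hasDerivAt
    exact (h1.comp_const_add (x : ℂ) w).mul_const _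

theorem enorm_pairing_le {F : ℂ → ℂ} (hF : DifferentiableOn ℂ F upperHalf) {h : ℝ → ℂ}
    (hh : Continuous h) {R : ℝ} (hR : 0 ≤ R) {w : ℂ} (hw : 0 < w.im) :
    ‖∫ x in (-R)..R, F (x + w) * h x‖ₑ ≤
      eLpNorm (hline F w.im) 2 volume * eLpNorm h 2 (volume.restrict (Ioc (-R) R)) := by
  rw [intervalIntegral.integral_of_le (by linarith), ← eLpNorm_hline_add F hF hw]
  have hc : Continuous fun x : ℝ => F (x + w) :=
    hF.continuousOn.comp_continuous (f := fun x : ℝ => (x : ℂ) + w) (by fun_prop)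
      (fun x => by simpa [upperHalf] using hw)
  refine (enorm_integral_le_lintegral_enorm _).trans ?_
  rw [← eLpNorm_one_eq_lintegral_enorm]
  have h1 := eLpNorm_smul_le_mul_eLpNorm (p := 2) (q := 2) (r := 1)
    (μ := volume.restrict (Ioc (-R) R)) (f := h) (φ := fun x : ℝ => F (x + w))
    hh.aestronglyMeasurable hc.aestronglyMeasurable
  refine h1.trans ?_
  gcongr
  exact Measure.restrict_le_self

theorem eLpNorm_hline_anti {F : ℂ → ℂ} (hF : IsHardy F) {ε y : ℝ} (hε : 0 < ε) (hy : ε < y) :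
    eLpNorm (hline F y) 2 volume ≤ eLpNorm (hline F ε) 2 volume := by
  obtain ⟨M, hM⟩ := hF.bdd
  have hy0 : 0 < y := hε.trans hy
  have hc := continuous_hline hF.holo hy0
  have key : ∀ R : ℝ, 0 ≤ R → eLpNorm (hline F y) 2 (volume.restrict (Ioc (-R) R)) ≤
      eLpNorm (hline F ε) 2 volume := by
    intro R hR
    set h : ℝ → ℂ := fun x => conj (hline F y x) with hh
    have hhc : Continuous h := Complex.continuous_conj.comp hc
    have hnorm : eLpNorm h 2 (volume.restrict (Ioc (-R) R)) =
        eLpNorm (hline F y) 2 (volume.restrict (Ioc (-R) R)) :=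
      eLpNorm_congr_norm_ae (Eventually.of_forall fun x => by simp [hh])
    set H := eLpNorm (hline F y) 2 (volume.restrict (Ioc (-R) R)) with hH
    have hHfin : H ≠ ∞ := ((eLpNorm_mono_measure _ Measure.restrict_le_self).trans
      (hM y hy0)).trans_lt ENNReal.coe_lt_top |>.ne
    have hεfin : eLpNorm (hline F ε) 2 volume ≠ ∞ := ((hM ε hε).trans_lt ENNReal.coe_lt_top).ne
    set G : ℂ → ℂ := fun w => ∫ x in (-R)..R, F (x + w) * h x with hG
    have hGd : DifferentiableOn ℂ G upperHalf := differentiableOn_pairing hF.holo hhc R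
    have hGle : ∀ w : ℂ, 0 < w.im → ‖G w‖ₑ ≤ eLpNorm (hline F w.im) 2 volume * H := fun w hw => by
      rw [← hnorm]
      exact enorm_pairing_le hF.holo hhc hR hw
    have hGM : ∀ w : ℂ, 0 < w.im → ‖G w‖ ≤ (M * H).toReal := fun w hw => by
      rw [← toReal_enorm]
      refine ENNReal.toReal_mono (ENNReal.mul_ne_top ENNReal.coe_ne_top hHfin) ((hGle w hw).trans ?_)
      gcongr
      exact hM _ hw
    have him : ∀ ζ : ℂ, (ζ * I + ε * I).im = ζ.re + ε := fun ζ => by simp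
    have hPL : ‖G ((y - ε : ℝ) * I + ε * I)‖ ≤ (eLpNorm (hline F ε) 2 volume * H).toReal := by
      refine PhragmenLindelof.right_half_plane_of_bounded_on_real
        (f := fun ζ => G (ζ * I + ε * I)) (z := ((y - ε : ℝ) : ℂ)) ?_ ⟨0, by norm_num, 0, ?_⟩
        ?_ ?_ ?_
      · apply DifferentiableOn.diffContOnCl
        rw [Complex.closure_setOfPred_lt_re]
        intro ζ hζ
        have hpos : ζ * I + ε * I ∈ upperHalf := by
          have : (0 : ℝ) ≤ ζ.re := hζ
          show 0 < (ζ * I + ε * I).im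
          rw [him]; linarith
        have h1 : DifferentiableAt ℂ G (ζ * I + ε * I) :=
          (hGd _ hpos).differentiableAt (isOpen_upperHalf.mem_nhds hpos)
        exact (DifferentiableAt.fun_comp' ζ h1
          (f := fun ζ : ℂ => ζ * I + ε * I) (by fun_prop)).differentiableWithinAt
      · refine Asymptotics.IsBigO.of_bound (M * H).toReal ?_
        refine eventually_inf_principal.2 (Eventually.of_forall fun ζ hζ => ?_)
        have hζ' : 0 < ζ.re := hζ
        have := hGM (ζ * I + ε * I) (by rw [him]; linarith)
        simpa using this
      · refine ⟨(M * H).toReal, eventually_map.2 ?_⟩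
        filter_upwards [eventually_gt_atTop 0] with x hx
        exact hGM _ (by rw [him]; simp; linarith)
      · intro x
        have h1 : (0 : ℝ) < ((x * I) * I + ε * I : ℂ).im := by rw [him]; simpa using hε
        have h2 := hGle _ h1
        rw [him] at h2
        rw [← toReal_enorm]
        refine ENNReal.toReal_mono (ENNReal.mul_ne_top hεfin hHfin) ?_
        simpa using h2
      · simp; linarith
    have hGy : ‖G ((y - ε : ℝ) * I + ε * I)‖ₑ = H * H := by
      have e1 : (((y - ε : ℝ) : ℂ) * I + ε * I) = y * I := by push_cast; ring
      have e2 : G (y * I) = ((∫ x in Ioc (-R) R, ‖hline F y x‖ ^ 2 : ℝ) : ℂ) := by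
        rw [hG]
        simp only
        rw [intervalIntegral.integral_of_le (by linarith), ← integral_complex_ofReal]
        congr 1
        funext x
        simp only [hh]
        change hline F y x * conj (hline F y x) = _
        rw [Complex.mul_conj, Complex.normSq_eq_norm_sq]
      rw [e1, e2]
      have hint : Integrable (fun x => ‖hline F y x‖ ^ 2) (volume.restrict (Ioc (-R) R)) :=
        ((hc.norm.pow 2).integrableOn_Icc (a := -R) (b := R)).mono_set Ioc_subset_Icc_self
      have e3 : ‖((∫ x in Ioc (-R) R, ‖hline F y x‖ ^ 2 : ℝ) : ℂ)‖ₑ =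
          ENNReal.ofReal (∫ x in Ioc (-R) R, ‖hline F y x‖ ^ 2) := by
        rw [← ofReal_norm, Complex.norm_real, Real.norm_of_nonneg
          (integral_nonneg fun x => by positivity)]
      rw [e3, ofReal_integral_eq_lintegral_ofReal hint (Eventually.of_forall fun x => by positivity),
        ← sq, hH, eLpNorm_eq_lintegral_rpow_enorm_toReal (by norm_num) (by norm_num)]
      rw [← ENNReal.rpow_natCast, ← ENNReal.rpow_mul]
      simp
    rcases eq_or_ne H 0 with h0 | h0
    · rw [h0]; exact bot_le
    · have h3 : ‖G ((y - ε : ℝ) * I + ε * I)‖ₑ ≤ eLpNorm (hline F ε) 2 volume * H := by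
        rw [← ofReal_norm]
        exact ENNReal.ofReal_le_of_le_toReal hPL
      rw [hGy] at h3
      exact (ENNReal.mul_le_mul_iff_left h0 hHfin).1 h3
  have hlim := Lp.eLpNorm_lim_le_liminf_eLpNorm (p := 2) (μ := (volume : Measure ℝ))
    (f := fun n : ℕ => (Ioc (-(n : ℝ)) n).indicator (hline F y))
    (fun n => (aesm_hline hF.holo hy0).indicator measurableSet_Ioc) (hline F y) (by
      refine Eventually.of_forall fun x => tendsto_const_nhds.congr' ?_
      obtain ⟨N, hN⟩ := exists_nat_gt |x|
      filter_upwards [eventually_ge_atTop N] with n hn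
      have h1 : |x| < n := hN.trans_le (by exact_mod_cast hn)
      rw [indicator_of_mem]
      exact ⟨(abs_lt.1 h1).1, (abs_lt.1 h1).2.le⟩)
  refine hlim.trans (liminf_le_of_le (by isBoundedDefault) fun b hb => ?_)
  obtain ⟨n, hn⟩ := hb.exists
  refine hn.trans ?_
  rw [eLpNorm_indicator_eq_eLpNorm_restrict measurableSet_Ioc]
  exact key n (by positivity)

/-- The norm of the boundary value dominates the norms over all horizontal lines. -/
theorem eLpNorm_hline_le {F : ℂ → ℂ} {f : ℝ → ℂ} (hF : IsHardy F)
    (hf : AEStronglyMeasurable f volume) (h : HasBoundary F f) {y : ℝ} (hy : 0 < y) :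
    eLpNorm (hline F y) 2 volume ≤ eLpNorm f 2 volume := by
  have h1 : Tendsto (fun ε : ℝ => eLpNorm (fun x => hline F ε x - f x) 2 volume +
      eLpNorm f 2 volume) (𝓝[>] 0) (𝓝 (0 + eLpNorm f 2 volume)) :=
    Tendsto.add h tendsto_const_nhds
  rw [zero_add] at h1
  refine ge_of_tendsto h1 ?_
  filter_upwards [Ioo_mem_nhdsGT hy] with ε hε
  refine (eLpNorm_hline_anti hF hε.1 hε.2).trans ?_
  refine le_trans (le_of_eq ?_) (eLpNorm_add_le ((aesm_hline hF.holo hε.1).sub hf) hf (by norm_num))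
  congr 1
  funext x
  simp

theorem enorm_sq_le_circle {F : ℂ → ℂ} (hF : DifferentiableOn ℂ F upperHalf) {z : ℂ} {ρ : ℝ}
    (hρ : 0 < ρ) (hz : ρ < z.im) :
    ENNReal.ofReal (2 * Real.pi) * ‖F z‖ₑ ^ 2 ≤
      ∫⁻ t in Ioo (-Real.pi) Real.pi, ‖F (circleMap z ρ t)‖ₑ ^ 2 := by
  have hsub : Metric.closedBall z ρ ⊆ upperHalf := by
    intro w hw
    have h1 : |(w - z).im| ≤ ρ := (Complex.abs_im_le_norm _).trans (by
      simpa [dist_eq_norm] using hw)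
    have h2 := (abs_le.1 h1).1
    simp only [Complex.sub_im] at h2
    simp only [upperHalf, mem_ofPred_eq]
    linarith
  have hd : DiffContOnCl ℂ (fun w => F w ^ 2) (Metric.ball z |ρ|) := by
    rw [abs_of_pos hρ]
    apply DifferentiableOn.diffContOnCl
    rw [closure_ball z hρ.ne']
    exact (hF.mono hsub).pow 2
  have h := hd.circleAverage
  rw [Real.circleAverage_def] at h
  have hper : Function.Periodic (fun t => F (circleMap z ρ t) ^ 2) (2 * Real.pi) := fun t => by
    simp only [periodic_circleMap z ρ t]
  have h2 := hper.intervalIntegral_add_eq 0 (-Real.pi)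
  rw [zero_add, show -Real.pi + 2 * Real.pi = Real.pi by ring] at h2
  rw [h2, intervalIntegral.integral_of_le (by linarith [Real.pi_pos])] at h
  have h3 : ((2 * Real.pi : ℝ) : ℂ) * F z ^ 2 =
      ∫ t in Ioc (-Real.pi) Real.pi, F (circleMap z ρ t) ^ 2 := by
    rw [← h, Complex.real_smul, ← mul_assoc, ← Complex.ofReal_mul,
      mul_inv_cancel₀ (by positivity), Complex.ofReal_one, one_mul]
  calc ENNReal.ofReal (2 * Real.pi) * ‖F z‖ₑ ^ 2
      = ‖((2 * Real.pi : ℝ) : ℂ) * F z ^ 2‖ₑ := by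
        rw [enorm_mul, enorm_pow, ← ofReal_norm (((2 * Real.pi : ℝ) : ℂ)), Complex.norm_real,
          Real.norm_of_nonneg (by positivity)]
    _ ≤ ∫⁻ t in Ioc (-Real.pi) Real.pi, ‖F (circleMap z ρ t) ^ 2‖ₑ := by
        rw [h3]
        exact enorm_integral_le_lintegral_enorm _
    _ = _ := by
        rw [setLIntegral_congr Ioo_ae_eq_Ioc.symm]
        simp only [enorm_pow]

/-- Point evaluations are locally bounded in the Hardy norm. -/
theorem enorm_sq_le_of_hline {F : ℂ → ℂ} (hF : DifferentiableOn ℂ F upperHalf) {M : ℝ≥0∞}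
    (hM : ∀ y : ℝ, 0 < y → eLpNorm (hline F y) 2 volume ≤ M) {z : ℂ} {r : ℝ}
    (hr : 0 < r) (hz : r < z.im) :
    ENNReal.ofReal (Real.pi * r ^ 2) * ‖F z‖ₑ ^ 2 ≤ ENNReal.ofReal (2 * r) * M ^ 2 := by
  have hpi := Real.pi_pos
  have hcont : ContinuousOn (fun w : ℂ => F (z + w)) {w | |w.im| < r} := by
    refine hF.continuousOn.comp (by fun_prop) fun w hw => ?_
    have := (abs_lt.1 (show |w.im| < r from hw)).1
    simp only [upperHalf, mem_ofPred_eq, Complex.add_im]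
    linarith
  have hopen : IsOpen {w : ℂ | |w.im| < r} :=
    isOpen_lt (by fun_prop) continuous_const
  set g : ℂ → ℝ≥0∞ := {w : ℂ | |w.im| < r}.indicator fun w => ‖F (z + w)‖ₑ ^ 2 with hg
  have hgm : Measurable g := by
    classical
    rw [hg, ← piecewise_eq_indicator]
    refine ContinuousOn.measurable_piecewise ?_ continuous_zero.continuousOn hopen.measurableSet
    exact (ENNReal.continuous_pow 2).comp_continuousOn hcont.enorm
  have hpolar : ENNReal.ofReal (Real.pi * r ^ 2) * ‖F z‖ₑ ^ 2 ≤ ∫⁻ w, g w := by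
    rw [← Complex.lintegral_comp_polarCoord_symm]
    rw [show polarCoord.target = Ioi (0 : ℝ) ×ˢ Ioo (-Real.pi) Real.pi from rfl,
      Measure.volume_eq_prod, ← Measure.prod_restrict, lintegral_prod _ (by
        refine Measurable.aemeasurable ?_
        refine (ENNReal.measurable_ofReal.comp measurable_fst).smul (hgm.comp ?_)
        have : Continuous fun p : ℝ × ℝ => Complex.polarCoord.symm (p.1, p.2) := by
          simp only [Complex.polarCoord_symm_apply]
          fun_prop
        exact this.measurable)]
    calc ENNReal.ofReal (Real.pi * r ^ 2) * ‖F z‖ₑ ^ 2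
        = ∫⁻ ρ in Ioo 0 r, ENNReal.ofReal ρ * (ENNReal.ofReal (2 * Real.pi) * ‖F z‖ₑ ^ 2) := by
          rw [lintegral_mul_const _ (by fun_prop),
            ← ofReal_integral_eq_lintegral_ofReal, ← integral_Ioc_eq_integral_Ioo,
            ← intervalIntegral.integral_of_le hr.le, integral_id, ← mul_assoc,
            ← ENNReal.ofReal_mul (by nlinarith)]
          · congr 2; ring
          · exact (continuous_id.integrableOn_Icc (a := 0) (b := r)).mono_set Ioo_subset_Icc_self
          · exact (ae_restrict_mem measurableSet_Ioo).mono fun x hx => hx.1.le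
      _ ≤ ∫⁻ ρ in Ioo 0 r, ∫⁻ t in Ioo (-Real.pi) Real.pi,
            ENNReal.ofReal ρ • g (Complex.polarCoord.symm (ρ, t)) := by
          refine setLIntegral_mono' measurableSet_Ioo fun ρ hρ => ?_
          simp only [smul_eq_mul]
          rw [lintegral_const_mul']
          swap
          · exact ENNReal.ofReal_ne_top
          gcongr
          refine (enorm_sq_le_circle hF hρ.1 (hρ.2.trans hz)).trans (le_of_eq ?_)
          refine lintegral_congr fun t => ?_
          have hmem : Complex.polarCoord.symm (ρ, t) ∈ {w : ℂ | |w.im| < r} := by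
            refine (Complex.abs_im_le_norm _).trans_lt ?_
            rw [Complex.norm_polarCoord_symm, abs_of_pos hρ.1]
            exact hρ.2
          rw [hg, indicator_of_mem hmem]
          congr 3
          simp [circleMap, Complex.exp_mul_I]
      _ ≤ _ := lintegral_mono_set Ioo_subset_Ioi_self
  refine hpolar.trans ?_
  rw [← (Complex.volume_preserving_equiv_real_prod.symm).lintegral_comp hgm,
    Measure.volume_eq_prod, lintegral_prod_symm _ (by
      exact (hgm.comp Complex.measurableEquivRealProd.symm.measurable).aemeasurable)]
  calc ∫⁻ η : ℝ, ∫⁻ x : ℝ, g (Complex.measurableEquivRealProd.symm (x, η))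
      ≤ ∫⁻ η : ℝ, (Ioo (-r) r).indicator (fun _ => M ^ 2) η := by
        refine lintegral_mono fun η => ?_
        by_cases hη : η ∈ Ioo (-r) r
        · rw [indicator_of_mem hη]
          have hη' : 0 < (z + η * I).im := by
            simp; linarith [hη.1]
          have h1 := (eLpNorm_hline_add F hF hη').trans_le (hM _ hη')
          rw [eLpNorm_eq_lintegral_rpow_enorm_toReal (by norm_num) (by norm_num)] at h1
          have h2 := pow_le_pow_left' h1 2
          rw [← ENNReal.rpow_natCast, ← ENNReal.rpow_mul] at h2
          simp only [ENNReal.toReal_ofNat, Nat.cast_ofNat, one_div, ne_eq, OfNat.ofNat_ne_zero,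
            not_false_eq_true, inv_mul_cancel₀, ENNReal.rpow_one, ENNReal.rpow_ofNat] at h2
          refine le_trans (lintegral_mono fun x => ?_) h2
          refine (indicator_le_self' (by intros; exact bot_le) _).trans (le_of_eq ?_)
          congr 3
          apply Complex.ext
          · simp; ring
          · simp
        · rw [indicator_of_notMem hη]
          refine le_of_eq ?_
          rw [lintegral_eq_zero_iff' (by
            exact (hgm.comp (Complex.measurableEquivRealProd.symm.measurable.comp
              (measurable_id.prodMk measurable_const))).aemeasurable)]
          refine Eventually.of_forall fun x => ?_
          apply indicator_of_notMem
          intro h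
          exact hη (abs_lt.1 (by simpa using h))
    _ = ENNReal.ofReal (2 * r) * M ^ 2 := by
        rw [lintegral_indicator_const measurableSet_Ioo, Real.volume_Ioo, mul_comm]
        congr 2; ring

theorem IsHardy.norm_sub_le {F G : ℂ → ℂ} {f g : L2R} (hF : IsHardy F) (hG : IsHardy G)
    (hf : HasBoundary F f) (hg : HasBoundary G g) :
    (∀ y : ℝ, 0 < y → eLpNorm (fun x => hline F y x - hline G y x) 2 volume ≤ ‖f - g‖ₑ) ∧
    ∀ (z : ℂ) (r : ℝ), 0 < r → r < z.im → ‖F z - G z‖ ≤ ‖f - g‖ / Real.sqrt r := by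
  have hd : IsHardy (F + (-1 : ℂ) • G) := hF.add (hG.const_smul _)
  have hb : HasBoundary (F + (-1 : ℂ) • G) ((f - g : L2R) : ℝ → ℂ) := by
    refine (hf.add hF (hG.const_smul (-1)) (Lp.aestronglyMeasurable f)
      ((Lp.aestronglyMeasurable g).const_smul (-1)) (hg.const_smul (-1))).congr ?_
    filter_upwards [Lp.coeFn_sub f g] with x hx
    rw [hx]
    simp [sub_eq_add_neg]
  have h1 : ∀ y : ℝ, 0 < y → eLpNorm (hline (F + (-1 : ℂ) • G) y) 2 volume ≤ ‖f - g‖₊ := by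
    intro y hy
    refine (eLpNorm_hline_le hd (Lp.aestronglyMeasurable _) hb hy).trans (le_of_eq ?_)
    rw [← Lp.enorm_def]
    rfl
  constructor
  · intro y hy
    refine le_trans (le_of_eq ?_) (h1 y hy)
    congr 1
    funext x
    simp [hline, sub_eq_add_neg]
  · intro z r hr hz
    have h2 := enorm_sq_le_of_hline hd.holo h1 hr hz
    have h3 : Real.pi * r ^ 2 * ‖F z - G z‖ ^ 2 ≤ 2 * r * ‖f - g‖ ^ 2 := by
      have e1 : ‖(F + (-1 : ℂ) • G) z‖ₑ = ENNReal.ofReal ‖F z - G z‖ := by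
        rw [ofReal_norm]
        simp [sub_eq_add_neg]
      have e2 : ((‖f - g‖₊ : ℝ≥0) : ℝ≥0∞) = ENNReal.ofReal ‖f - g‖ := by
        rw [ofReal_norm]; rfl
      rw [e1, e2, ← ENNReal.ofReal_pow (norm_nonneg _), ← ENNReal.ofReal_pow (norm_nonneg _),
        ← ENNReal.ofReal_mul (by positivity), ← ENNReal.ofReal_mul (by positivity)] at h2
      exact (ENNReal.ofReal_le_ofReal_iff (by positivity)).1 h2
    have h4 : r * ‖F z - G z‖ ^ 2 ≤ ‖f - g‖ ^ 2 := by
      have hpi := Real.pi_gt_three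
      have h5 : r * (3 * (r * ‖F z - G z‖ ^ 2)) ≤ r * (2 * ‖f - g‖ ^ 2) := by
        have : 0 ≤ (Real.pi - 3) * (r ^ 2 * ‖F z - G z‖ ^ 2) :=
          mul_nonneg (by linarith) (by positivity)
        nlinarith
      have h6 := le_of_mul_le_mul_left h5 hr
      nlinarith [sq_nonneg ‖f - g‖]
    rw [le_div_iff₀ (Real.sqrt_pos.2 hr)]
    refine abs_le_of_sq_le_sq' ?_ (norm_nonneg _) |>.2
    rw [mul_pow, Real.sq_sqrt hr.le]
    linarith

/-- The Hardy space is a closed subspace of `L²(ℝ)`. -/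
theorem isClosed_hardySpace : IsClosed (hardySpace : Set L2R) := by
  refine IsSeqClosed.isClosed fun f g hf hfg => ?_
  choose F hF hb using hf
  have hcau : CauchySeq f := hfg.cauchySeq
  have hpt : ∀ z ∈ upperHalf, CauchySeq fun n => F n z := by
    intro z hz
    have hz' : 0 < z.im := hz
    have hs : 0 < Real.sqrt (z.im / 2) := Real.sqrt_pos.2 (by linarith)
    refine Metric.cauchySeq_iff.2 fun ε hε => ?_
    obtain ⟨N, hN⟩ := Metric.cauchySeq_iff.1 hcau (ε * Real.sqrt (z.im / 2)) (by positivity)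
    refine ⟨N, fun m hm n hn => ?_⟩
    rw [dist_eq_norm]
    refine (((hF m).norm_sub_le (hF n) (hb m) (hb n)).2 z (z.im / 2) (by linarith)
      (by linarith)).trans_lt ?_
    rw [div_lt_iff₀ hs, ← dist_eq_norm]
    exact hN m hm n hn
  have hex : ∀ z : ℂ, ∃ c : ℂ, z ∈ upperHalf → Tendsto (fun n => F n z) atTop (𝓝 c) := fun z => by
    by_cases hz : z ∈ upperHalf
    · obtain ⟨c, hc⟩ := cauchySeq_tendsto_of_complete (hpt z hz)
      exact ⟨c, fun _ => hc⟩
    · exact ⟨0, fun h => absurd h hz⟩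
  choose G hG using hex
  have hloc : TendstoLocallyUniformlyOn F G atTop upperHalf := by
    rw [tendstoLocallyUniformlyOn_iff_forall_isCompact isOpen_upperHalf]
    intro K hK hKc
    rcases K.eq_empty_or_nonempty with rfl | hne
    · exact tendstoUniformlyOn_empty
    obtain ⟨z₀, hz₀, hmin⟩ := hKc.exists_isMinOn hne Complex.continuous_im.continuousOn
    have hz₀' : 0 < z₀.im := hK hz₀
    have hs : 0 < Real.sqrt (z₀.im / 2) := Real.sqrt_pos.2 (by linarith)
    refine UniformCauchySeqOn.tendstoUniformlyOn_of_tendsto ?_ fun z hz => hG z (hK hz)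
    refine Metric.uniformCauchySeqOn_iff.2 fun ε hε => ?_
    obtain ⟨N, hN⟩ := Metric.cauchySeq_iff.1 hcau (ε * Real.sqrt (z₀.im / 2)) (by positivity)
    refine ⟨N, fun m hm n hn z hz => ?_⟩
    have hle : z₀.im ≤ z.im := hmin hz
    rw [dist_eq_norm]
    refine (((hF m).norm_sub_le (hF n) (hb m) (hb n)).2 z (z₀.im / 2) (by linarith)
      (by linarith)).trans_lt ?_
    rw [div_lt_iff₀ hs, ← dist_eq_norm]
    exact hN m hm n hn
  have hGd : DifferentiableOn ℂ G upperHalf :=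
    hloc.differentiableOn (Eventually.of_forall fun n => (hF n).holo) isOpen_upperHalf
  have hdist : Tendsto (fun n => ‖g - f n‖ₑ) atTop (𝓝 0) := by
    have h1 : Tendsto (fun n => g - f n) atTop (𝓝 (g - g)) := tendsto_const_nhds.sub hfg
    rw [sub_self] at h1
    simpa using h1.enorm
  have hGn : ∀ (n : ℕ) (y : ℝ), 0 < y →
      eLpNorm (fun x => hline G y x - hline (F n) y x) 2 volume ≤ ‖g - f n‖ₑ := by
    intro n y hy
    have h1 := Lp.eLpNorm_lim_le_liminf_eLpNorm (p := 2) (μ := (volume : Measure ℝ))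
      (f := fun (m : ℕ) (x : ℝ) => hline (F m) y x - hline (F n) y x)
      (fun m => (aesm_hline (hF m).holo hy).sub (aesm_hline (hF n).holo hy))
      (fun x => hline G y x - hline (F n) y x)
      (Eventually.of_forall fun x =>
        (hG (x + y * I) (by simpa [upperHalf] using hy)).sub tendsto_const_nhds)
    refine h1.trans ((liminf_le_liminf (Eventually.of_forall fun m =>
      ((hF m).norm_sub_le (hF n) (hb m) (hb n)).1 y hy)).trans (le_of_eq ?_))
    exact ((hfg.sub tendsto_const_nhds).enorm).liminf_eq
  refine ⟨G, ⟨hGd, ?_⟩, ?_⟩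
  · obtain ⟨M, hM⟩ := (hF 0).bdd
    refine ⟨‖g - f 0‖₊ + M, fun y hy => ?_⟩
    have h1 := eLpNorm_add_le (p := 2) (μ := (volume : Measure ℝ))
      ((aesm_hline hGd hy).sub (aesm_hline (hF 0).holo hy))
      (aesm_hline (hF 0).holo hy) (by norm_num)
    rw [sub_add_cancel] at h1
    refine h1.trans ?_
    push_cast
    exact add_le_add (hGn 0 y hy) (hM y hy)
  · refine ENNReal.tendsto_nhds_zero.2 fun ε hε => ?_
    have hε3 : 0 < ε / 3 := ENNReal.div_pos hε.ne' (by norm_num)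
    obtain ⟨n, hn⟩ := (ENNReal.tendsto_nhds_zero.1 hdist (ε / 3) hε3).exists
    filter_upwards [ENNReal.tendsto_nhds_zero.1 (hb n) (ε / 3) hε3, self_mem_nhdsWithin] with y h1 hy
    have hy' : 0 < y := hy
    have m1 := (aesm_hline hGd hy').sub (aesm_hline (hF n).holo hy')
    have m2 := (aesm_hline (hF n).holo hy').sub (Lp.aestronglyMeasurable (f n))
    have m3 := (Lp.aestronglyMeasurable (f n)).sub (Lp.aestronglyMeasurable g)
    have h2 := eLpNorm_add_le (p := 2) (m1.add m2) m3 (by norm_num)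
    have h3 := eLpNorm_add_le (p := 2) m1 m2 (by norm_num)
    have e : (fun x => hline G y x - g x) = (hline G y - hline (F n) y + (hline (F n) y - (f n : ℝ → ℂ))) +
        ((f n : ℝ → ℂ) - (g : ℝ → ℂ)) := by
      funext x
      simp
    have h4 : eLpNorm ((f n : ℝ → ℂ) - (g : ℝ → ℂ)) 2 volume ≤ ε / 3 := by
      have : eLpNorm ((f n : ℝ → ℂ) - (g : ℝ → ℂ)) 2 volume = ‖g - f n‖ₑ := by
        rw [Lp.enorm_def, eLpNorm_sub_comm]
        exact (eLpNorm_congr_ae (Lp.coeFn_sub g (f n))).symm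
      rw [this]; exact hn
    rw [e]
    calc _ ≤ _ := h2
      _ ≤ (ε / 3 + ε / 3) + ε / 3 := by
        refine add_le_add (h3.trans (add_le_add ?_ h1)) h4
        exact (hGn n y hy').trans hn
      _ = ε := ENNReal.add_thirds ε

instance : CompleteSpace hardySpace := isClosed_hardySpace.completeSpace_coe

/-- The orthogonal projection `ℙ₊` of `L²(ℝ)` onto the Hardy space. -/
noncomputable def szegoProj : L2R →L[ℂ] hardySpace := hardySpace.orthogonalProjectionOnto

/-- Complex conjugation on `L²(ℝ)`. -/
noncomputable def conjL2 : L2R →L⋆[ℂ] L2R :=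
  LinearMap.mkContinuous
    { toFun := fun f => star f
      map_add' := fun f g => by
        apply Lp.ext
        filter_upwards [Lp.coeFn_star (f + g), Lp.coeFn_add f g, Lp.coeFn_add (star f) (star g),
          Lp.coeFn_star f, Lp.coeFn_star g] with x h1 h2 h3 h4 h5
        rw [h1, h3, Pi.star_apply, h2, Pi.add_apply, Pi.add_apply, h4, h5, Pi.star_apply,
          Pi.star_apply, star_add]
      map_smul' := fun c f => by
        apply Lp.ext
        filter_upwards [Lp.coeFn_star (c • f), Lp.coeFn_smul c f,
          Lp.coeFn_smul (starRingEnd ℂ c) (star f), Lp.coeFn_star f] with x h1 h2 h3 h4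
        rw [h1, h3]
        simp [h2, h4] }
    1 (fun f => by
      rw [one_mul]
      refine le_of_eq ?_
      change ‖star f‖ = ‖f‖
      rw [Lp.norm_def, Lp.norm_def]
      congr 1
      refine eLpNorm_congr_norm_ae ?_
      filter_upwards [Lp.coeFn_star f] with x hx
      rw [hx]
      simp)

/-- Multiplication by a bounded function on `L²(ℝ)`. -/
noncomputable def mulL2 (φ : LinfR) : L2R →L[ℂ] L2R :=
  LinearMap.mkContinuous
    { toFun := fun f => (φ • f : L2R)
      map_add' := fun f g => Lp.add_smul φ f g
      map_smul' := fun c f => (Lp.smul_comm c φ f).symm }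
    ‖φ‖ (fun f => Lp.norm_smul_le φ f)

theorem coeFn_conjL2 (f : L2R) : conjL2 f =ᵐ[volume] fun x => conj (f x) :=
  Lp.coeFn_star f

theorem coeFn_mulL2 (φ : LinfR) (f : L2R) : mulL2 φ f =ᵐ[volume] fun x => φ x * f x :=
  Lp.coeFn_lpSMul φ f

/-- The anti-linear Hankel operator `f ↦ ℙ₊(φ f̄)` on the Hardy space. -/
noncomputable def hankel (φ : LinfR) : hardySpace →L⋆[ℂ] hardySpace :=
  (szegoProj.comp (mulL2 φ)).comp (conjL2.comp hardySpace.subtypeL)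

/-- The Schmidt subspace `Ker(H² - lam² I)` of the Hankel operator `H` with symbol `φ`. -/
noncomputable def schmidtSpace (φ : LinfR) (lam : ℝ) : Submodule ℂ hardySpace :=
  ((hankel φ).comp (hankel φ) - ((lam : ℂ) ^ 2) • ContinuousLinearMap.id ℂ hardySpace).ker

/-- `lam` is a singular value of the Hankel operator with symbol `φ`. -/
def IsSingularValue (φ : LinfR) (lam : ℝ) : Prop := 0 < lam ∧ schmidtSpace φ lam ≠ ⊥

instance (φ : LinfR) (lam : ℝ) : CompleteSpace (schmidtSpace φ lam) :=
  (ContinuousLinearMap.isClosed_ker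
    ((hankel φ).comp (hankel φ) - ((lam : ℂ) ^ 2) • ContinuousLinearMap.id ℂ hardySpace)
    ).completeSpace_coe

/-- The unimodular function `x ↦ e^{iτx}`. -/
noncomputable def expFun (τ : ℝ) : ℝ → ℂ := fun x => Complex.exp (τ * x * I)

theorem memLp_expFun (τ : ℝ) : MemLp (expFun τ) ∞ volume := by
  refine memLp_top_of_bound (C := 1) (Continuous.aestronglyMeasurable ?_)
    (Eventually.of_forall fun x => le_of_eq ?_)
  · unfold expFun; fun_prop
  · unfold expFun
    rw [← Complex.ofReal_mul, Complex.norm_exp_ofReal_mul_I]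

theorem mulL2_expFun_mem {τ : ℝ} (hτ : 0 ≤ τ) {f : L2R} (hf : f ∈ hardySpace) :
    mulL2 (memLp_expFun τ).toLp f ∈ hardySpace := by
  obtain ⟨F, hF, hb⟩ := hf
  have hn : ∀ (x y : ℝ), ‖Complex.exp (τ * (x + y * I) * I)‖ = Real.exp (-(τ * y)) := by
    intro x y
    rw [Complex.norm_exp]
    congr 1
    simp
  refine ⟨fun z => Complex.exp (τ * z * I) * F z, ⟨?_, ?_⟩, ?_⟩
  · refine DifferentiableOn.mul (Differentiable.differentiableOn ?_) hF.holo
    fun_prop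
  · obtain ⟨M, hM⟩ := hF.bdd
    refine ⟨M, fun y hy => (eLpNorm_mono fun x => ?_).trans (hM y hy)⟩
    simp only [hline, norm_mul, hn]
    refine mul_le_of_le_one_left (norm_nonneg _) (Real.exp_le_one_iff.2 ?_)
    have := mul_nonneg hτ hy.le
    linarith
  · have hae : (fun x => expFun τ x * f x) =ᵐ[volume] mulL2 (memLp_expFun τ).toLp f := by
      filter_upwards [coeFn_mulL2 (memLp_expFun τ).toLp f, (memLp_expFun τ).coeFn_toLp] with x h1 h2
      rw [h1, h2]
    refine HasBoundary.congr ?_ hae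
    have hlim : Tendsto (fun y : ℝ => eLpNorm (fun x => hline F y x - f x) 2 volume +
        ENNReal.ofReal (1 - Real.exp (-(τ * y))) * eLpNorm f 2 volume) (𝓝[>] 0) (𝓝 0) := by
      have h1 : Tendsto (fun y : ℝ => ENNReal.ofReal (1 - Real.exp (-(τ * y)))) (𝓝[>] 0) (𝓝 0) := by
        have : Continuous fun y : ℝ => ENNReal.ofReal (1 - Real.exp (-(τ * y))) :=
          ENNReal.continuous_ofReal.comp (by fun_prop)
        exact (this.tendsto' 0 0 (by simp)).mono_left nhdsWithin_le_nhds
      have h2 := Tendsto.add hb (ENNReal.Tendsto.mul_const (b := eLpNorm f 2 volume) h1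
        (Or.inr (Lp.memLp f).eLpNorm_ne_top))
      simpa using h2
    refine tendsto_of_tendsto_of_tendsto_of_le_of_le' tendsto_const_nhds hlim
      (Eventually.of_forall fun _ => bot_le) ?_
    filter_upwards [self_mem_nhdsWithin] with y hy
    have hy' : 0 < y := hy
    have hle : Real.exp (-(τ * y)) ≤ 1 := Real.exp_le_one_iff.2 (by
      have := mul_nonneg hτ hy'.le
      linarith)
    have h3 : eLpNorm (((1 - Real.exp (-(τ * y)) : ℝ) : ℂ) • (f : ℝ → ℂ)) 2 volume =
        ENNReal.ofReal (1 - Real.exp (-(τ * y))) * eLpNorm f 2 volume := by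
      rw [eLpNorm_const_smul, ← ofReal_norm (((1 - Real.exp (-(τ * y)) : ℝ) : ℂ)),
        Complex.norm_real, Real.norm_of_nonneg (by linarith)]
    rw [← h3]
    have m1 := (aesm_hline hF.holo hy').sub (Lp.aestronglyMeasurable f)
    have m2 := (Lp.aestronglyMeasurable f).const_smul (((1 - Real.exp (-(τ * y)) : ℝ) : ℂ))
    have m3 := m1.norm.add m2.norm
    refine le_trans (eLpNorm_mono_real (g := fun x => ‖hline F y x - f x‖ +
      ‖((1 - Real.exp (-(τ * y)) : ℝ) : ℂ) • f x‖) fun x => ?_) ?_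
    · have e : hline (fun z => Complex.exp (τ * z * I) * F z) y x - expFun τ x * f x =
          expFun τ x * ((Real.exp (-(τ * y)) : ℂ) * (hline F y x - f x) -
            ((1 - Real.exp (-(τ * y)) : ℝ) : ℂ) * f x) := by
        have e1 : Complex.exp (τ * (x + y * I) * I) = expFun τ x * (Real.exp (-(τ * y)) : ℂ) := by
          rw [expFun, Complex.ofReal_exp, ← Complex.exp_add]
          congr 1
          push_cast
          linear_combination (τ * y : ℂ) * I_sq
        simp only [hline]
        rw [e1]
        push_cast
        ring
      rw [e, norm_mul]
      have e2 : ‖expFun τ x‖ = 1 := by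
        rw [expFun, ← Complex.ofReal_mul, Complex.norm_exp_ofReal_mul_I]
      rw [e2, one_mul]
      refine (norm_sub_le _ _).trans ?_
      rw [norm_mul, Complex.norm_real, Real.norm_of_nonneg (Real.exp_pos _).le]
      gcongr
      · exact mul_le_of_le_one_left (norm_nonneg _) hle
      · rw [smul_eq_mul]
    · refine (eLpNorm_add_le m1.norm m2.norm (by norm_num)).trans (le_of_eq ?_)
      rw [eLpNorm_norm, eLpNorm_norm]
      rfl

/-- The semigroup `S(τ)`: multiplication by `e^{iτx}` on the Hardy space. -/
noncomputable def shift (τ : ℝ≥0) : hardySpace →L[ℂ] hardySpace :=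
  ((mulL2 (memLp_expFun τ).toLp).comp hardySpace.subtypeL).codRestrict hardySpace
    fun f => mulL2_expFun_mem τ.2 f.2

/-- `A` is the infinitesimal generator of the semigroup `T`, in the normalisation
`T(τ) = e^{iτA}` for all `τ > 0`. -/
def IsSemigroupGenerator {E : Type*} [NormedAddCommGroup E] [InnerProductSpace ℂ E]
    (T : ℝ≥0 → E →L[ℂ] E) (A : E →L[ℂ] E) : Prop :=
  ∀ τ : ℝ≥0, 0 < τ → T τ = NormedSpace.exp ((I * ((τ : ℝ) : ℂ)) • A)

/-- A finite Blaschke product in the upper half-plane, given by its unimodular constant and its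
zeros, repeated according to multiplicity. -/
structure FiniteBlaschke where
  const : Circle
  zeros : Multiset UpperHalfPlane

namespace FiniteBlaschke

/-- The Blaschke product as a function. -/
noncomputable def eval (θ : FiniteBlaschke) (z : ℂ) : ℂ :=
  θ.const * (θ.zeros.map fun a : UpperHalfPlane => (z - (a : ℂ)) / (z - conj (a : ℂ))).prod

theorem memLp_eval (θ : FiniteBlaschke) : MemLp (fun x : ℝ => θ.eval x) ∞ volume := by
  have hne : ∀ (a : UpperHalfPlane) (x : ℝ), (x : ℂ) - conj (a : ℂ) ≠ 0 := by
    intro a x h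
    have h1 := congrArg Complex.im h
    have h2 : 0 < (a : ℂ).im := a.im_pos
    simp at h1
    simp [h1] at h2
  refine memLp_top_of_bound (C := 1) (Continuous.aestronglyMeasurable ?_)
    (Eventually.of_forall fun x => le_of_eq ?_)
  · refine continuous_const.mul (continuous_multiset_prod _ fun a _ => ?_)
    exact Continuous.div (by fun_prop) (by fun_prop) (hne a)
  · have hprod : ∀ s : Multiset UpperHalfPlane,
        ‖(s.map fun a : UpperHalfPlane => ((x : ℂ) - (a : ℂ)) / (x - conj (a : ℂ))).prod‖ = 1 := by
      intro s
      induction s using Multiset.induction_on with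
      | empty => simp
      | cons a s ih =>
        have h1 : ‖(x : ℂ) - conj (a : ℂ)‖ = ‖(x : ℂ) - (a : ℂ)‖ := by
          rw [← Complex.norm_conj ((x : ℂ) - (a : ℂ))]
          simp
        rw [Multiset.map_cons, Multiset.prod_cons, norm_mul, ih, mul_one, norm_div, ← h1]
        exact div_self (norm_ne_zero_iff.2 (hne a x))
    rw [eval, norm_mul, hprod, mul_one]
    exact Circle.norm_coe _

/-- The boundary function of the Blaschke product on the real line. -/
noncomputable def toLinf (θ : FiniteBlaschke) : LinfR := θ.memLp_eval.toLp

/-- The normalisation `θ(∞) = 1`. -/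
def IsNormalized (θ : FiniteBlaschke) : Prop := Tendsto θ.eval (Bornology.cobounded ℂ) (𝓝 1)

/-- The model space `K_θ = H² ∩ (θ H²)^⊥`, as a subspace of the Hardy space. -/
noncomputable def modelSpace (θ : FiniteBlaschke) : Submodule ℂ hardySpace :=
  ((hardySpace.map (mulL2 θ.toLinf).toLinearMap)ᗮ).comap hardySpace.subtype

theorem isClosed_modelSpace (θ : FiniteBlaschke) : IsClosed (θ.modelSpace : Set hardySpace) :=
  (Submodule.isClosed_orthogonal _).preimage continuous_subtype_val

instance (θ : FiniteBlaschke) : CompleteSpace θ.modelSpace := θ.isClosed_modelSpace.completeSpace_coe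

/-- The Beurling-Lax semigroup `S_θ(τ) f = P_θ (S(τ) f)` on `K_θ`. -/
noncomputable def modelShift (θ : FiniteBlaschke) (τ : ℝ≥0) : θ.modelSpace →L[ℂ] θ.modelSpace :=
  θ.modelSpace.orthogonalProjectionOnto.comp ((shift τ).comp θ.modelSpace.subtypeL)

/-- `A` is the infinitesimal generator `A_θ` of the Beurling-Lax semigroup. -/
def IsGenerator (θ : FiniteBlaschke) (A : θ.modelSpace →L[ℂ] θ.modelSpace) : Prop :=
  IsSemigroupGenerator (E := θ.modelSpace) θ.modelShift A

end FiniteBlaschke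

/-- A rational function that is analytic in the closed upper half-plane and vanishes at infinity. -/
structure RationalSymbol where
  toRatFunc : RatFunc ℂ
  no_pole : ∀ z : ℂ, 0 ≤ z.im → toRatFunc.denom.eval z ≠ 0
  vanish : Tendsto (fun z : ℂ => toRatFunc.eval (RingHom.id ℂ) z) (Bornology.cobounded ℂ) (𝓝 0)

namespace RationalSymbol

/-- The symbol as a function. -/
noncomputable def eval (u : RationalSymbol) (z : ℂ) : ℂ := u.toRatFunc.eval (RingHom.id ℂ) z

theorem eval_eq (u : RationalSymbol) (z : ℂ) :
    u.eval z = u.toRatFunc.num.eval z / u.toRatFunc.denom.eval z := by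
  simp [eval, RatFunc.eval, Polynomial.eval₂_id]

theorem differentiableAt (u : RationalSymbol) {z : ℂ} (hz : 0 ≤ z.im) :
    DifferentiableAt ℂ u.eval z := by
  have : u.eval = fun z => u.toRatFunc.num.eval z / u.toRatFunc.denom.eval z := funext u.eval_eq
  rw [this]
  exact (Polynomial.differentiableAt _).fun_div (Polynomial.differentiableAt _) (u.no_pole z hz)

theorem degree_lt (u : RationalSymbol) : u.toRatFunc.num.degree < u.toRatFunc.denom.degree := by
  by_contra hcon
  have hd0 : u.toRatFunc.denom ≠ 0 := u.toRatFunc.denom_ne_zero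
  have h1 := Polynomial.isBigO_cobounded_of_degree_le (not_lt.1 hcon)
  have hne : ∀ᶠ z in Bornology.cobounded ℂ, u.toRatFunc.denom.eval z ≠ 0 := by
    rw [Metric.cobounded_eq_cocompact]
    exact (Polynomial.eventually_cofinite_not_isRoot hd0).filter_mono cocompact_le_cofinite
  have h2 : (fun z => u.toRatFunc.num.eval z) =o[Bornology.cobounded ℂ]
      fun z => u.toRatFunc.denom.eval z := by
    rw [Asymptotics.isLittleO_iff_tendsto' (hne.mono fun z hz h => absurd h hz)]
    exact u.vanish.congr u.eval_eq
  have h3 := h1.trans_isLittleO h2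
  have h4 := Asymptotics.isLittleO_irrefl (f'' := fun z => u.toRatFunc.denom.eval z)
    (l := Bornology.cobounded ℂ) hne.frequently
  exact h4 h3

theorem exists_bound (u : RationalSymbol) :
    ∃ C : ℝ, 0 ≤ C ∧ ∀ z : ℂ, 0 ≤ z.im → ‖u.eval z‖ ≤ C * (1 + z.re ^ 2) ^ (-(1 / 2) : ℝ) := by
  have hdeg : (Polynomial.X * u.toRatFunc.num).degree ≤ u.toRatFunc.denom.degree := by
    rw [Polynomial.degree_mul, Polynomial.degree_X, add_comm]
    have h1 := u.degree_lt
    rw [Polynomial.degree_eq_natDegree u.toRatFunc.denom_ne_zero] at h1 ⊢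
    rcases eq_or_ne u.toRatFunc.num 0 with h0 | h0
    · simp [h0]
    · rw [Polynomial.degree_eq_natDegree h0] at h1 ⊢
      exact_mod_cast h1
  obtain ⟨C₁, hC₁⟩ := (Polynomial.isBigO_cobounded_of_degree_le hdeg).bound
  obtain ⟨R, hR⟩ := (Metric.hasBasis_cobounded_compl_closedBall (0 : ℂ)).eventually_iff.1 hC₁
  have hK : IsCompact (Metric.closedBall (0 : ℂ) (max R 1) ∩ {z | 0 ≤ z.im}) :=
    (isCompact_closedBall _ _).inter_right (isClosed_le continuous_const Complex.continuous_im)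
  obtain ⟨C₂, hC₂⟩ := hK.exists_bound_of_continuousOn (f := fun z => u.eval z) fun z hz =>
    (u.differentiableAt hz.2).continuousAt.continuousWithinAt
  set S := max R 1 with hS
  have hS1 : 1 ≤ S := le_max_right _ _
  refine ⟨max (2 * |C₁|) (|C₂| * (1 + S)), le_max_of_le_left (by positivity), fun z hz => ?_⟩
  have hsqrt : (1 + z.re ^ 2) ^ (-(1 / 2) : ℝ) = (Real.sqrt (1 + z.re ^ 2))⁻¹ := by
    rw [Real.rpow_neg (by positivity), Real.sqrt_eq_rpow]
  have hpos : 0 < Real.sqrt (1 + z.re ^ 2) := Real.sqrt_pos.2 (by positivity)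
  rw [hsqrt, ← div_eq_mul_inv, le_div_iff₀ hpos]
  have hsq : Real.sqrt (1 + z.re ^ 2) ≤ 1 + ‖z‖ := by
    refine Real.sqrt_le_iff.2 ⟨by positivity, ?_⟩
    have h1 : z.re ^ 2 ≤ ‖z‖ ^ 2 := by
      rw [← sq_abs z.re]
      exact pow_le_pow_left₀ (abs_nonneg _) (Complex.abs_re_le_norm z) 2
    nlinarith [norm_nonneg z]
  by_cases hz' : z ∈ Metric.closedBall (0 : ℂ) S
  · refine le_trans ?_ (le_max_right _ _)
    have h1 := hC₂ z ⟨hz', hz⟩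
    have h2 : ‖z‖ ≤ S := by simpa using hz'
    exact mul_le_mul (h1.trans (le_abs_self _)) (hsq.trans (by linarith)) hpos.le (abs_nonneg _)
  · refine le_trans ?_ (le_max_left _ _)
    have hzS : S < ‖z‖ := by simpa using hz'
    have h1 := hR.2 (show z ∈ (Metric.closedBall (0 : ℂ) R)ᶜ by
      simp only [mem_compl_iff, Metric.mem_closedBall, dist_zero_right, not_le]
      exact (le_max_left _ _).trans_lt hzS)
    simp only [Polynomial.eval_mul, Polynomial.eval_X, norm_mul] at h1
    have hd : 0 < ‖u.toRatFunc.denom.eval z‖ := norm_pos_iff.2 (u.no_pole z hz)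
    have h3 : ‖z‖ * ‖u.eval z‖ ≤ |C₁| := by
      rw [u.eval_eq, norm_div, ← mul_div_assoc, div_le_iff₀ hd]
      exact h1.trans (mul_le_mul_of_nonneg_right (le_abs_self _) hd.le)
    nlinarith [norm_nonneg (u.eval z)]

theorem memLp_weight : MemLp (fun x : ℝ => (1 + x ^ 2) ^ (-(1 / 2) : ℝ)) 2 volume := by
  rw [memLp_two_iff_integrable_sq (Measurable.aestronglyMeasurable (by fun_prop))]
  refine integrable_inv_one_add_sq.congr (Eventually.of_forall fun x => ?_)
  have hx : (0 : ℝ) ≤ 1 + x ^ 2 := by positivity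
  simp only
  rw [← Real.rpow_mul_natCast hx, ← Real.rpow_neg_one]
  norm_num

theorem continuous_eval (u : RationalSymbol) : Continuous fun x : ℝ => u.eval x := by
  refine continuous_iff_continuousAt.2 fun x => ?_
  exact ContinuousAt.comp (f := fun x : ℝ => (x : ℂ)) (u.differentiableAt (by simp)).continuousAt
    (by fun_prop)

theorem memLp_top (u : RationalSymbol) : MemLp (fun x : ℝ => u.eval x) ∞ volume := by
  obtain ⟨C, hC, h⟩ := u.exists_bound
  refine memLp_top_of_bound (C := C) u.continuous_eval.aestronglyMeasurable
    (Eventually.of_forall fun x => (h x (by simp)).trans ?_)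
  refine mul_le_of_le_one_right hC (Real.rpow_le_one_of_one_le_of_nonpos ?_ (by norm_num))
  nlinarith [sq_nonneg (x : ℂ).re]

theorem memLp_two (u : RationalSymbol) : MemLp (fun x : ℝ => u.eval x) 2 volume := by
  obtain ⟨C, hC, h⟩ := u.exists_bound
  refine (memLp_weight.const_mul C).mono' u.continuous_eval.aestronglyMeasurable
    (Eventually.of_forall fun x => ?_)
  simpa using h x (by simp)

theorem mem_hardySpace (u : RationalSymbol) : u.memLp_two.toLp ∈ hardySpace := by
  obtain ⟨C, hC, h⟩ := u.exists_bound
  have hline_le : ∀ y : ℝ, 0 ≤ y → ∀ x : ℝ,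
      ‖hline u.eval y x‖ ≤ C * (1 + x ^ 2) ^ (-(1 / 2) : ℝ) := fun y hy x => by
    simpa [hline] using h (x + y * I) (by simpa using hy)
  have hfin := (memLp_weight.const_mul C).eLpNorm_ne_top
  have hol : DifferentiableOn ℂ u.eval upperHalf := fun z hz =>
    (u.differentiableAt (le_of_lt hz)).differentiableWithinAt
  refine ⟨u.eval, ⟨hol, ?_⟩, ?_⟩
  · refine ⟨(eLpNorm (fun x : ℝ => C * (1 + x ^ 2) ^ (-(1 / 2) : ℝ)) 2 volume).toNNReal,
      fun y hy => ?_⟩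
    rw [ENNReal.coe_toNNReal hfin]
    exact eLpNorm_mono_real (hline_le y hy.le)
  · refine HasBoundary.congr ?_ u.memLp_two.coeFn_toLp.symm
    have key : Tendsto (fun y : ℝ => ∫⁻ x : ℝ, ‖hline u.eval y x - u.eval x‖ₑ ^ 2) (𝓝[>] 0)
        (𝓝 (∫⁻ _ : ℝ, 0)) := by
      refine tendsto_lintegral_filter_of_dominated_convergence
        (fun x => ENNReal.ofReal (2 * (C * (1 + x ^ 2) ^ (-(1 / 2) : ℝ))) ^ 2) ?_ ?_ ?_ ?_
      · filter_upwards [self_mem_nhdsWithin] with y hy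
        exact (((continuous_hline hol hy).sub u.continuous_eval).enorm.measurable).pow_const 2
      · filter_upwards [self_mem_nhdsWithin] with y hy
        refine Eventually.of_forall fun x => ?_
        rw [← ofReal_norm (hline u.eval y x - u.eval x)]
        gcongr
        refine (norm_sub_le _ _).trans ?_
        have h0 : ‖u.eval x‖ ≤ C * (1 + x ^ 2) ^ (-(1 / 2) : ℝ) := by
          simpa using h x (by simp)
        linarith [hline_le y (le_of_lt hy) x]
      · have h2 := (memLp_weight.const_mul C).const_mul 2
        have h3 := lintegral_rpow_enorm_lt_top_of_eLpNorm_lt_top (by norm_num) (by norm_num) h2.2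
        refine ne_of_lt (lt_of_le_of_lt (le_of_eq (lintegral_congr fun x => ?_)) h3)
        rw [← ofReal_norm, Real.norm_of_nonneg (by positivity)]
        simp
      · refine Eventually.of_forall fun x => ?_
        have h1 : Tendsto (fun y : ℝ => hline u.eval y x) (𝓝[>] 0) (𝓝 (u.eval x)) := by
          have h2 : ContinuousAt u.eval (x : ℂ) := (u.differentiableAt (by simp)).continuousAt
          have h3 : Tendsto (fun y : ℝ => (x : ℂ) + y * I) (𝓝 0) (𝓝 (x : ℂ)) :=
            Continuous.tendsto' (by fun_prop) _ _ (by simp)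
          exact (h2.tendsto.comp h3).mono_left nhdsWithin_le_nhds
        have h4 := (h1.sub_const (u.eval x)).enorm
        rw [sub_self, enorm_zero] at h4
        simpa [Function.comp_def] using ((ENNReal.continuous_pow 2).tendsto 0).comp h4
    rw [lintegral_zero] at key
    have h5 := ((ENNReal.continuous_rpow_const (y := (1 / 2 : ℝ))).tendsto 0).comp key
    rw [ENNReal.zero_rpow_of_pos (by norm_num)] at h5
    refine Tendsto.congr (fun y => ?_) h5
    rw [eLpNorm_eq_lintegral_rpow_enorm_toReal (by norm_num) (by norm_num)]
    simp

/-- The symbol as an element of `L^∞(ℝ)`. -/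
noncomputable def toLinf (u : RationalSymbol) : LinfR := u.memLp_top.toLp

/-- The symbol as an element of the Hardy space. -/
noncomputable def toHardy (u : RationalSymbol) : hardySpace := ⟨u.memLp_two.toLp, u.mem_hardySpace⟩

/-- `θ` is the normalised finite Blaschke product with `Ran H_u = K_θ`. -/
def IsAssociated (u : RationalSymbol) (θ : FiniteBlaschke) : Prop :=
  θ.IsNormalized ∧ (hankel u.toLinf).range = θ.modelSpace

/-- The orthogonal projection `u_lam` of `u` onto the Schmidt subspace of `H_u` for `lam`. -/
noncomputable def component (u : RationalSymbol) (lam : ℝ) : hardySpace :=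
  (schmidtSpace u.toLinf lam).starProjection u.toHardy

end RationalSymbol

end Szego

open Szego

/-! Everything takes place in K_θ = Ran H_u. With D the denominator of u, this space consists of the
fractions p/D with deg p < deg D (`RationalSymbol.range_hankel`, `FiniteBlaschke.modelSpace_eq`).
Such an f satisfies f(x) = c(f)/x + O(1/x²) at infinity, and B f = x f - c(f) is again such a
fraction. Differentiating multiplication by e^{iτx} at τ = 0 against K_θ gives A_θ = B*
(`FiniteBlaschke.IsGenerator.inner_eq`).

The operators H = H_u and B are tied by the identities collected in `HankelModel`. The difference B
- B* has rank one and is given by c (`inner_mulXMod_sub`). The functional c(H f) is a multiple of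
⟪f, u⟫ (`topCoeff_of_hankel_eq`). One has B H = H B* (`inner_mulXMod_hankel_comm`). No eigenvector
of B is annihilated by c, since (X - μ) p = 0 forces p = 0.

Hence B H² = H B* H, and replacing B* by B in the middle costs a rank one term. On E = Ker(H² - λ²)
this yields λ² c(f) conj c(g) = c(H g) conj c(H f) (`HankelModel.coeff_mul`), which decides all
three claims. If u were orthogonal to E, then c ∘ H, and so c, would vanish on E. Then E would be
B-invariant and contain an eigenvector of B annihilated by c. Next take g to be the projection v of
u onto E. The left side becomes a multiple of ⟪H v, f⟫ because λ² c(f) = c(H² f), and the right side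
is a multiple of ⟪v, f⟫. So H v = ζ v, and |ζ| = λ because H² v = λ² v. Finally Im ⟪B v, v⟫ = π
|c(v)|². It is positive, since c(v) = 0 would give c(H v) = 0, whereas c(H v) = i‖v‖²/(2π).

The analysis rests on two facts: ∫ f g = 0 for f, g in H² (`integral_mul_eq_zero`), which replaces
all residue computations, and division by z - a at a zero a (`exists_div_mem_hardySpace`), which
gives H² = K_θ + θH². -/

namespace Szego

open MeasureTheory Filter Topology Complex Set
open scoped ENNReal NNReal ComplexConjugate InnerProductSpace

/-! ### The linear algebra: an antilinear operator intertwining a rank one perturbation with its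
adjoint. -/

section SchmidtSubspaces

variable {V : Type*} [NormedAddCommGroup V] [InnerProductSpace ℂ V]

/-- An anti-linear symmetric operator `H` together with an operator `B` whose imaginary part has
rank one and which intertwines with its adjoint through `H`. -/
structure HankelModel (H : V →ₗ⋆[ℂ] V) (B : V →ₗ[ℂ] V) (c : V →ₗ[ℂ] ℂ) (u : V) : Prop where
  symm : ∀ f g, ⟪H f, g⟫_ℂ = ⟪H g, f⟫_ℂ
  im_part : ∀ f g, ⟪g, B f⟫_ℂ - ⟪B g, f⟫_ℂ = -(2 * Real.pi * I) * (c f * conj (c g))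
  coeff_hankel : ∀ f, c (H f) = I / (2 * Real.pi) * ⟪f, u⟫_ℂ
  intertwine : ∀ f g, ⟪f, B (H g)⟫_ℂ = ⟪g, B (H f)⟫_ℂ
  coeff_ne_zero : ∀ f (μ : ℂ), B f = μ • f → c f = 0 → f = 0

namespace HankelModel

variable {H : V →ₗ⋆[ℂ] V} {B : V →ₗ[ℂ] V} {c : V →ₗ[ℂ] ℂ} {u : V}

theorem inner_sq (h : HankelModel H B c u) (f g : V) : ⟪g, H (H f)⟫_ℂ = ⟪H (H g), f⟫_ℂ := by
  rw [h.symm (H g) f, ← inner_conj_symm, h.symm (H f) g, inner_conj_symm]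

/-- In operator form, B H² - H² B* = H (B* - B) H, and the middle factor has rank one. -/
theorem inner_B_sq (h : HankelModel H B c u) (f g : V) :
    ⟪g, B (H (H f))⟫_ℂ = ⟪B (H (H g)), f⟫_ℂ
      - (2 * Real.pi * I) * (c (H g) * conj (c (H f))) := by
  have h1 := h.im_part (H g) (H f)
  have h2 : ⟪B (H f), H g⟫_ℂ = ⟪B (H (H g)), f⟫_ℂ := by
    rw [← inner_conj_symm, h.intertwine, inner_conj_symm]
  rw [h.intertwine, ← h2]
  linear_combination h1

variable {lam : ℝ}

/-- On the Schmidt subspace H² acts as λ², so `inner_B_sq` evaluates λ² times the form of B - B*,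
which `im_part` evaluates too. Equating the two rank one forms gives the identity. -/
theorem coeff_mul (h : HankelModel H B c u) {f g : V}
    (hf : H (H f) = ((lam : ℂ) ^ 2) • f) (hg : H (H g) = ((lam : ℂ) ^ 2) • g) :
    (lam : ℂ) ^ 2 * (c f * conj (c g)) = c (H g) * conj (c (H f)) := by
  have h1 := h.inner_B_sq f g
  have h2 := h.im_part f g
  rw [hf, hg, map_smul, map_smul, inner_smul_left, inner_smul_right] at h1
  simp only [map_pow, conj_ofReal] at h1
  have h3 : (2 * Real.pi * I : ℂ) ≠ 0 := by simp [Real.pi_ne_zero]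
  apply mul_left_cancel₀ h3
  linear_combination -h1 + (lam : ℂ) ^ 2 * h2

theorem exists_inner_ne_zero [FiniteDimensional ℂ V] (h : HankelModel H B c u) (hlam : lam ≠ 0)
    {f₀ : V} (hf₀ : H (H f₀) = ((lam : ℂ) ^ 2) • f₀) (h0 : f₀ ≠ 0) :
    ∃ f, H (H f) = ((lam : ℂ) ^ 2) • f ∧ ⟪f, u⟫_ℂ ≠ 0 := by
  by_contra! hcon
  have hl : (lam : ℂ) ^ 2 ≠ 0 := pow_ne_zero _ (by exact_mod_cast hlam)
  have hH : ∀ f, H (H f) = ((lam : ℂ) ^ 2) • f → c (H f) = 0 := fun f hf => by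
    rw [h.coeff_hankel, hcon f hf, mul_zero]
  have hc : ∀ f, H (H f) = ((lam : ℂ) ^ 2) • f → c f = 0 := fun f hf => by
    have h1 := h.coeff_mul hf hf
    rw [hH f hf, zero_mul] at h1
    simpa [hl] using h1
  let E : Submodule ℂ V :=
    { carrier := {f | H (H f) = ((lam : ℂ) ^ 2) • f}
      add_mem' := fun {f g} hf hg => by
        simp only [mem_ofPred_eq, map_add, smul_add] at *
        rw [hf, hg]
      zero_mem' := by simp
      smul_mem' := fun a f hf => by
        simp only [mem_ofPred_eq, LinearMap.map_smulₛₗ] at *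
        rw [hf]
        simp [smul_comm a] }
  -- With c and c ∘ H both zero on E, the two rank one corrections vanish and H² commutes with B on
  -- E.
  have hBE : ∀ f ∈ E, B f ∈ E := by
    intro f hf
    have hf' : H (H f) = ((lam : ℂ) ^ 2) • f := hf
    refine ext_inner_left ℂ fun g => ?_
    have h1 := h.inner_B_sq f g
    have h2 := h.im_part f (H (H g))
    rw [hf', hH f hf', map_smul, map_zero, mul_zero, mul_zero, sub_zero] at h1
    rw [hc f hf', zero_mul, mul_zero, sub_eq_zero] at h2
    rw [h.inner_sq, h2, ← h1]
  have : Nontrivial E := ⟨⟨f₀, hf₀⟩, 0, fun hz => h0 (congrArg Subtype.val hz)⟩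
  obtain ⟨μ, hμ⟩ := Module.End.exists_eigenvalue (B.restrict hBE)
  obtain ⟨f, hf⟩ := hμ.exists_hasEigenvector
  refine hf.2 (Subtype.ext (h.coeff_ne_zero f μ ?_ (hc f f.2)))
  exact congrArg Subtype.val hf.apply_eq_smul

/-- The hypothesis `hproj` says that v represents on the Schmidt subspace the same functional as u.
There c ∘ H is thus a multiple of pairing with v, and `coeff_mul` with g = v compares H v to v. -/
theorem component_spec (h : HankelModel H B c u) (hlam : 0 < lam) {v : V}
    (hv : H (H v) = ((lam : ℂ) ^ 2) • v)
    (hproj : ∀ f, H (H f) = ((lam : ℂ) ^ 2) • f → ⟪f, v⟫_ℂ = ⟪f, u⟫_ℂ) (hv0 : v ≠ 0) :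
    c v ≠ 0 ∧ ∃ φ : ℝ, H v = ((lam : ℂ) * Complex.exp (φ * Complex.I)) • v := by
  have hlC : (lam : ℂ) ≠ 0 := by exact_mod_cast hlam.ne'
  have hpi : (Real.pi : ℂ) ≠ 0 := by exact_mod_cast Real.pi_ne_zero
  have hvv : ⟪v, v⟫_ℂ ≠ 0 := inner_self_ne_zero.2 hv0
  have hHE : ∀ f, H (H f) = ((lam : ℂ) ^ 2) • f → H (H (H f)) = ((lam : ℂ) ^ 2) • H f := by
    intro f hf
    rw [hf, LinearMap.map_smulₛₗ]
    simp
  have hcH : ∀ f, H (H f) = ((lam : ℂ) ^ 2) • f →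
      c (H f) = I / (2 * Real.pi) * ⟪f, v⟫_ℂ := fun f hf => by
    rw [h.coeff_hankel, hproj f hf]
  have hcv : c v ≠ 0 := by
    intro hc
    have h1 := h.coeff_mul hv hv
    rw [hc, hcH v hv] at h1
    simp [hpi, hv0] at h1
  refine ⟨hcv, ?_⟩
  -- The factor λ² in `coeff_mul` is absorbed by λ² c(f) = c(H(H f)) = i/(2π) ⟪H f, v⟫ = i/(2π) ⟪H
  -- v, f⟫.
  have key : ∀ f, H (H f) = ((lam : ℂ) ^ 2) • f →
      ⟪H v, f⟫_ℂ * (I / (2 * Real.pi) * conj (c v)) =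
        I / (2 * Real.pi) * ⟪v, v⟫_ℂ * conj (I / (2 * Real.pi)) * ⟪v, f⟫_ℂ := by
    intro f hf
    have h1 := h.coeff_mul hf hv
    have h2 := hcH (H f) (hHE f hf)
    rw [hf, map_smul, h.symm f v, smul_eq_mul] at h2
    rw [hcH v hv, hcH f hf, map_mul, inner_conj_symm] at h1
    linear_combination h1 - conj (c v) * h2
  set a : ℂ := I / (2 * Real.pi) * conj (c v) with ha
  set b : ℂ := I / (2 * Real.pi) * ⟪v, v⟫_ℂ * conj (I / (2 * Real.pi)) with hb
  have ha0 : a ≠ 0 := by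
    rw [ha]
    simp [hpi, hcv]
  set ζ : ℂ := conj (b / a) with hζ
  have hHv : H v = ζ • v := by
    -- `key` only tests against the Schmidt subspace, but H v - ζ v lies in it and may itself be
    -- used as f.
    have hz : H v - ζ • v = 0 := by
      rw [← inner_self_eq_zero (𝕜 := ℂ)]
      have hmem : H (H (H v - ζ • v)) = ((lam : ℂ) ^ 2) • (H v - ζ • v) := by
        rw [map_sub, map_sub, hHE v hv, LinearMap.map_smulₛₗ, LinearMap.map_smulₛₗ, hv, smul_sub]
        simp [smul_comm ζ]
      have h1 := key _ hmem
      rw [inner_sub_left, inner_smul_left, hζ, conj_conj, sub_eq_zero]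
      field_simp
      linear_combination h1
    exact sub_eq_zero.1 hz
  have hnorm : ‖ζ‖ = lam := by
    have h1 := hv
    rw [hHv, LinearMap.map_smulₛₗ, hHv, smul_smul] at h1
    have h2 := smul_left_injective ℂ hv0 h1
    rw [Complex.conj_mul'] at h2
    have h3 : ‖ζ‖ ^ 2 = lam ^ 2 := by exact_mod_cast h2
    exact (pow_left_inj₀ (norm_nonneg _) hlam.le (by norm_num)).1 h3
  refine ⟨ζ.arg, ?_⟩
  rw [hHv, ← hnorm, Complex.norm_mul_exp_arg_mul_I]

theorem im_inner (h : HankelModel H B c u) (v : V) : (⟪B v, v⟫_ℂ).im = Real.pi * ‖c v‖ ^ 2 := by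
  have h1 := h.im_part v v
  rw [← inner_conj_symm, mul_conj'] at h1
  have h2 := congrArg Complex.im h1
  rw [sub_im, conj_im] at h2
  have h3 : (-(2 * Real.pi * I) * ((‖c v‖ : ℂ) ^ 2)).im = -(2 * Real.pi * ‖c v‖ ^ 2) := by
    rw [← ofReal_pow, im_mul_ofReal]
    simp
  rw [h3] at h2
  linarith

end HankelModel

end SchmidtSubspaces

/-! ### Contour integration and the orthogonality of the Hardy space to its conjugate. -/

/-- The closed upper half-plane. -/
def closedUpperHalf : Set ℂ := {z | 0 ≤ z.im}

theorem upperHalf_subset_closedUpperHalf : upperHalf ⊆ closedUpperHalf :=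
  fun z (h : 0 < z.im) => show 0 ≤ z.im from h.le

theorem ofReal_mem_closedUpperHalf (x : ℝ) : (x : ℂ) ∈ closedUpperHalf := by
  simp [closedUpperHalf]

theorem continuous_comp_ofReal {F : ℂ → ℂ} (hF : ContinuousOn F closedUpperHalf) :
    Continuous fun x : ℝ => F x :=
  hF.comp_continuous (f := fun x : ℝ => (x : ℂ)) continuous_ofReal ofReal_mem_closedUpperHalf

/-- Cauchy's theorem on the rectangle [-R, R] × [0, R]: the three sides off the real axis have total
length 4R, and on them |F| ≤ C/R². -/
theorem norm_intervalIntegral_le_of_decay {F : ℂ → ℂ} (hc : ContinuousOn F closedUpperHalf)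
    (hd : DifferentiableOn ℂ F upperHalf) {C : ℝ}
    (hC : ∀ z ∈ closedUpperHalf, ‖F z‖ ≤ C / (1 + ‖z‖ ^ 2)) {R : ℝ} (hR : 0 < R) :
    ‖∫ x in (-R)..R, F x‖ ≤ 4 * C / R := by
  have h := Complex.integral_boundary_rect_eq_zero_of_continuousOn_of_differentiableOn F (-R : ℂ)
    (R + R * I) (hc.mono fun z hz => ?_) (hd.mono fun z hz => ?_)
  rotate_left
  · have h1 := hz.2
    simp [uIcc_of_le hR.le] at h1
    exact h1.1
  · have h1 := hz.2
    simp [hR.le] at h1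
    exact h1.1
  have hC0 : 0 ≤ C := by
    have h1 := (norm_nonneg _).trans (hC 0 (by simp [closedUpperHalf]))
    simpa using h1
  have hb : ∀ z ∈ closedUpperHalf, R ≤ ‖z‖ → ‖F z‖ ≤ C / R ^ 2 := fun z hz hzR =>
    (hC z hz).trans (div_le_div_of_nonneg_left hC0 (by positivity) (by nlinarith))
  simp only [neg_re, ofReal_re, add_re, mul_re, I_re, mul_zero, ofReal_im, I_im, mul_one, sub_self,
    add_zero, neg_im, neg_zero, add_im, mul_im, zero_add, ofReal_zero, zero_mul, ofReal_neg,
    smul_eq_mul] at h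
  have h1 : ‖∫ x in (-R)..R, F (x + R * I)‖ ≤ C / R ^ 2 * |R - (-R)| :=
    intervalIntegral.norm_integral_le_of_norm_le_const fun x _ => hb _
      (by simp [closedUpperHalf, hR.le])
      (by simpa [abs_of_pos hR] using Complex.abs_im_le_norm (x + R * I))
  have h2 : ‖∫ y in (0 : ℝ)..R, F (R + y * I)‖ ≤ C / R ^ 2 * |R - 0| :=
    intervalIntegral.norm_integral_le_of_norm_le_const fun y hy => hb _
      (by rw [uIoc_of_le hR.le] at hy; simpa [closedUpperHalf] using hy.1.le)
      (by simpa [abs_of_pos hR] using Complex.abs_re_le_norm (R + y * I))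
  have h3 : ‖∫ y in (0 : ℝ)..R, F (-R + y * I)‖ ≤ C / R ^ 2 * |R - 0| :=
    intervalIntegral.norm_integral_le_of_norm_le_const fun y hy => hb _
      (by rw [uIoc_of_le hR.le] at hy; simpa [closedUpperHalf] using hy.1.le)
      (by simpa [abs_of_pos hR] using Complex.abs_re_le_norm (-R + y * I))
  rw [show |R - -R| = 2 * R by rw [abs_of_pos (by linarith)]; ring] at h1
  rw [sub_zero, abs_of_pos hR] at h2 h3
  have h4 : (∫ x in (-R)..R, F x) = (∫ x in (-R)..R, F (x + R * I)) -
      I * (∫ y in (0 : ℝ)..R, F (R + y * I)) + I * ∫ y in (0 : ℝ)..R, F (-R + y * I) := by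
    linear_combination h
  rw [h4]
  have h5 : C / R ^ 2 * (2 * R) + C / R ^ 2 * R + C / R ^ 2 * R = 4 * C / R := by
    field_simp; ring
  rw [← h5]
  refine (norm_add_le _ _).trans (add_le_add ((norm_sub_le _ _).trans (add_le_add h1 ?_)) ?_)
  · simpa using h2
  · simpa using h3

theorem integral_eq_zero_of_decay {F : ℂ → ℂ} (hc : ContinuousOn F closedUpperHalf)
    (hd : DifferentiableOn ℂ F upperHalf) {C : ℝ}
    (hC : ∀ z ∈ closedUpperHalf, ‖F z‖ ≤ C / (1 + ‖z‖ ^ 2)) : ∫ x : ℝ, F x = 0 := by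
  have hint : Integrable (fun x : ℝ => F x) := by
    refine (integrable_inv_one_add_sq.const_mul C).mono'
      (continuous_comp_ofReal hc).aestronglyMeasurable (Eventually.of_forall fun x => ?_)
    simpa [div_eq_mul_inv] using hC x (ofReal_mem_closedUpperHalf x)
  have h1 := intervalIntegral_tendsto_integral hint tendsto_neg_atTop_atBot tendsto_id
  refine tendsto_nhds_unique h1 (squeeze_zero_norm' ?_ (tendsto_const_nhds.div_atTop tendsto_id :
    Tendsto (fun R : ℝ => 4 * C / R) atTop (𝓝 0)))
  filter_upwards [eventually_gt_atTop 0] with R hR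
  exact norm_intervalIntegral_le_of_decay hc hd hC hR

theorem IsHardy.norm_le {F : ℂ → ℂ} {f : L2R} (hF : IsHardy F) (hf : HasBoundary F f) {z : ℂ}
    {r : ℝ} (hr : 0 < r) (hz : r < z.im) : ‖F z‖ ≤ ‖f‖ / Real.sqrt r := by
  have h0 : HasBoundary ((0 : ℂ) • F) ((0 : L2R) : ℝ → ℂ) := by
    refine (hf.const_smul 0).congr ?_
    filter_upwards [Lp.coeFn_zero ℂ 2 (volume : Measure ℝ)] with x hx
    rw [hx]
    simp
  simpa using (hF.norm_sub_le (hF.const_smul 0) hf h0).2 z r hr hz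

theorem IsHardy.memLp_hline {F : ℂ → ℂ} (hF : IsHardy F) {y : ℝ} (hy : 0 < y) :
    MemLp (hline F y) 2 volume := by
  obtain ⟨M, hM⟩ := hF.bdd
  exact ⟨aesm_hline hF.holo hy, (hM y hy).trans_lt ENNReal.coe_lt_top⟩

theorem normSq_le_norm_add_mul_I_sq {z : ℂ} (hz : z ∈ closedUpperHalf) {n : ℝ} (hn : 0 ≤ n) :
    n ^ 2 + ‖z‖ ^ 2 ≤ ‖z + n * I‖ ^ 2 := by
  have hz' : 0 ≤ z.im := hz
  rw [← Complex.normSq_eq_norm_sq, ← Complex.normSq_eq_norm_sq, Complex.normSq_apply,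
    Complex.normSq_apply]
  simp
  nlinarith [mul_nonneg hz' hn]

/-- Shifted up by ε, the product FG is bounded and integrable on the line, but need not decay like
|z|⁻² in the half-plane. A regularising factor supplies the decay and is then removed by dominated
convergence. -/
theorem integral_hline_mul_hline {F G : ℂ → ℂ} {f g : L2R} (hF : IsHardy F) (hG : IsHardy G)
    (hf : HasBoundary F f) (hg : HasBoundary G g) {ε : ℝ} (hε : 0 < ε) :
    ∫ x, hline F ε x * hline G ε x = 0 := by
  set Φ : ℂ → ℂ := fun z => F (z + ε * I) * G (z + ε * I) with hΦ
  have hmap : MapsTo (fun z : ℂ => z + ε * I) closedUpperHalf upperHalf := fun z hz => by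
    have : 0 ≤ z.im := hz
    simp only [upperHalf, mem_ofPred_eq, add_im, mul_im, ofReal_re, I_im, mul_one, ofReal_im, I_re,
      mul_zero, add_zero]
    linarith
  have hd : DifferentiableOn ℂ Φ upperHalf :=
    ((hF.holo.comp (by fun_prop) hmap).mul (hG.holo.comp (by fun_prop) hmap)).mono
      upperHalf_subset_closedUpperHalf
  have hc : ContinuousOn Φ closedUpperHalf :=
    (hF.holo.continuousOn.comp (by fun_prop) hmap).mul
      (hG.holo.continuousOn.comp (by fun_prop) hmap)
  have hb : ∀ z ∈ closedUpperHalf, ‖Φ z‖ ≤ (‖f‖ / √(ε / 2)) * (‖g‖ / √(ε / 2)) := fun z hz => by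
    have h1 : ε / 2 < (z + ε * I).im := by
      have : 0 ≤ z.im := hz
      simp; linarith
    rw [hΦ]
    simp only [norm_mul]
    exact mul_le_mul (hF.norm_le hf (by positivity) h1) (hG.norm_le hg (by positivity) h1)
      (norm_nonneg _) (by positivity)
  set C := (‖f‖ / √(ε / 2)) * (‖g‖ / √(ε / 2))
  have hC0 : 0 ≤ C := by positivity
  have hint : Integrable (fun x : ℝ => Φ x) :=
    (hF.memLp_hline hε).integrable_mul (hG.memLp_hline hε)
  -- The regulariser has its only pole at -i(n + 1), is bounded by 1 on the closed half-plane,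
  -- decays like |z|⁻² and tends to 1 pointwise. The shift n + 1 avoids a pole at 0.
  set κ : ℕ → ℂ → ℂ := fun n z => (((n + 1 : ℝ) : ℂ) * I / (z + ((n + 1 : ℝ) : ℂ) * I)) ^ 2 with hκ
  have hnorm : ∀ (n : ℕ), ∀ z ∈ closedUpperHalf,
      ‖κ n z‖ ≤ (n + 1 : ℝ) ^ 2 / ((n + 1 : ℝ) ^ 2 + ‖z‖ ^ 2) := fun n z hz => by
    rw [hκ]
    simp only [norm_pow, norm_div, norm_mul, norm_I, mul_one, div_pow]
    rw [Complex.norm_real, Real.norm_of_nonneg (by positivity)]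
    exact div_le_div_of_nonneg_left (by positivity) (by positivity)
      (normSq_le_norm_add_mul_I_sq hz (by positivity))
  have hne : ∀ (n : ℕ), ∀ z ∈ closedUpperHalf, z + ((n + 1 : ℝ) : ℂ) * I ≠ 0 := fun n z hz h0 => by
    have h1 := normSq_le_norm_add_mul_I_sq hz (show (0 : ℝ) ≤ n + 1 by positivity)
    rw [h0] at h1
    have : (0 : ℝ) < (n + 1 : ℝ) ^ 2 := by positivity
    simp at h1
    nlinarith [sq_nonneg ‖z‖]
  have hκd : ∀ n, DifferentiableOn ℂ (κ n) closedUpperHalf := fun n =>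
    (DifferentiableOn.div (by fun_prop) (by fun_prop) (hne n)).pow 2
  have hzero : ∀ n : ℕ, ∫ x : ℝ, κ n x * Φ x = 0 := fun n => by
    refine integral_eq_zero_of_decay (F := fun z => κ n z * Φ z) (C := (n + 1 : ℝ) ^ 2 * C)
      ((hκd n).continuousOn.mul hc) (((hκd n).mono upperHalf_subset_closedUpperHalf).mul hd)
      fun z hz => ?_
    rw [norm_mul]
    calc ‖κ n z‖ * ‖Φ z‖ ≤ (n + 1 : ℝ) ^ 2 / (1 + ‖z‖ ^ 2) * C := by
          refine mul_le_mul ((hnorm n z hz).trans ?_) (hb z hz) (norm_nonneg _) (by positivity)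
          refine div_le_div_of_nonneg_left (by positivity) (by positivity) ?_
          have : (0 : ℝ) ≤ n := by positivity
          nlinarith
      _ = _ := by ring
  have hlim : Tendsto (fun n : ℕ => ∫ x : ℝ, κ n x * Φ x) atTop (𝓝 (∫ x : ℝ, Φ x)) := by
    refine tendsto_integral_of_dominated_convergence (fun x => ‖Φ x‖) (fun n => ?_) hint.norm
      (fun n => Eventually.of_forall fun x => ?_) (Eventually.of_forall fun x => ?_)
    · exact ((continuous_comp_ofReal (hκd n).continuousOn).mul
        (continuous_comp_ofReal hc)).aestronglyMeasurable
    · rw [norm_mul]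
      refine mul_le_of_le_one_left (norm_nonneg _) ((hnorm n x (ofReal_mem_closedUpperHalf x)).trans
        (div_le_one_of_le₀ ?_ (by positivity)))
      nlinarith [sq_nonneg ‖(x : ℂ)‖]
    · have h1 : Tendsto (fun n : ℕ => (x : ℂ) / ((n + 1 : ℝ) : ℂ)) atTop (𝓝 0) := by
        have h2 : Tendsto (fun n : ℕ => x / ((n : ℝ) + 1)) atTop (𝓝 0) :=
          tendsto_const_nhds.div_atTop
            (tendsto_atTop_add_const_right _ _ tendsto_natCast_atTop_atTop)
        have h3 := (continuous_ofReal.tendsto 0).comp h2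
        simpa [Function.comp_def] using h3
      have h2 : Tendsto (fun n : ℕ => (I / ((x : ℂ) / ((n + 1 : ℝ) : ℂ) + I)) ^ 2 * Φ x) atTop
          (𝓝 ((I / (0 + I)) ^ 2 * Φ x)) :=
        ((tendsto_const_nhds.div (h1.add_const I) (by simp)).pow 2).mul_const _
      rw [zero_add, div_self I_ne_zero, one_pow, one_mul] at h2
      refine h2.congr fun n => ?_
      rw [hκ]
      have hn : ((n + 1 : ℝ) : ℂ) ≠ 0 := by exact_mod_cast (by positivity : (n + 1 : ℝ) ≠ 0)
      have := hne n x (ofReal_mem_closedUpperHalf x)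
      simp only
      congr 2
      rw [div_add' _ _ _ hn, div_div_eq_mul_div, mul_comm I]
  simp only [hzero] at hlim
  exact (tendsto_nhds_unique hlim tendsto_const_nhds)

/-- `H²` is orthogonal to its complex conjugate. -/
theorem integral_mul_eq_zero {f g : L2R} (hf : f ∈ hardySpace) (hg : g ∈ hardySpace) :
    ∫ x, f x * g x = 0 := by
  obtain ⟨F, hF, hbF⟩ := hf
  obtain ⟨G, hG, hbG⟩ := hg
  have hpos : ∀ n : ℕ, (0 : ℝ) < 1 / ((n : ℝ) + 1) := fun n => by positivity
  have hseq : Tendsto (fun n : ℕ => 1 / ((n : ℝ) + 1)) atTop (𝓝[>] 0) :=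
    tendsto_nhdsWithin_iff.2 ⟨tendsto_one_div_add_atTop_nhds_zero_nat, Eventually.of_forall hpos⟩
  have hlim : ∀ {K : ℂ → ℂ} {k : L2R} (hK : IsHardy K), HasBoundary K k →
      Tendsto (fun n : ℕ => (hK.memLp_hline (hpos n)).toLp) atTop (𝓝 k) := by
    intro K k hK hb
    rw [← Lp.toLp_coeFn k (Lp.memLp k)]
    exact (Lp.tendsto_Lp_iff_tendsto_eLpNorm'' _ _ _ _).2 (hb.comp hseq)
  -- The bilinear integral is the inner product with a conjugate, hence continuous for the L²
  -- convergence of the lines of height 1/(n + 1) to the boundary values.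
  have h1 := ((conjL2.continuous.tendsto f).comp (hlim hF hbF)).inner (𝕜 := ℂ) (hlim hG hbG)
  have hpair : ∀ a b : L2R, inner ℂ (conjL2 a) b = ∫ x, a x * b x := fun a b => by
    rw [L2.inner_def]
    refine integral_congr_ae ?_
    filter_upwards [coeFn_conjL2 a] with x hx
    rw [hx, RCLike.inner_apply, conj_conj, mul_comm]
  rw [hpair] at h1
  refine tendsto_nhds_unique h1 (tendsto_const_nhds.congr fun n => ?_)
  rw [Function.comp_apply, hpair, ← integral_hline_mul_hline hF hG hbF hbG (hpos n)]
  refine integral_congr_ae ?_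
  filter_upwards [(hF.memLp_hline (hpos n)).coeFn_toLp, (hG.memLp_hline (hpos n)).coeFn_toLp]
    with x h2 h3
  rw [h2, h3]

/-! ### Membership criteria, multipliers and division in the Hardy space. -/

theorem tendsto_eLpNorm_two_of_dominated {k : ℝ → ℝ → ℂ} {l : Filter ℝ} [l.IsCountablyGenerated]
    {b : ℝ → ℝ} (hb : MemLp b 2 volume) (hk : ∀ᶠ y in l, AEStronglyMeasurable (k y) volume)
    (hkb : ∀ᶠ y in l, ∀ x, ‖k y x‖ ≤ b x) (hlim : ∀ x, Tendsto (fun y => k y x) l (𝓝 0)) :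
    Tendsto (fun y => eLpNorm (k y) 2 volume) l (𝓝 0) := by
  have h1 : Tendsto (fun y => ∫ x, ‖k y x‖ ^ 2) l (𝓝 (∫ _ : ℝ, (0 : ℝ))) := by
    refine tendsto_integral_filter_of_dominated_convergence (fun x => b x ^ 2) ?_ ?_
      ((memLp_two_iff_integrable_sq hb.1).1 hb) (Eventually.of_forall fun x => ?_)
    · filter_upwards [hk] with y hy
      exact hy.norm.pow 2
    · filter_upwards [hkb] with y hy
      refine Eventually.of_forall fun x => ?_
      rw [Real.norm_of_nonneg (by positivity)]
      exact pow_le_pow_left₀ (norm_nonneg _) (hy x) 2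
    · simpa using (hlim x).norm.pow 2
  rw [integral_zero] at h1
  have h2 : Tendsto (fun y => ENNReal.ofReal ((∫ x, ‖k y x‖ ^ 2) ^ (1 / 2 : ℝ))) l (𝓝 0) := by
    have h3 : Continuous fun t : ℝ => ENNReal.ofReal (t ^ (1 / 2 : ℝ)) :=
      ENNReal.continuous_ofReal.comp (Real.continuous_rpow_const (by norm_num))
    have h4 := (h3.tendsto 0).comp h1
    rw [Real.zero_rpow (by norm_num), ENNReal.ofReal_zero] at h4
    exact h4
  refine h2.congr' ?_
  filter_upwards [hk, hkb] with y h3 h4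
  have h5 : MemLp (k y) 2 volume := hb.mono' h3 (Eventually.of_forall h4)
  rw [h5.eLpNorm_eq_integral_rpow_norm (by norm_num) (by norm_num)]
  simp

theorem tendsto_add_mul_I {F : ℂ → ℂ} (hF : ContinuousOn F closedUpperHalf) (x : ℝ) :
    Tendsto (fun y : ℝ => F (x + y * I)) (𝓝[>] 0) (𝓝 (F x)) := by
  have h1 : Tendsto (fun y : ℝ => (x : ℂ) + y * I) (𝓝[>] 0) (𝓝[closedUpperHalf] (x : ℂ)) := by
    refine tendsto_nhdsWithin_iff.2 ⟨?_, ?_⟩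
    · exact (Continuous.tendsto' (by fun_prop) _ _ (by simp)).mono_left nhdsWithin_le_nhds
    · filter_upwards [self_mem_nhdsWithin] with y hy
      simpa [closedUpperHalf] using le_of_lt hy
  exact (hF x (ofReal_mem_closedUpperHalf x)).tendsto.comp h1

theorem memLp_two_of_decay {F : ℂ → ℂ} (hc : ContinuousOn F closedUpperHalf) {C : ℝ}
    (hC : ∀ z ∈ closedUpperHalf, ‖F z‖ ≤ C * (1 + z.re ^ 2) ^ (-(1 / 2) : ℝ)) :
    MemLp (fun x : ℝ => F x) 2 volume := by
  refine (RationalSymbol.memLp_weight.const_mul C).mono'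
    (continuous_comp_ofReal hc).aestronglyMeasurable (Eventually.of_forall fun x => ?_)
  simpa using hC x (ofReal_mem_closedUpperHalf x)

theorem isHardy_of_decay {F : ℂ → ℂ} (hc : ContinuousOn F closedUpperHalf)
    (hd : DifferentiableOn ℂ F upperHalf) {C : ℝ}
    (hC : ∀ z ∈ closedUpperHalf, ‖F z‖ ≤ C * (1 + z.re ^ 2) ^ (-(1 / 2) : ℝ)) :
    IsHardy F ∧ HasBoundary F (fun x : ℝ => F x) := by
  have hline_le : ∀ y : ℝ, 0 ≤ y → ∀ x : ℝ,
      ‖hline F y x‖ ≤ C * (1 + x ^ 2) ^ (-(1 / 2) : ℝ) := fun y hy x => by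
    simpa [hline] using hC (x + y * I) (by simpa [closedUpperHalf] using hy)
  have hfin := (RationalSymbol.memLp_weight.const_mul C).eLpNorm_ne_top
  refine ⟨⟨hd, (eLpNorm (fun x : ℝ => C * (1 + x ^ 2) ^ (-(1 / 2) : ℝ)) 2 volume).toNNReal,
    fun y hy => ?_⟩, ?_⟩
  · rw [ENNReal.coe_toNNReal hfin]
    exact eLpNorm_mono_real (hline_le y hy.le)
  · refine tendsto_eLpNorm_two_of_dominated
      ((RationalSymbol.memLp_weight.const_mul C).const_mul 2) ?_ ?_ fun x => ?_
    · filter_upwards [self_mem_nhdsWithin] with y hy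
      exact (aesm_hline hd hy).sub (continuous_comp_ofReal hc).aestronglyMeasurable
    · filter_upwards [self_mem_nhdsWithin] with y hy x
      refine (norm_sub_le _ _).trans ?_
      have h0 := hline_le 0 le_rfl x
      simp only [hline, ofReal_zero, zero_mul, add_zero] at h0
      linarith [hline_le y (le_of_lt hy) x]
    · simpa [hline] using (tendsto_add_mul_I hc x).sub_const (F x)

theorem toLp_mem_hardySpace {F : ℂ → ℂ} {f : ℝ → ℂ} (h : IsHardy F ∧ HasBoundary F f)
    (hf : MemLp f 2 volume) : hf.toLp ∈ hardySpace :=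
  ⟨F, h.1, h.2.congr hf.coeFn_toLp.symm⟩

/-- `H²` is stable under multiplication by bounded holomorphic functions. -/
theorem exists_mul_mem_hardySpace {φ : ℂ → ℂ} (hc : ContinuousOn φ closedUpperHalf)
    (hd : DifferentiableOn ℂ φ upperHalf) {C : ℝ} (hC : ∀ z ∈ closedUpperHalf, ‖φ z‖ ≤ C)
    {f : L2R} (hf : f ∈ hardySpace) :
    ∃ g ∈ hardySpace, g =ᵐ[volume] fun x : ℝ => φ x * f x := by
  obtain ⟨F, hF, hb⟩ := hf
  have hC0 : 0 ≤ C := (norm_nonneg _).trans (hC 0 (by simp [closedUpperHalf]))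
  have hφm := (continuous_comp_ofReal hc).aestronglyMeasurable (μ := volume)
  have hmem : MemLp (fun x : ℝ => φ x * f x) 2 volume := by
    refine (Lp.memLp f).of_le_mul (c := C) (hφm.mul (Lp.aestronglyMeasurable f))
      (Eventually.of_forall fun x => ?_)
    rw [norm_mul]
    exact mul_le_mul_of_nonneg_right (hC x (ofReal_mem_closedUpperHalf x)) (norm_nonneg _)
  have hline_le : ∀ y : ℝ, 0 < y → ∀ x : ℝ, ‖φ (x + y * I)‖ ≤ C := fun y hy x =>
    hC _ (by simpa [closedUpperHalf] using hy.le)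
  refine ⟨hmem.toLp, toLp_mem_hardySpace (F := fun z => φ z * F z) ⟨⟨hd.mul hF.holo, ?_⟩, ?_⟩ hmem,
    hmem.coeFn_toLp⟩
  · obtain ⟨M, hM⟩ := hF.bdd
    refine ⟨C.toNNReal * M, fun y hy => ?_⟩
    refine (eLpNorm_le_mul_eLpNorm_of_ae_le_mul (g := hline F y) (c := C)
      (Eventually.of_forall fun x => ?_) 2).trans ?_
    · simp only [hline, norm_mul]
      exact mul_le_mul_of_nonneg_right (hline_le y hy x) (norm_nonneg _)
    · push_cast
      exact mul_le_mul_right (hM y hy) _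
  · have h1 : Tendsto (fun y : ℝ => eLpNorm (fun x : ℝ => (φ (x + y * I) - φ x) * f x) 2 volume)
        (𝓝[>] 0) (𝓝 0) := by
      refine tendsto_eLpNorm_two_of_dominated (b := fun x => 2 * C * ‖f x‖)
        ((Lp.memLp f).norm.const_mul _) ?_ ?_ fun x => ?_
      · filter_upwards [self_mem_nhdsWithin] with y hy
        exact ((aesm_hline hd hy).sub hφm).mul (Lp.aestronglyMeasurable f)
      · filter_upwards [self_mem_nhdsWithin] with y hy x
        rw [norm_mul]
        refine mul_le_mul_of_nonneg_right ((norm_sub_le _ _).trans ?_) (norm_nonneg _)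
        linarith [hline_le y hy x, hC x (ofReal_mem_closedUpperHalf x)]
      · simpa using ((tendsto_add_mul_I hc x).sub_const (φ x)).mul_const (f x)
    have h2 : Tendsto (fun y : ℝ => ENNReal.ofReal C * eLpNorm (fun x => hline F y x - f x) 2 volume
        + eLpNorm (fun x : ℝ => (φ (x + y * I) - φ x) * f x) 2 volume) (𝓝[>] 0) (𝓝 0) := by
      have h3 := (ENNReal.Tendsto.const_mul (a := ENNReal.ofReal C) hb
        (Or.inr ENNReal.ofReal_ne_top)).add h1
      simpa using h3
    refine tendsto_of_tendsto_of_tendsto_of_le_of_le' tendsto_const_nhds h2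
      (Eventually.of_forall fun _ => bot_le) ?_
    filter_upwards [self_mem_nhdsWithin] with y hy
    have m1 := (aesm_hline hF.holo hy).sub (Lp.aestronglyMeasurable f)
    have m2 := ((aesm_hline hd hy).sub hφm).mul (Lp.aestronglyMeasurable f)
    have e : (fun x => hline (fun z => φ z * F z) y x - φ x * f x) =
        (fun x => hline φ y x * (hline F y x - f x)) +
          fun x : ℝ => (φ (x + y * I) - φ x) * f x := by
      funext x
      simp only [hline, Pi.add_apply]
      ring
    rw [e]
    refine (eLpNorm_add_le ((aesm_hline hd hy).mul m1) m2 (by norm_num)).trans ?_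
    refine add_le_add ?_ le_rfl
    refine eLpNorm_le_mul_eLpNorm_of_ae_le_mul (Eventually.of_forall fun x => ?_) 2
    rw [Pi.mul_apply, norm_mul]
    exact mul_le_mul_of_nonneg_right (hline_le y hy x) (norm_nonneg _)

/-- Zeros in the upper half-plane of functions in `H²` can be divided out. -/
theorem exists_div_mem_hardySpace {L : ℂ → ℂ} {l : L2R} (hL : IsHardy L) (hl : HasBoundary L l)
    {a : ℂ} (ha : 0 < a.im) (h0 : L a = 0) :
    ∃ m ∈ hardySpace, m =ᵐ[volume] fun x : ℝ => l x / (x - a) := by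
  -- Half the height of a serves twice: the closed δ-disc about a stays in the open half-plane, and
  -- every point of height at most δ stays at distance at least δ from a.
  set δ := a.im / 2 with hδ
  have hδ0 : 0 < δ := by positivity
  set M := dslope L a with hM
  have hMz : ∀ z, z ≠ a → M z = L z / (z - a) := fun z hz => by
    rw [hM, dslope_of_ne _ hz, slope_def_field, h0, sub_zero]
  have hMd : DifferentiableOn ℂ M upperHalf :=
    (Complex.differentiableOn_dslope (isOpen_upperHalf.mem_nhds ha)).2 hL.holo
  have hball : Metric.closedBall a δ ⊆ upperHalf := by
    intro w hw
    have h1 : |(w - a).im| ≤ δ := (Complex.abs_im_le_norm _).trans (by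
      simpa [dist_eq_norm] using hw)
    have h2 := (abs_le.1 h1).1
    simp only [Complex.sub_im] at h2
    simp only [upperHalf, mem_ofPred_eq]
    linarith
  obtain ⟨K, hK⟩ := (isCompact_closedBall a δ).exists_bound_of_continuousOn
    (hMd.continuousOn.mono hball)
  have hfar : ∀ z w : ℂ, δ ≤ ‖z - a‖ → ‖w / (z - a)‖ ≤ δ⁻¹ * ‖w‖ := fun z w hz => by
    rw [norm_div, div_eq_mul_inv, mul_comm]
    exact mul_le_mul_of_nonneg_right (inv_anti₀ hδ0 hz) (norm_nonneg _)
  have hne : ∀ z : ℂ, δ ≤ ‖z - a‖ → z ≠ a := fun z hz h => by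
    rw [h, sub_self, norm_zero] at hz
    linarith
  have hlow : ∀ z : ℂ, z.im ≤ δ → δ ≤ ‖z - a‖ := fun z hz => by
    refine le_trans ?_ (Complex.abs_im_le_norm _)
    rw [sub_im, abs_sub_comm]
    exact le_trans (by linarith) (le_abs_self _)
  have hmem : MemLp (fun x : ℝ => l x / (x - a)) 2 volume := by
    refine (Lp.memLp l).of_le_mul (c := δ⁻¹) ?_
      (Eventually.of_forall fun x => hfar _ _ (hlow x (by simpa using hδ0.le)))
    simp only [div_eq_mul_inv]
    refine (Lp.aestronglyMeasurable l).mul (Continuous.aestronglyMeasurable ?_)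
    exact Continuous.inv₀ (by fun_prop) fun x =>
      sub_ne_zero.2 (hne x (hlow x (by simpa using hδ0.le)))
  refine ⟨hmem.toLp, toLp_mem_hardySpace (F := M) ⟨⟨hMd, ?_⟩, ?_⟩ hmem, hmem.coeFn_toLp⟩
  · obtain ⟨N, hN⟩ := hL.bdd
    set S := Icc (a.re - δ) (a.re + δ)
    have hind : MemLp (S.indicator fun _ => |K|) 2 (volume : Measure ℝ) :=
      memLp_indicator_const 2 measurableSet_Icc _ (Or.inr (by simp))
    refine ⟨(δ⁻¹).toNNReal * N + (eLpNorm (S.indicator fun _ => |K|) 2 volume).toNNReal,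
      fun y hy => ?_⟩
    -- Away from the disc division by z - a costs at most δ⁻¹. Inside it the quotient is bounded by
    -- compactness, and x is confined to an interval of length 2δ, so the bound is uniform in y.
    have h1 : ∀ x, ‖hline M y x‖ ≤ δ⁻¹ * ‖hline L y x‖ + S.indicator (fun _ => |K|) x := by
      intro x
      by_cases hx : δ ≤ ‖(x + y * I : ℂ) - a‖
      · simp only [hline]
        rw [hMz _ (hne _ hx)]
        exact (hfar _ _ hx).trans (le_add_of_nonneg_right
          (indicator_nonneg (fun _ _ => abs_nonneg K) _))
      · push Not at hx
        have hxS : x ∈ S := by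
          have h2 := (Complex.abs_re_le_norm _).trans hx.le
          simp only [sub_re, add_re, ofReal_re, mul_re, I_re, mul_zero, ofReal_im, I_im, mul_one,
            sub_self, add_zero] at h2
          have h3 := abs_le.1 h2
          exact ⟨by linarith [h3.1], by linarith [h3.2]⟩
        rw [indicator_of_mem hxS]
        have h2 := (hK (x + y * I) (by rw [Metric.mem_closedBall, dist_eq_norm]; exact hx.le)).trans
          (le_abs_self K)
        exact h2.trans (le_add_of_nonneg_left (by positivity))
    refine (eLpNorm_mono_real h1).trans ((eLpNorm_add_le
      ((aesm_hline hL.holo hy).norm.const_mul _) hind.1 (by norm_num)).trans ?_)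
    push_cast
    rw [ENNReal.coe_toNNReal hind.eLpNorm_ne_top]
    gcongr
    refine (eLpNorm_le_mul_eLpNorm_of_ae_le_mul (g := hline L y) (c := δ⁻¹)
      (Eventually.of_forall fun x => ?_) 2).trans (mul_le_mul_right (hN y hy) _)
    rw [norm_mul, norm_norm, Real.norm_of_nonneg (by positivity)]
  · have h1 : Tendsto (fun y : ℝ => eLpNorm (fun x : ℝ =>
        (1 / (x + y * I - a) - 1 / (x - a)) * l x) 2 volume) (𝓝[>] 0) (𝓝 0) := by
      refine tendsto_eLpNorm_two_of_dominated (b := fun x => 2 * δ⁻¹ * ‖l x‖)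
        ((Lp.memLp l).norm.const_mul _) ?_ ?_ fun x => ?_
      · filter_upwards [Ioo_mem_nhdsGT hδ0] with y hy
        refine (Continuous.aestronglyMeasurable ?_).mul (Lp.aestronglyMeasurable l)
        refine Continuous.sub (Continuous.div (by fun_prop) (by fun_prop) fun x =>
          sub_ne_zero.2 (hne _ (hlow _ ?_))) (Continuous.div (by fun_prop) (by fun_prop) fun x =>
          sub_ne_zero.2 (hne x (hlow x (by simpa using hδ0.le))))
        simpa using hy.2.le
      · filter_upwards [Ioo_mem_nhdsGT hδ0] with y hy x
        rw [norm_mul]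
        refine mul_le_mul_of_nonneg_right ((norm_sub_le _ _).trans ?_) (norm_nonneg _)
        have h2 := hfar (x + y * I) 1 (hlow _ (by simpa using hy.2.le))
        have h3 := hfar x 1 (hlow x (by simpa using hδ0.le))
        rw [norm_one, mul_one] at h2 h3
        linarith
      · have h2 : Tendsto (fun y : ℝ => 1 / ((x : ℂ) + y * I - a)) (𝓝[>] 0) (𝓝 (1 / (x - a))) := by
          refine tendsto_const_nhds.div ?_
            (sub_ne_zero.2 (hne x (hlow x (by simpa using hδ0.le))))
          exact (Continuous.tendsto' (by fun_prop) _ _ (by simp)).mono_left nhdsWithin_le_nhds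
        simpa using (h2.sub_const (1 / ((x : ℂ) - a))).mul_const (l x)
    have h2 : Tendsto (fun y : ℝ => ENNReal.ofReal δ⁻¹ *
        eLpNorm (fun x => hline L y x - l x) 2 volume +
        eLpNorm (fun x : ℝ => (1 / (x + y * I - a) - 1 / (x - a)) * l x) 2 volume)
        (𝓝[>] 0) (𝓝 0) := by
      have h3 := (ENNReal.Tendsto.const_mul (a := ENNReal.ofReal δ⁻¹) hl
        (Or.inr ENNReal.ofReal_ne_top)).add h1
      simpa using h3
    refine tendsto_of_tendsto_of_tendsto_of_le_of_le' tendsto_const_nhds h2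
      (Eventually.of_forall fun _ => bot_le) ?_
    filter_upwards [Ioo_mem_nhdsGT hδ0] with y hy
    have hfy : ∀ x : ℝ, δ ≤ ‖(x + y * I : ℂ) - a‖ := fun x => hlow _ (by simpa using hy.2.le)
    have m1 := (aesm_hline hL.holo hy.1).sub (Lp.aestronglyMeasurable l)
    have c1 : Continuous fun x : ℝ => 1 / ((x : ℂ) + y * I - a) :=
      Continuous.div (by fun_prop) (by fun_prop) fun x => sub_ne_zero.2 (hne _ (hfy x))
    have c2 : Continuous fun x : ℝ => 1 / ((x : ℂ) - a) :=
      Continuous.div (by fun_prop) (by fun_prop) fun x =>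
          sub_ne_zero.2 (hne x (hlow x (by simpa using hδ0.le)))
    have e : (fun x => hline M y x - l x / (x - a)) =
        (fun x : ℝ => (1 / ((x : ℂ) + y * I - a)) * (hline L y x - l x)) +
          fun x : ℝ => (1 / (x + y * I - a) - 1 / (x - a)) * l x := by
      funext x
      simp only [hline, Pi.add_apply]
      rw [hMz _ (hne _ (hfy x))]
      ring
    rw [e]
    refine (eLpNorm_add_le (c1.aestronglyMeasurable.mul m1) ((c1.sub c2).aestronglyMeasurable.mul
      (Lp.aestronglyMeasurable l)) (by norm_num)).trans ?_
    refine add_le_add ?_ le_rfl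
    refine eLpNorm_le_mul_eLpNorm_of_ae_le_mul (Eventually.of_forall fun x => ?_) 2
    rw [Pi.mul_apply, Pi.sub_apply, one_div_mul_eq_div]
    exact hfar _ _ (hfy x)

/-! ### Proper fractions with poles in the lower half-plane. -/

section RationalFunctions

open Polynomial

theorem exists_decay_of_degree_lt {p q : ℂ[X]} (hpq : p.degree < q.degree)
    (hq : ∀ z ∈ closedUpperHalf, q.eval z ≠ 0) :
    ∃ C : ℝ, ∀ z ∈ closedUpperHalf,
      ‖p.eval z / q.eval z‖ ≤ C * (1 + z.re ^ 2) ^ (-(1 / 2) : ℝ) := by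
  have hq0 : q ≠ 0 := fun h => by simp [h] at hpq
  have hdeg : (X * p).degree ≤ q.degree := by
    rw [degree_mul, degree_X, add_comm]
    rcases eq_or_ne p 0 with h0 | h0
    · simp [h0]
    · rw [degree_eq_natDegree hq0] at hpq ⊢
      rw [degree_eq_natDegree h0] at hpq ⊢
      exact_mod_cast hpq
  obtain ⟨C₁, hC₁⟩ := (isBigO_cobounded_of_degree_le hdeg).bound
  obtain ⟨R, hR⟩ := (Metric.hasBasis_cobounded_compl_closedBall (0 : ℂ)).eventually_iff.1 hC₁
  have hK : IsCompact (Metric.closedBall (0 : ℂ) (max R 1) ∩ closedUpperHalf) :=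
    (isCompact_closedBall _ _).inter_right (isClosed_le continuous_const Complex.continuous_im)
  obtain ⟨C₂, hC₂⟩ := hK.exists_bound_of_continuousOn (f := fun z => p.eval z / q.eval z)
    fun z hz => (p.continuous.continuousAt.div q.continuous.continuousAt
      (hq z hz.2)).continuousWithinAt
  set S := max R 1 with hS
  have hS1 : 1 ≤ S := le_max_right _ _
  -- Since √(1 + x²) ≤ 1 + |z|, the weight costs at most 1 + S inside the ball, and at most 2|z|
  -- outside it because S ≥ 1. There z p/q is bounded by |C₁|.
  refine ⟨max (2 * |C₁|) (|C₂| * (1 + S)), fun z hz => ?_⟩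
  have hsqrt : (1 + z.re ^ 2) ^ (-(1 / 2) : ℝ) = (Real.sqrt (1 + z.re ^ 2))⁻¹ := by
    rw [Real.rpow_neg (by positivity), Real.sqrt_eq_rpow]
  have hpos : 0 < Real.sqrt (1 + z.re ^ 2) := Real.sqrt_pos.2 (by positivity)
  rw [hsqrt, ← div_eq_mul_inv, le_div_iff₀ hpos]
  have hsq : Real.sqrt (1 + z.re ^ 2) ≤ 1 + ‖z‖ := by
    refine Real.sqrt_le_iff.2 ⟨by positivity, ?_⟩
    have h1 : z.re ^ 2 ≤ ‖z‖ ^ 2 := by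
      rw [← sq_abs z.re]
      exact pow_le_pow_left₀ (abs_nonneg _) (Complex.abs_re_le_norm z) 2
    nlinarith [norm_nonneg z]
  by_cases hz' : z ∈ Metric.closedBall (0 : ℂ) S
  · refine le_trans ?_ (le_max_right _ _)
    have h1 := hC₂ z ⟨hz', hz⟩
    have h2 : ‖z‖ ≤ S := by simpa using hz'
    exact mul_le_mul (h1.trans (le_abs_self _)) (hsq.trans (by linarith)) hpos.le (abs_nonneg _)
  · refine le_trans ?_ (le_max_left _ _)
    have hzS : S < ‖z‖ := by simpa using hz'
    have h1 := hR.2 (show z ∈ (Metric.closedBall (0 : ℂ) R)ᶜ by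
      simp only [mem_compl_iff, Metric.mem_closedBall, dist_zero_right, not_le]
      exact (le_max_left _ _).trans_lt hzS)
    simp only [eval_mul, eval_X, norm_mul] at h1
    have hd : 0 < ‖q.eval z‖ := norm_pos_iff.2 (hq z hz)
    have h3 : ‖z‖ * ‖p.eval z / q.eval z‖ ≤ |C₁| := by
      rw [norm_div, ← mul_div_assoc, div_le_iff₀ hd]
      exact h1.trans (mul_le_mul_of_nonneg_right (le_abs_self _) hd.le)
    nlinarith [norm_nonneg (p.eval z / q.eval z)]

theorem differentiableOn_eval_div {p q : ℂ[X]} (hq : ∀ z ∈ closedUpperHalf, q.eval z ≠ 0) :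
    DifferentiableOn ℂ (fun z => p.eval z / q.eval z) closedUpperHalf :=
  p.differentiable.differentiableOn.div q.differentiable.differentiableOn hq

theorem isHardy_eval_div {p q : ℂ[X]} (hpq : p.degree < q.degree)
    (hq : ∀ z ∈ closedUpperHalf, q.eval z ≠ 0) :
    IsHardy (fun z => p.eval z / q.eval z) ∧
      HasBoundary (fun z => p.eval z / q.eval z) (fun x : ℝ => p.eval (x : ℂ) / q.eval (x : ℂ))
        := by
  obtain ⟨C, hC⟩ := exists_decay_of_degree_lt hpq hq
  exact isHardy_of_decay (differentiableOn_eval_div hq).continuousOn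
    ((differentiableOn_eval_div hq).mono upperHalf_subset_closedUpperHalf) hC

theorem memLp_two_eval_div {p q : ℂ[X]} (hpq : p.degree < q.degree)
    (hq : ∀ z ∈ closedUpperHalf, q.eval z ≠ 0) :
    MemLp (fun x : ℝ => p.eval (x : ℂ) / q.eval (x : ℂ)) 2 volume := by
  obtain ⟨C, hC⟩ := exists_decay_of_degree_lt hpq hq
  exact memLp_two_of_decay (F := fun z => p.eval z / q.eval z)
    (differentiableOn_eval_div hq).continuousOn hC

theorem exists_eval_div_mul_mem_hardySpace {p q : ℂ[X]} (hpq : p.degree < q.degree)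
    (hq : ∀ z ∈ closedUpperHalf, q.eval z ≠ 0) {f : L2R} (hf : f ∈ hardySpace) :
    ∃ g ∈ hardySpace, g =ᵐ[volume] fun x : ℝ => p.eval (x : ℂ) / q.eval (x : ℂ) * f x := by
  obtain ⟨C, hC⟩ := exists_decay_of_degree_lt hpq hq
  have hC0 : 0 ≤ C := by
    have h1 := (norm_nonneg _).trans (hC 0 (by simp [closedUpperHalf]))
    simpa using h1
  refine exists_mul_mem_hardySpace (φ := fun z => p.eval z / q.eval z) (C := C)
    (differentiableOn_eval_div hq).continuousOn
    ((differentiableOn_eval_div hq).mono upperHalf_subset_closedUpperHalf) (fun z hz => ?_) hf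
  refine (hC z hz).trans (mul_le_of_le_one_right hC0
    (Real.rpow_le_one_of_one_le_of_nonpos ?_ (by norm_num)))
  nlinarith [sq_nonneg z.re]

theorem eval_X_sub_C_conj_ne_zero {a : ℂ} (ha : 0 < a.im) {z : ℂ} (hz : z ∈ closedUpperHalf) :
    (X - C (conj a)).eval z ≠ 0 := by
  intro h
  have h1 := congrArg Complex.im h
  have h2 : 0 ≤ z.im := hz
  simp at h1
  linarith

/-- Each function in `H²` is the sum of a multiple of the reproducing kernel at `a` and of a
multiple of the Blaschke factor with zero `a`. -/
theorem exists_eq_kernel_add_blaschke_mul {f : L2R} (hf : f ∈ hardySpace) {a : ℂ} (ha : 0 < a.im) :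
    ∃ c : ℂ, ∃ g ∈ hardySpace,
      f =ᵐ[volume] fun x : ℝ => c / (x - conj a) + (x - a) / (x - conj a) * g x := by
  obtain ⟨F, hF, hb⟩ := hf
  -- This is the value for which F - c/(z - ā) vanishes at a.
  set c := F a * (a - conj a) with hc
  have hdeg : (C (-c)).degree < (X - C (conj a)).degree := by
    rw [degree_X_sub_C]
    exact degree_C_le.trans_lt (by norm_num)
  obtain ⟨hk, hkb⟩ := isHardy_eval_div hdeg fun z => eval_X_sub_C_conj_ne_zero ha
  have hkm := memLp_two_eval_div hdeg fun z => eval_X_sub_C_conj_ne_zero ha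
  have hne : ∀ x : ℝ, (x : ℂ) - conj a ≠ 0 := fun x => by
    simpa using eval_X_sub_C_conj_ne_zero ha (ofReal_mem_closedUpperHalf x)
  have hne' : ∀ x : ℝ, (x : ℂ) - a ≠ 0 := fun x h => by
    have h1 := congrArg Complex.im h
    simp at h1
    linarith
  have haa : a - conj a ≠ 0 := fun h => by
    have h1 := congrArg Complex.im h
    simp at h1
    linarith
  set l : L2R := f + hkm.toLp with hl
  have hlb : HasBoundary (F + fun z => (C (-c)).eval z / (X - C (conj a)).eval z) l := by
    refine (hb.add hF hk (Lp.aestronglyMeasurable f) hkm.1 hkb).congr ?_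
    filter_upwards [Lp.coeFn_add f hkm.toLp, hkm.coeFn_toLp] with x h1 h2
    rw [h1, Pi.add_apply, Pi.add_apply, h2]
  obtain ⟨m, hm, hml⟩ := exists_div_mem_hardySpace (hF.add hk) hlb ha (by
    simp only [Pi.add_apply, eval_C, eval_sub, eval_X, hc]
    field_simp
    ring)
  -- With m = l/(x - a), this is (x - ā) m = (x - a) m + (a - ā) m, a form that visibly stays in H².
  refine ⟨c, l + (a - conj a) • m, hardySpace.add_mem ⟨_, hF.add hk, hlb⟩
    (hardySpace.smul_mem _ hm), ?_⟩
  filter_upwards [hml, Lp.coeFn_add f hkm.toLp, hkm.coeFn_toLp,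
    Lp.coeFn_add l ((a - conj a) • m), Lp.coeFn_smul (a - conj a) m] with x h1 h2 h3 h4 h5
  rw [h4, Pi.add_apply, h5, Pi.smul_apply, h1, h2, Pi.add_apply, h3]
  simp only [eval_C, eval_sub, eval_X, smul_eq_mul]
  have := hne x
  have := hne' x
  field_simp
  ring

end RationalFunctions

/-! ### Pairings with Hankel operators. -/

theorem inner_L2R (f g : L2R) : ⟪f, g⟫_ℂ = ∫ x, conj (f x) * g x := by
  rw [L2.inner_def]
  exact integral_congr_ae (Eventually.of_forall fun x => by
    simp only [RCLike.inner_apply]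
    exact mul_comm _ _)

theorem inner_hardySpace (f g : hardySpace) : ⟪f, g⟫_ℂ = ∫ x, conj ((f : L2R) x) * (g : L2R) x :=
  inner_L2R f g

theorem inner_conjL2_eq_zero {f g : L2R} (hf : f ∈ hardySpace) (hg : g ∈ hardySpace) :
    ⟪f, conjL2 g⟫_ℂ = 0 := by
  have h1 := congrArg conj (integral_mul_eq_zero hf hg)
  rw [← integral_conj, map_zero] at h1
  rw [inner_L2R, ← h1]
  refine integral_congr_ae ?_
  filter_upwards [coeFn_conjL2 g] with x hx
  rw [hx, map_mul]

theorem inner_szegoProj (f : hardySpace) (g : L2R) : ⟪f, szegoProj g⟫_ℂ = ⟪(f : L2R), g⟫_ℂ :=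
  Submodule.inner_orthogonalProjectionOnto_eq_of_mem_left f g

theorem inner_hankel (φ : LinfR) (f g : hardySpace) :
    ⟪f, hankel φ g⟫_ℂ = ∫ x, φ x * (conj ((f : L2R) x) * conj ((g : L2R) x)) := by
  refine (inner_szegoProj f _).trans ?_
  rw [inner_L2R]
  refine integral_congr_ae ?_
  filter_upwards [coeFn_mulL2 φ (conjL2 g), coeFn_conjL2 (g : L2R)] with x h1 h2
  change conj ((f : L2R) x) * (mulL2 φ (conjL2 (g : L2R))) x = _
  rw [h1, h2]
  ring

theorem inner_hankel_comm (φ : LinfR) (f g : hardySpace) :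
    ⟪f, hankel φ g⟫_ℂ = ⟪g, hankel φ f⟫_ℂ := by
  rw [inner_hankel, inner_hankel]
  exact integral_congr_ae (Eventually.of_forall fun x => by
    simp only [mul_comm (conj ((f : L2R) x))])

/-- The conjugate of h is orthogonal to H², so the projection discards it. This reduces each
evaluation of the Hankel operator to an algebraic splitting on the real line. -/
theorem hankel_eq_of_ae {φ : LinfR} {f v h : hardySpace}
    (hfv : ∀ᵐ x, φ x * conj ((f : L2R) x) = (v : L2R) x + conj ((h : L2R) x)) :
    hankel φ f = v := by
  have h1 : mulL2 φ (conjL2 (f : L2R)) = (v : L2R) + conjL2 (h : L2R) := by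
    apply Lp.ext
    filter_upwards [hfv, coeFn_mulL2 φ (conjL2 f), coeFn_conjL2 (f : L2R), coeFn_conjL2 (h : L2R),
      Lp.coeFn_add (v : L2R) (conjL2 (h : L2R))] with x h1 h2 h3 h4 h5
    rw [h2, h3, h1, h5, Pi.add_apply, h4]
  refine ext_inner_left ℂ fun k => ?_
  refine (inner_szegoProj k _).trans ?_
  change ⟪(k : L2R), mulL2 φ (conjL2 (f : L2R))⟫_ℂ = _
  rw [h1, inner_add_right, inner_conjL2_eq_zero k.2 h.2, add_zero]
  rfl

/-! ### Numerators and denominators of Blaschke products, and the space of fractions p/D. -/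

section ModelSpace

open Polynomial

/-- The denominator of the finite Blaschke product with the given zeros. -/
noncomputable def blaschkeDenom (s : Multiset UpperHalfPlane) : ℂ[X] :=
  (s.map fun a : UpperHalfPlane => X - C (conj (a : ℂ))).prod

/-- The numerator of the finite Blaschke product with the given zeros. -/
noncomputable def blaschkeNum (s : Multiset UpperHalfPlane) : ℂ[X] :=
  (s.map fun a : UpperHalfPlane => X - C (a : ℂ)).prod

theorem monic_blaschkeDenom (s : Multiset UpperHalfPlane) : (blaschkeDenom s).Monic :=
  monic_multiset_prod_of_monic _ _ fun _ _ => monic_X_sub_C _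

theorem monic_blaschkeNum (s : Multiset UpperHalfPlane) : (blaschkeNum s).Monic :=
  monic_multiset_prod_of_monic _ _ fun _ _ => monic_X_sub_C _

theorem natDegree_blaschkeDenom (s : Multiset UpperHalfPlane) :
    (blaschkeDenom s).natDegree = Multiset.card s := by
  rw [blaschkeDenom, natDegree_multiset_prod_of_monic _ (by
    intro f hf
    obtain ⟨a, _, rfl⟩ := Multiset.mem_map.1 hf
    exact monic_X_sub_C _)]
  simp

theorem natDegree_blaschkeNum (s : Multiset UpperHalfPlane) :
    (blaschkeNum s).natDegree = Multiset.card s := by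
  rw [blaschkeNum, natDegree_multiset_prod_of_monic _ (by
    intro f hf
    obtain ⟨a, _, rfl⟩ := Multiset.mem_map.1 hf
    exact monic_X_sub_C _)]
  simp

theorem degree_blaschkeDenom (s : Multiset UpperHalfPlane) :
    (blaschkeDenom s).degree = Multiset.card s := by
  rw [degree_eq_natDegree (monic_blaschkeDenom s).ne_zero, natDegree_blaschkeDenom]

theorem degree_blaschkeNum (s : Multiset UpperHalfPlane) :
    (blaschkeNum s).degree = Multiset.card s := by
  rw [degree_eq_natDegree (monic_blaschkeNum s).ne_zero, natDegree_blaschkeNum]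

theorem map_conj_blaschkeDenom (s : Multiset UpperHalfPlane) :
    (blaschkeDenom s).map (starRingEnd ℂ) = blaschkeNum s := by
  rw [blaschkeDenom, blaschkeNum, Polynomial.map_multiset_prod, Multiset.map_map]
  simp

theorem map_conj_blaschkeNum (s : Multiset UpperHalfPlane) :
    (blaschkeNum s).map (starRingEnd ℂ) = blaschkeDenom s := by
  rw [blaschkeDenom, blaschkeNum, Polynomial.map_multiset_prod, Multiset.map_map]
  simp

theorem conj_eval_ofReal (p : ℂ[X]) (x : ℝ) :
    conj (p.eval (x : ℂ)) = (p.map (starRingEnd ℂ)).eval (x : ℂ) := by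
  conv_rhs => rw [← conj_ofReal x, eval_map_apply]

theorem degree_map_conj (p : ℂ[X]) : (p.map (starRingEnd ℂ)).degree = p.degree :=
  degree_map p _

theorem eval_blaschkeDenom_ne_zero (s : Multiset UpperHalfPlane) {z : ℂ}
    (hz : z ∈ closedUpperHalf) : (blaschkeDenom s).eval z ≠ 0 := by
  rw [blaschkeDenom, eval_multiset_prod, Multiset.map_map]
  refine Multiset.prod_ne_zero fun h => ?_
  obtain ⟨a, _, ha⟩ := Multiset.mem_map.1 h
  exact eval_X_sub_C_conj_ne_zero a.im_pos hz ha

theorem eval_blaschkeNum_ofReal_ne_zero (s : Multiset UpperHalfPlane) (x : ℝ) :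
    (blaschkeNum s).eval (x : ℂ) ≠ 0 := by
  rw [← map_conj_blaschkeDenom, ← conj_eval_ofReal]
  exact (_root_.map_ne_zero _).2 (eval_blaschkeDenom_ne_zero s (ofReal_mem_closedUpperHalf x))

/-- The roots of the numerator lie in the upper half-plane, those of the denominator in the lower
one. -/
theorem isCoprime_blaschke (s : Multiset UpperHalfPlane) :
    IsCoprime (blaschkeNum s) (blaschkeDenom s) := by
  rw [Polynomial.isCoprime_iff_aeval_ne_zero_of_isAlgClosed ℂ ℂ]
  intro z
  simp only [coe_aeval_eq_eval]
  by_cases hz : 0 ≤ z.im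
  · exact Or.inr (eval_blaschkeDenom_ne_zero s hz)
  · left
    rw [blaschkeNum, eval_multiset_prod, Multiset.map_map]
    refine Multiset.prod_ne_zero fun h => ?_
    obtain ⟨a, _, ha⟩ := Multiset.mem_map.1 h
    have h1 : z = a := by simpa [sub_eq_zero] using ha
    exact hz (h1 ▸ a.im_pos.le)

theorem FiniteBlaschke.eval_eq (θ : FiniteBlaschke) (z : ℂ) :
    θ.eval z = θ.const * ((blaschkeNum θ.zeros).eval z / (blaschkeDenom θ.zeros).eval z) := by
  rw [FiniteBlaschke.eval, blaschkeNum, blaschkeDenom, eval_multiset_prod, eval_multiset_prod,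
    Multiset.map_map, Multiset.map_map, Multiset.prod_map_div]
  simp

variable (s : Multiset UpperHalfPlane)

theorem degree_lt_blaschkeDenom (p : degreeLT ℂ (Multiset.card s)) :
    (p : ℂ[X]).degree < (blaschkeDenom s).degree := by
  rw [degree_blaschkeDenom]
  exact mem_degreeLT.1 p.2

theorem memLp_fraction (p : degreeLT ℂ (Multiset.card s)) :
    MemLp (fun x : ℝ => (p : ℂ[X]).eval (x : ℂ) / (blaschkeDenom s).eval (x : ℂ)) 2 volume :=
  memLp_two_eval_div (degree_lt_blaschkeDenom s p) fun _ => eval_blaschkeDenom_ne_zero s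

/-- The proper fractions with the denominator of a finite Blaschke product, as functions in the
Hardy space. -/
noncomputable def fraction : degreeLT ℂ (Multiset.card s) →ₗ[ℂ] hardySpace where
  toFun p := ⟨(memLp_fraction s p).toLp, toLp_mem_hardySpace (isHardy_eval_div
    (degree_lt_blaschkeDenom s p) fun _ => eval_blaschkeDenom_ne_zero s) _⟩
  map_add' p q := by
    refine Subtype.ext (Lp.ext ?_)
    filter_upwards [(memLp_fraction s (p + q)).coeFn_toLp, (memLp_fraction s p).coeFn_toLp,
      (memLp_fraction s q).coeFn_toLp, Lp.coeFn_add (memLp_fraction s p).toLp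
      (memLp_fraction s q).toLp] with x h1 h2 h3 h4
    refine h1.trans (Eq.symm (h4.trans ?_))
    rw [Pi.add_apply, h2, h3]
    simp [add_div]
  map_smul' c p := by
    refine Subtype.ext (Lp.ext ?_)
    filter_upwards [(memLp_fraction s (c • p)).coeFn_toLp, (memLp_fraction s p).coeFn_toLp,
      Lp.coeFn_smul c (memLp_fraction s p).toLp] with x h1 h2 h3
    refine h1.trans (Eq.symm (h3.trans ?_))
    rw [Pi.smul_apply, h2]
    simp [mul_div_assoc]

theorem coeFn_fraction (p : degreeLT ℂ (Multiset.card s)) :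
    (fraction s p : L2R) =ᵐ[volume]
      fun x : ℝ => (p : ℂ[X]).eval (x : ℂ) / (blaschkeDenom s).eval (x : ℂ) :=
  (memLp_fraction s p).coeFn_toLp

theorem continuous_eval_div_ofReal (p : ℂ[X]) :
    Continuous fun x : ℝ => p.eval (x : ℂ) / (blaschkeDenom s).eval (x : ℂ) :=
  continuous_comp_ofReal (F := fun z => p.eval z / (blaschkeDenom s).eval z)
    (differentiableOn_eval_div fun _ => eval_blaschkeDenom_ne_zero s).continuousOn

theorem fraction_injective : Function.Injective (fraction s) := by
  rw [← LinearMap.ker_eq_bot, LinearMap.ker_eq_bot']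
  intro p hp
  have h1 : (fun x : ℝ => (p : ℂ[X]).eval (x : ℂ) / (blaschkeDenom s).eval (x : ℂ)) =ᵐ[volume]
      fun _ => 0 := by
    filter_upwards [coeFn_fraction s p, Lp.coeFn_zero ℂ 2 (volume : Measure ℝ)] with x h2 h3
    rw [← h2, hp]
    exact h3
  have h2 := ((continuous_eval_div_ofReal s p).ae_eq_iff_eq volume continuous_const).1 h1
  refine Subtype.ext (eq_of_infinite_eval_eq _ _ ?_)
  refine (infinite_range_of_injective ofReal_injective).mono ?_
  rintro _ ⟨x, rfl⟩
  simpa [eval_blaschkeDenom_ne_zero s (ofReal_mem_closedUpperHalf x)] using congrFun h2 x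

/-- Multiplication by `X` followed by reduction modulo the denominator. -/
noncomputable def mulXMod :
    degreeLT ℂ (Multiset.card s) →ₗ[ℂ] degreeLT ℂ (Multiset.card s) where
  toFun p := ⟨X * (p : ℂ[X]) - C ((p : ℂ[X]).coeff (Multiset.card s - 1)) * blaschkeDenom s, by
    rw [mem_degreeLT, degree_lt_iff_coeff_zero]
    intro k hk
    have hp : ∀ j, Multiset.card s ≤ j → (p : ℂ[X]).coeff j = 0 :=
      (degree_lt_iff_coeff_zero _ _).1 (mem_degreeLT.1 p.2)
    rw [coeff_sub, coeff_C_mul]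
    rcases k with _ | j
    -- Here `hk` forces the multiset to be empty. The truncated index `card s - 1` is then 0, and
    -- that coefficient of p is zero.
    · rw [hp (Multiset.card s - 1) (by omega)]
      simp
    · rw [coeff_X_mul]
      rcases eq_or_lt_of_le hk with h | h
      · have h1 : (blaschkeDenom s).coeff (j + 1) = 1 := by
          rw [← h, ← natDegree_blaschkeDenom s]
          exact monic_blaschkeDenom s
        rw [h1, show Multiset.card s - 1 = j by omega]
        simp
      · have h1 : (blaschkeDenom s).coeff (j + 1) = 0 :=
          coeff_eq_zero_of_natDegree_lt (by rwa [natDegree_blaschkeDenom])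
        rw [hp j (by omega), h1]
        simp⟩
  map_add' p q := by
    refine Subtype.ext ?_
    simp
    ring
  map_smul' c p := by
    refine Subtype.ext ?_
    simp [mul_sub, smul_eq_C_mul]
    ring

/-- The leading coefficient of the numerator of a proper fraction. -/
noncomputable def topCoeff : degreeLT ℂ (Multiset.card s) →ₗ[ℂ] ℂ :=
  (lcoeff ℂ (Multiset.card s - 1)).comp (degreeLT ℂ (Multiset.card s)).subtype

theorem mul_eval_div (p : degreeLT ℂ (Multiset.card s)) {z : ℂ} (hz : z ∈ closedUpperHalf) :
    z * ((p : ℂ[X]).eval z / (blaschkeDenom s).eval z) =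
      topCoeff s p + (mulXMod s p : ℂ[X]).eval z / (blaschkeDenom s).eval z := by
  have := eval_blaschkeDenom_ne_zero s hz
  simp only [mulXMod, topCoeff, LinearMap.coe_mk, AddHom.coe_mk, eval_sub, eval_mul, eval_X, eval_C,
    LinearMap.comp_apply, Submodule.subtype_apply, lcoeff_apply]
  field_simp
  ring

theorem eq_zero_of_mulXMod_eq_smul {p : degreeLT ℂ (Multiset.card s)} {μ : ℂ}
    (h : mulXMod s p = μ • p) (hc : topCoeff s p = 0) : p = 0 := by
  have h1 := congrArg Subtype.val h
  have hc' : (p : ℂ[X]).coeff (Multiset.card s - 1) = 0 := hc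
  simp only [mulXMod, LinearMap.coe_mk, AddHom.coe_mk, hc', C_0, zero_mul, sub_zero,
    Submodule.coe_smul, smul_eq_C_mul] at h1
  have h2 : (X - C μ) * (p : ℂ[X]) = 0 := by rw [sub_mul, h1, sub_self]
  exact Subtype.ext ((mul_eq_zero.1 h2).resolve_left (X_sub_C_ne_zero μ))

/-- This is H² = K_θ + θH², obtained by splitting off one Blaschke factor at a time; each factor
adds one kernel term to the fraction. -/
theorem exists_fraction_add_blaschke_mul (f : hardySpace) :
    ∃ (p : degreeLT ℂ (Multiset.card s)) (g : hardySpace), (f : L2R) =ᵐ[volume] fun x : ℝ =>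
      (p : ℂ[X]).eval (x : ℂ) / (blaschkeDenom s).eval (x : ℂ) +
        (blaschkeNum s).eval (x : ℂ) / (blaschkeDenom s).eval (x : ℂ) * (g : L2R) x := by
  induction s using Multiset.induction_on with
  | empty => exact ⟨0, f, by simp [blaschkeNum, blaschkeDenom]⟩
  | cons a s ih =>
    obtain ⟨p, g, h⟩ := ih
    obtain ⟨c, k, hk, hgk⟩ := exists_eq_kernel_add_blaschke_mul g.2 a.im_pos
    have hD : blaschkeDenom (a ::ₘ s) = (X - C (conj (a : ℂ))) * blaschkeDenom s := by
      simp [blaschkeDenom]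
    have hN : blaschkeNum (a ::ₘ s) = (X - C (a : ℂ)) * blaschkeNum s := by
      simp [blaschkeNum]
    refine ⟨⟨(X - C (conj (a : ℂ))) * (p : ℂ[X]) + c • blaschkeNum s, ?_⟩, ⟨k, hk⟩, ?_⟩
    · rw [mem_degreeLT, Multiset.card_cons]
      refine (degree_add_le _ _).trans_lt (max_lt ?_ ?_)
      · rw [degree_mul, degree_X_sub_C, Nat.cast_add, add_comm, Nat.cast_one]
        exact WithBot.add_lt_add_right (by simp) (mem_degreeLT.1 p.2)
      · refine (degree_smul_le _ _).trans_lt ?_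
        rw [degree_blaschkeNum]
        exact_mod_cast Nat.lt_succ_self _
    · filter_upwards [h, hgk] with x h1 h2
      rw [h1, h2, hD, hN]
      have h3 := eval_blaschkeDenom_ne_zero s (ofReal_mem_closedUpperHalf x)
      have h4 : (x : ℂ) - conj (a : ℂ) ≠ 0 := by
        simpa using eval_X_sub_C_conj_ne_zero a.im_pos (ofReal_mem_closedUpperHalf x)
      simp only [eval_mul, eval_add, eval_sub, eval_X, eval_C, eval_smul, smul_eq_mul]
      field_simp
      ring

end ModelSpace

/-! ### Identification of the model space with the space of fractions. -/

section ModelSpace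

open Polynomial

theorem coeFn_mulL2_blaschke (θ : FiniteBlaschke) (g : L2R) :
    mulL2 θ.toLinf g =ᵐ[volume] fun x : ℝ => (θ.const : ℂ) *
      ((blaschkeNum θ.zeros).eval (x : ℂ) / (blaschkeDenom θ.zeros).eval (x : ℂ)) * g x := by
  filter_upwards [coeFn_mulL2 θ.toLinf g, θ.memLp_eval.coeFn_toLp] with x h1 h2
  rw [h1, ← θ.eval_eq]
  exact congrArg (· * g x) h2

theorem FiniteBlaschke.mem_modelSpace {θ : FiniteBlaschke} {f : hardySpace} :
    f ∈ θ.modelSpace ↔ ∀ g ∈ hardySpace, ⟪mulL2 θ.toLinf g, (f : L2R)⟫_ℂ = 0 := by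
  simp only [modelSpace, Submodule.mem_comap, Submodule.mem_orthogonal, Submodule.mem_map,
    forall_exists_index, and_imp, forall_apply_eq_imp_iff₂]
  rfl

/-- The model space of a finite Blaschke product consists of proper fractions. -/
theorem FiniteBlaschke.modelSpace_eq (θ : FiniteBlaschke) :
    θ.modelSpace = LinearMap.range (fraction θ.zeros) := by
  have hle : LinearMap.range (fraction θ.zeros) ≤ θ.modelSpace := by
    rintro _ ⟨p, rfl⟩
    rw [mem_modelSpace]
    intro g hg
    have hq : (((p : ℂ[X]).map (starRingEnd ℂ))).degree < (Multiset.card θ.zeros : WithBot ℕ) := by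
      rw [degree_map_conj]
      exact mem_degreeLT.1 p.2
    set q : degreeLT ℂ (Multiset.card θ.zeros) := ⟨_, mem_degreeLT.2 hq⟩
    have h1 := congrArg conj (integral_mul_eq_zero hg (fraction θ.zeros q).2)
    rw [← integral_conj, map_zero] at h1
    rw [inner_L2R]
    -- On the real line the conjugate of N/D is D/N, so conj(θ) p/D is a constant times p/N. With q
    -- obtained from p by conjugating coefficients, p/N = conj(q/D), and a conjugated product of two
    -- H² functions remains.
    have h2 : ∫ x, conj (mulL2 θ.toLinf g x) * (fraction θ.zeros p : L2R) x =
        ∫ x, conj (θ.const : ℂ) * conj (g x * (fraction θ.zeros q : L2R) x) := by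
      refine integral_congr_ae ?_
      filter_upwards [coeFn_mulL2_blaschke θ g, coeFn_fraction θ.zeros p,
        coeFn_fraction θ.zeros q] with x h2 h3 h4
      rw [h2, h3, h4]
      have hd := eval_blaschkeDenom_ne_zero θ.zeros (ofReal_mem_closedUpperHalf x)
      have hn := eval_blaschkeNum_ofReal_ne_zero θ.zeros x
      simp only [map_mul, map_div₀, q]
      rw [← conj_eval_ofReal, conj_conj, conj_eval_ofReal, conj_eval_ofReal,
        map_conj_blaschkeDenom, map_conj_blaschkeNum]
      field_simp
    rw [h2, integral_const_mul, h1, mul_zero]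
  refine le_antisymm (fun f hf => ?_) hle
  obtain ⟨p, g, hpg⟩ := exists_fraction_add_blaschke_mul θ.zeros f
  refine ⟨p, ?_⟩
  have hw : ((f - fraction θ.zeros p : hardySpace) : L2R) =
      mulL2 θ.toLinf ((θ.const : ℂ)⁻¹ • (g : L2R)) := by
    apply Lp.ext
    filter_upwards [hpg, coeFn_fraction θ.zeros p, coeFn_mulL2_blaschke θ ((θ.const : ℂ)⁻¹ • (g :
      L2R)),
      Lp.coeFn_smul (θ.const : ℂ)⁻¹ (g : L2R),
      Lp.coeFn_sub (f : L2R) (fraction θ.zeros p : L2R)] with x h1 h2 h3 h4 h5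
    refine h5.trans ?_
    have hc : (θ.const : ℂ) ≠ 0 := Circle.coe_ne_zero _
    rw [h3, h4, Pi.sub_apply, Pi.smul_apply, h1, h2, smul_eq_mul]
    field_simp
    ring
  -- The remainder lies in K_θ and in θH², hence is orthogonal to itself.
  have h0 := mem_modelSpace.1 (θ.modelSpace.sub_mem hf (hle ⟨p, rfl⟩)) _
    (hardySpace.smul_mem (θ.const : ℂ)⁻¹ g.2)
  rw [← hw] at h0
  have h1 : f - fraction θ.zeros p = 0 := inner_self_eq_zero.1 h0
  exact (sub_eq_zero.1 h1).symm

end ModelSpace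

/-! ### The Hankel operator on fractions, and its range. -/

namespace RationalSymbol

open Polynomial

theorem exists_blaschkeDenom_eq (u : RationalSymbol) :
    ∃ s : Multiset UpperHalfPlane, blaschkeDenom s = u.toRatFunc.denom := by
  have hlift : ∀ t : Multiset ℂ, (∀ z ∈ t, z.im < 0) →
      ∃ s : Multiset UpperHalfPlane, blaschkeDenom s = (t.map fun z => X - C z).prod := by
    intro t
    induction t using Multiset.induction_on with
    | empty => exact fun _ => ⟨0, by simp [blaschkeDenom]⟩
    | cons z t ih =>
      intro h
      obtain ⟨s, hs⟩ := ih fun w hw => h w (Multiset.mem_cons_of_mem hw)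
      have hz : 0 < (conj z).im := by
        rw [conj_im]
        linarith [h z (Multiset.mem_cons_self z t)]
      refine ⟨⟨conj z, hz⟩ ::ₘ s, ?_⟩
      rw [Multiset.map_cons, Multiset.prod_cons, ← hs, blaschkeDenom, blaschkeDenom,
        Multiset.map_cons, Multiset.prod_cons]
      congr 3
      exact conj_conj z
  obtain ⟨s, hs⟩ := hlift u.toRatFunc.denom.roots fun z hz => by
    by_contra hcon
    exact u.no_pole z (not_lt.1 hcon) (isRoot_of_mem_roots hz)
  refine ⟨s, hs.trans ?_⟩
  exact ((IsAlgClosed.splits _).eq_prod_roots_of_monic (RatFunc.monic_denom _)).symm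

variable {u : RationalSymbol} {s : Multiset UpperHalfPlane}

/-- The numerator of the symbol. -/
noncomputable def num (u : RationalSymbol) (hs : blaschkeDenom s = u.toRatFunc.denom) :
    degreeLT ℂ (Multiset.card s) :=
  ⟨u.toRatFunc.num, by
    rw [mem_degreeLT, ← degree_blaschkeDenom, hs]
    exact u.degree_lt⟩

theorem coeFn_toLinf (hs : blaschkeDenom s = u.toRatFunc.denom) :
    u.toLinf =ᵐ[volume]
      fun x : ℝ => u.toRatFunc.num.eval (x : ℂ) / (blaschkeDenom s).eval (x : ℂ) := by
  filter_upwards [u.memLp_top.coeFn_toLp] with x hx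
  rw [hs, ← u.eval_eq]
  exact hx

theorem toHardy_eq_fraction (hs : blaschkeDenom s = u.toRatFunc.denom) :
    u.toHardy = fraction s (u.num hs) := by
  refine Subtype.ext (Lp.ext ?_)
  filter_upwards [u.memLp_two.coeFn_toLp, coeFn_fraction s (u.num hs)] with x h1 h2
  rw [h2]
  refine h1.trans ?_
  rw [u.eval_eq, hs]
  rfl

/-- The conjugated Blaschke quotient D/N cancels the denominator of u, and the remaining P/N times
conj(g) is the conjugate of an H² function. -/
theorem hankel_blaschke_mul (hs : blaschkeDenom s = u.toRatFunc.denom) {f g : hardySpace}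
    (hfg : (f : L2R) =ᵐ[volume] fun x : ℝ =>
      (blaschkeNum s).eval (x : ℂ) / (blaschkeDenom s).eval (x : ℂ) * (g : L2R) x) :
    hankel u.toLinf f = 0 := by
  have hdeg : (u.toRatFunc.num.map (starRingEnd ℂ)).degree < (blaschkeDenom s).degree := by
    rw [degree_map_conj, hs]
    exact u.degree_lt
  obtain ⟨h, hh, hae⟩ := exists_eval_div_mul_mem_hardySpace hdeg
    (fun _ => eval_blaschkeDenom_ne_zero s) g.2
  refine hankel_eq_of_ae (h := ⟨h, hh⟩) ?_
  filter_upwards [hfg, hae, coeFn_toLinf hs, Lp.coeFn_zero ℂ 2 (volume : Measure ℝ)]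
    with x h1 h2 h3 h4
  have hd := eval_blaschkeDenom_ne_zero s (ofReal_mem_closedUpperHalf x)
  have hn := eval_blaschkeNum_ofReal_ne_zero s x
  have h5 : (((0 : hardySpace) : L2R) : ℝ → ℂ) x = 0 := h4
  rw [h5, h1, h2, h3]
  simp only [map_mul, map_div₀]
  rw [← conj_eval_ofReal, conj_conj, conj_eval_ofReal, conj_eval_ofReal,
    map_conj_blaschkeDenom, map_conj_blaschkeNum]
  field_simp
  ring

/-- With p* denoting p with conjugated coefficients, u conj(p/D) = P p*/(D N) splits into partial
fractions α/D + β/N. The second term is conjugate to an H² function, so the projection keeps α/D.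
The divisibility is retained because it yields injectivity. -/
theorem exists_hankel_fraction (hs : blaschkeDenom s = u.toRatFunc.denom)
    (p : degreeLT ℂ (Multiset.card s)) :
    ∃ α : degreeLT ℂ (Multiset.card s), hankel u.toLinf (fraction s p) = fraction s α ∧
      blaschkeDenom s ∣ u.toRatFunc.num * (p : ℂ[X]).map (starRingEnd ℂ) -
        α * blaschkeNum s := by
  set N := blaschkeNum s
  set D := blaschkeDenom s with hD
  set T := u.toRatFunc.num * (p : ℂ[X]).map (starRingEnd ℂ) with hT
  obtain ⟨a, b, hab⟩ := isCoprime_blaschke s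
  have hDm := monic_blaschkeDenom s
  have hα : ((a * T) %ₘ D).degree < D.degree := degree_modByMonic_lt _ hDm
  set α := (a * T) %ₘ D with hαdef
  obtain ⟨β, hβ⟩ : D ∣ T - α * N := by
    have h1 := modByMonic_add_div (a * T) D
    refine ⟨b * T + ((a * T) /ₘ D) * N, ?_⟩
    linear_combination -T * hab - N * h1
  have hDd := degree_blaschkeDenom s
  -- Both P p* and αN have degree below 2 deg D, and their difference is D β.
  have hβdeg : β.degree < D.degree := by
    have h1 : (T - α * N).degree < D.degree + D.degree := by
      refine (degree_sub_le _ _).trans_lt (max_lt ?_ ?_)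
      · rw [hT, degree_mul, degree_map_conj]
        have h2 : u.toRatFunc.num.degree < D.degree := by
          rw [hs]
          exact u.degree_lt
        rcases eq_or_ne (p : ℂ[X]).degree ⊥ with h3 | h3
        · rw [h3, WithBot.add_bot, hDd]
          exact WithBot.bot_lt_coe _
        · exact WithBot.add_lt_add_of_lt_of_le h3 h2 (degree_lt_blaschkeDenom s p).le
      · rw [degree_mul, degree_blaschkeNum, hDd]
        rw [hDd] at hα
        exact WithBot.add_lt_add_right WithBot.coe_ne_bot hα
    rw [hβ, degree_mul] at h1
    exact lt_of_add_lt_add_left h1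
  set γ : degreeLT ℂ (Multiset.card s) := ⟨β.map (starRingEnd ℂ), by
    rw [mem_degreeLT, degree_map_conj, ← hDd]; exact hβdeg⟩ with hγ
  refine ⟨⟨α, by rw [mem_degreeLT, ← hDd]; exact hα⟩, ?_, ⟨β, hβ⟩⟩
  refine hankel_eq_of_ae (h := fraction s γ) ?_
  filter_upwards [coeFn_fraction s p, coeFn_fraction s γ, coeFn_toLinf hs,
    coeFn_fraction s ⟨α, by rw [mem_degreeLT, ← hDd]; exact hα⟩] with x h1 h2 h3 h4
  have hd := eval_blaschkeDenom_ne_zero s (ofReal_mem_closedUpperHalf x)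
  have hn := eval_blaschkeNum_ofReal_ne_zero s x
  have h5 := congrArg (Polynomial.eval (x : ℂ)) hβ
  simp only [hT, eval_sub, eval_mul, ← conj_eval_ofReal] at h5
  rw [h1, h2, h3, h4]
  simp only [map_div₀, γ]
  rw [← conj_eval_ofReal, conj_conj, conj_eval_ofReal (blaschkeDenom s), map_conj_blaschkeDenom]
  field_simp
  linear_combination h5

theorem hankel_mem_range_fraction (hs : blaschkeDenom s = u.toRatFunc.denom) (f : hardySpace) :
    hankel u.toLinf f ∈ LinearMap.range (fraction s) := by
  obtain ⟨p, g, hpg⟩ := exists_fraction_add_blaschke_mul s f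
  obtain ⟨α, hα, _⟩ := exists_hankel_fraction hs p
  have h0 : hankel u.toLinf (f - fraction s p) = 0 := by
    refine hankel_blaschke_mul hs (g := g) ?_
    filter_upwards [hpg, coeFn_fraction s p,
      Lp.coeFn_sub (f : L2R) (fraction s p : L2R)] with x h1 h2 h3
    refine h3.trans ?_
    rw [Pi.sub_apply, h1, h2, add_sub_cancel_left]
  rw [map_sub, sub_eq_zero] at h0
  exact ⟨α, by rw [h0, hα]⟩

/-- A zero image means that D divides P p*. Since P/D is in lowest terms, D divides p*, whose degree
is too small. -/
theorem eq_zero_of_hankel_fraction_eq_zero (hs : blaschkeDenom s = u.toRatFunc.denom)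
    {p : degreeLT ℂ (Multiset.card s)} (hp : hankel u.toLinf (fraction s p) = 0) : p = 0 := by
  obtain ⟨α, hα, hdvd⟩ := exists_hankel_fraction hs p
  have hα0 : α = 0 := fraction_injective s (by rw [← hα, hp, map_zero])
  rw [hα0, ZeroMemClass.coe_zero, zero_mul, sub_zero, hs] at hdvd
  have h1 := u.toRatFunc.isCoprime_num_denom.symm.dvd_of_dvd_mul_left hdvd
  have h2 : (p : ℂ[X]).map (starRingEnd ℂ) = 0 := by
    refine eq_zero_of_dvd_of_degree_lt h1 ?_
    rw [degree_map_conj, ← hs]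
    exact degree_lt_blaschkeDenom s p
  refine Subtype.ext ?_
  exact (Polynomial.map_eq_zero_iff (starRingEnd ℂ).injective).1 h2

theorem range_hankel (hs : blaschkeDenom s = u.toRatFunc.denom) :
    (hankel u.toLinf).range = LinearMap.range (fraction s) := by
  refine le_antisymm ?_ ?_
  · rintro _ ⟨f, rfl⟩
    exact hankel_mem_range_fraction hs f
  · set H := hankel u.toLinf
    set V := LinearMap.range (fraction s)
    -- The square is complex linear, so injectivity gives surjectivity by finite dimension.
    let T : V →ₗ[ℂ] V := ((H.comp H).toLinearMap.comp V.subtype).codRestrict V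
      fun f => hankel_mem_range_fraction hs _
    have hinj : ∀ f ∈ V, H f = 0 → f = 0 := by
      rintro _ ⟨p, rfl⟩ hp
      rw [eq_zero_of_hankel_fraction_eq_zero hs hp, map_zero]
    have hT : Function.Injective T := by
      rw [← LinearMap.ker_eq_bot, LinearMap.ker_eq_bot']
      intro f hf
      have h1 : H (H f) = 0 := congrArg Subtype.val hf
      exact Subtype.ext (hinj f f.2 (hinj _ (hankel_mem_range_fraction hs _) h1))
    intro f hf
    obtain ⟨g, hg⟩ := LinearMap.surjective_of_injective hT ⟨f, hf⟩
    exact ⟨H g, congrArg Subtype.val hg⟩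

end RationalSymbol

/-! ### The difference quotient (e^{iτz} - 1)/z as an H² function. -/

theorem norm_exp_sub_one_le_of_re_nonpos {w : ℂ} (hw : w.re ≤ 0) : ‖Complex.exp w - 1‖ ≤ ‖w‖ := by
  have h := Convex.norm_image_sub_le_of_norm_deriv_le (𝕜 := ℂ) (f := Complex.exp)
    (s := {z : ℂ | z.re ≤ 0}) (x := 0) (y := w) (C := 1)
    (fun z _ => Complex.differentiableAt_exp) (fun z hz => ?_)
    (convex_halfSpace_re_le 0) (by simp) hw
  · simpa using h
  · rw [Complex.deriv_exp, Complex.norm_exp]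
    exact Real.exp_le_one_iff.2 hz

/-- The difference quotient `(e^{iτz} - 1) / z`. -/
noncomputable def expQuot (τ : ℝ) : ℂ → ℂ := dslope (fun z : ℂ => Complex.exp (τ * z * I)) 0

theorem expQuot_of_ne (τ : ℝ) {z : ℂ} (hz : z ≠ 0) :
    expQuot τ z = (Complex.exp (τ * z * I) - 1) / z := by
  rw [expQuot, dslope_of_ne _ hz, slope_def_field]
  simp

theorem expQuot_zero (τ : ℝ) : expQuot τ 0 = τ * I := by
  rw [expQuot, dslope_same]
  have h : HasDerivAt (fun z : ℂ => Complex.exp (τ * z * I))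
      (Complex.exp (τ * 0 * I) * (τ * 1 * I)) 0 :=
    (((hasDerivAt_id' (0 : ℂ)).const_mul (τ : ℂ)).mul_const I).cexp
  rw [h.deriv]
  simp

theorem mul_expQuot (τ : ℝ) (z : ℂ) : z * expQuot τ z = Complex.exp (τ * z * I) - 1 := by
  rcases eq_or_ne z 0 with rfl | hz
  · simp
  · rw [expQuot_of_ne τ hz, mul_div_cancel₀ _ hz]

theorem differentiable_expQuot (τ : ℝ) : Differentiable ℂ (expQuot τ) := by
  rw [← differentiableOn_univ]
  exact (Complex.differentiableOn_dslope univ_mem).2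
    (Differentiable.differentiableOn (by fun_prop))

theorem norm_expQuot_le {τ : ℝ} (hτ : 0 ≤ τ) {z : ℂ} (hz : z ∈ closedUpperHalf) :
    ‖expQuot τ z‖ ≤ τ := by
  rcases eq_or_ne z 0 with rfl | h0
  · rw [expQuot_zero]
    simp [abs_of_nonneg hτ]
  · rw [expQuot_of_ne τ h0, norm_div, div_le_iff₀ (norm_pos_iff.2 h0)]
    refine (norm_exp_sub_one_le_of_re_nonpos ?_).trans (le_of_eq ?_)
    · have : 0 ≤ τ * z.im := mul_nonneg hτ hz
      simpa using this
    · simp [abs_of_nonneg hτ]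

theorem norm_expQuot_le_decay {τ : ℝ} (hτ : 0 ≤ τ) {z : ℂ} (hz : z ∈ closedUpperHalf) :
    ‖expQuot τ z‖ ≤ (τ + 2) * (1 + z.re ^ 2) ^ (-(1 / 2) : ℝ) := by
  have hsqrt : (1 + z.re ^ 2) ^ (-(1 / 2) : ℝ) = (Real.sqrt (1 + z.re ^ 2))⁻¹ := by
    rw [Real.rpow_neg (by positivity), Real.sqrt_eq_rpow]
  have hpos : 0 < Real.sqrt (1 + z.re ^ 2) := Real.sqrt_pos.2 (by positivity)
  rw [hsqrt, ← div_eq_mul_inv, le_div_iff₀ hpos]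
  have hsq : Real.sqrt (1 + z.re ^ 2) ≤ 1 + ‖z‖ := by
    refine Real.sqrt_le_iff.2 ⟨by positivity, ?_⟩
    have h1 : z.re ^ 2 ≤ ‖z‖ ^ 2 := by
      rw [← sq_abs z.re]
      exact pow_le_pow_left₀ (abs_nonneg _) (Complex.abs_re_le_norm z) 2
    nlinarith [norm_nonneg z]
  have h2 : ‖z‖ * ‖expQuot τ z‖ ≤ 2 := by
    rw [← norm_mul, mul_expQuot]
    refine (norm_sub_le _ _).trans ?_
    have h3 : ‖Complex.exp (τ * z * I)‖ ≤ 1 := by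
      rw [Complex.norm_exp]
      refine Real.exp_le_one_iff.2 ?_
      have : 0 ≤ τ * z.im := mul_nonneg hτ hz
      simpa using this
    rw [norm_one]
    linarith
  have h4 := norm_expQuot_le hτ hz
  calc ‖expQuot τ z‖ * √(1 + z.re ^ 2) ≤ ‖expQuot τ z‖ * (1 + ‖z‖) :=
        mul_le_mul_of_nonneg_left hsq (norm_nonneg _)
    _ ≤ τ + 2 := by linarith

theorem exists_expQuot_hardySpace {τ : ℝ} (hτ : 0 ≤ τ) :
    ∃ e : hardySpace, (e : L2R) =ᵐ[volume] fun x : ℝ => expQuot τ x := by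
  have hc : ContinuousOn (expQuot τ) closedUpperHalf :=
    (differentiable_expQuot τ).continuous.continuousOn
  have hm := memLp_two_of_decay hc fun z => norm_expQuot_le_decay hτ
  exact ⟨⟨hm.toLp, toLp_mem_hardySpace (isHardy_of_decay hc
    (differentiable_expQuot τ).differentiableOn fun z => norm_expQuot_le_decay hτ) hm⟩,
    hm.coeFn_toLp⟩

theorem tendsto_inv_mul_expQuot (x : ℝ) :
    Tendsto (fun τ : ℝ => (τ : ℂ)⁻¹ * expQuot τ x) (𝓝[>] 0) (𝓝 I) := by
  rcases eq_or_ne x 0 with rfl | hx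
  · refine tendsto_const_nhds.congr' ?_
    filter_upwards [self_mem_nhdsWithin] with τ hτ
    have : (τ : ℂ) ≠ 0 := by exact_mod_cast (ne_of_gt hτ)
    rw [ofReal_zero, expQuot_zero]
    field_simp
  · have hx' : (x : ℂ) ≠ 0 := by exact_mod_cast hx
    have h : HasDerivAt (fun τ : ℝ => Complex.exp (τ * x * I)) (Complex.exp ((0 : ℝ) * x * I) *
        (1 * x * I)) 0 := ((ofRealCLM.hasDerivAt.mul_const (x : ℂ)).mul_const I).cexp
    have h1 := h.tendsto_slope_zero_right.div_const (x : ℂ)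
    have e : Complex.exp ((0 : ℝ) * x * I) * (1 * x * I) / x = I := by
      simp [hx']
    rw [e] at h1
    refine h1.congr fun τ => ?_
    rw [expQuot_of_ne _ hx']
    simp only [zero_add, ofReal_zero, zero_mul, Complex.exp_zero, real_smul, ofReal_inv]
    ring

/-- The bound |(e^{iτx} - 1)/x| ≤ τ makes the integrands dominated by |k|, and the rescaled
quotients tend to i. -/
theorem tendsto_integral_expQuot {k : ℝ → ℂ} (hk : Integrable k) :
    Tendsto (fun τ : ℝ => (τ : ℂ)⁻¹ * ∫ x : ℝ, conj (expQuot τ x) * k x) (𝓝[>] 0)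
      (𝓝 (-I * ∫ x, k x)) := by
  have h1 : Tendsto (fun τ : ℝ => ∫ x : ℝ, conj ((τ : ℂ)⁻¹ * expQuot τ x) * k x) (𝓝[>] 0)
      (𝓝 (∫ x, -I * k x)) := by
    refine tendsto_integral_filter_of_dominated_convergence (fun x => ‖k x‖) ?_ ?_ hk.norm ?_
    · refine Eventually.of_forall fun τ => ?_
      refine AEStronglyMeasurable.mul (Continuous.aestronglyMeasurable ?_) hk.1
      exact continuous_conj.comp (continuous_const.mul
        ((differentiable_expQuot τ).continuous.comp continuous_ofReal))
    · filter_upwards [self_mem_nhdsWithin] with τ hτ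
      have hτ' : 0 < τ := hτ
      refine Eventually.of_forall fun x => ?_
      rw [norm_mul, RCLike.norm_conj, norm_mul, norm_inv, Complex.norm_real,
        Real.norm_of_nonneg hτ'.le]
      refine mul_le_of_le_one_left (norm_nonneg _) ?_
      rw [inv_mul_le_one₀ hτ']
      exact norm_expQuot_le hτ'.le (ofReal_mem_closedUpperHalf x)
    · refine Eventually.of_forall fun x => ?_
      have h2 := ((continuous_conj.tendsto I).comp (tendsto_inv_mul_expQuot x)).mul_const (k x)
      rw [conj_I] at h2
      exact h2
  rw [integral_const_mul] at h1
  refine h1.congr fun τ => ?_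
  rw [← integral_const_mul]
  refine integral_congr_ae (Eventually.of_forall fun x => ?_)
  simp only [map_mul, map_inv₀, conj_ofReal]
  ring

theorem coeFn_shift (τ : ℝ≥0) (f : hardySpace) :
    (shift τ f : L2R) =ᵐ[volume] fun x => expFun τ x * (f : L2R) x := by
  filter_upwards [coeFn_mulL2 (memLp_expFun τ).toLp (f : L2R), (memLp_expFun τ).coeFn_toLp]
    with x h1 h2
  exact h1.trans (by rw [h2])

theorem integrable_mul_hardySpace (f g : L2R) : Integrable fun x => f x * g x :=
  (Lp.memLp f).integrable_mul (Lp.memLp g)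

theorem integrable_conj_mul (f g : L2R) : Integrable fun x => conj (f x) * g x := by
  refine (integrable_mul_hardySpace (conjL2 f) g).congr ?_
  filter_upwards [coeFn_conjL2 f] with x hx
  rw [hx]

/-! ### Weak derivatives and residues at infinity. -/

section ModelSpace

open Polynomial

variable (s : Multiset UpperHalfPlane)

theorem mul_fraction (p : degreeLT ℂ (Multiset.card s)) : ∀ᵐ x : ℝ,
    (x : ℂ) * (fraction s p : L2R) x = topCoeff s p + (fraction s (mulXMod s p) : L2R) x := by
  filter_upwards [coeFn_fraction s p, coeFn_fraction s (mulXMod s p)] with x h1 h2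
  rw [h1, h2]
  exact mul_eval_div s p (ofReal_mem_closedUpperHalf x)

/-- Write e for the difference quotient, so that S(τ)g - g = x e g. Moving the factor x onto f = p/D
gives c(f) + B f, and the constant c(f) contributes nothing because e and g are both in H². -/
theorem inner_shift_sub_fraction {τ : ℝ≥0} (g : hardySpace)
    (p : degreeLT ℂ (Multiset.card s)) :
    ⟪shift τ g - g, fraction s p⟫_ℂ = ∫ x : ℝ, conj (expQuot τ x) *
      (conj ((g : L2R) x) * (fraction s (mulXMod s p) : L2R) x) := by
  obtain ⟨e, he⟩ := exists_expQuot_hardySpace τ.coe_nonneg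
  have hint : Integrable fun x : ℝ => conj (expQuot τ x) *
      (conj ((g : L2R) x) * (fraction s (mulXMod s p) : L2R) x) := by
    refine (integrable_conj_mul (g : L2R) (fraction s (mulXMod s p) : L2R)).bdd_mul (c := τ)
      (Continuous.aestronglyMeasurable ?_) (Eventually.of_forall fun x => ?_)
    · exact continuous_conj.comp ((differentiable_expQuot τ).continuous.comp continuous_ofReal)
    · rw [RCLike.norm_conj]
      exact norm_expQuot_le τ.coe_nonneg (ofReal_mem_closedUpperHalf x)
  have h0 : ∫ x, conj ((e : L2R) x * (g : L2R) x) = 0 := by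
    rw [integral_conj, integral_mul_eq_zero e.2 g.2, map_zero]
  have hint0 : Integrable fun x => conj ((e : L2R) x * (g : L2R) x) :=
    (conjCLE : ℂ →L[ℝ] ℂ).integrable_comp (integrable_mul_hardySpace (e : L2R) (g : L2R))
  rw [inner_hardySpace]
  calc ∫ x, conj (((shift τ g - g : hardySpace) : L2R) x) * (fraction s p : L2R) x
      = ∫ x : ℝ, (topCoeff s p * conj ((e : L2R) x * (g : L2R) x) + conj (expQuot τ x) *
      (conj ((g : L2R) x) * (fraction s (mulXMod s p) : L2R) x)) := by
        refine integral_congr_ae ?_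
        filter_upwards [coeFn_shift τ g, Lp.coeFn_sub (shift τ g : L2R) (g : L2R), he,
          mul_fraction s p] with x h1 h2 h3 h4
        have h5 : ((shift τ g - g : hardySpace) : L2R) x =
            (x : ℂ) * expQuot τ x * (g : L2R) x := by
          refine h2.trans ?_
          rw [Pi.sub_apply, h1, mul_expQuot, expFun]
          ring
        rw [h5, h3]
        simp only [map_mul, conj_ofReal]
        linear_combination conj (expQuot τ x) * conj ((g : L2R) x) * h4
    _ = _ := by
        rw [integral_add (hint0.const_mul _) hint, integral_const_mul, h0, mul_zero, zero_add]

/-- The weak derivative at `0` of the shift semigroup, tested against proper fractions. -/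
theorem tendsto_shift_sub (g : hardySpace) (p : degreeLT ℂ (Multiset.card s)) :
    Tendsto (fun τ : ℝ => (τ : ℂ)⁻¹ * ⟪shift τ.toNNReal g - g, fraction s p⟫_ℂ) (𝓝[>] 0)
      (𝓝 (-I * ⟪g, fraction s (mulXMod s p)⟫_ℂ)) := by
  rw [inner_hardySpace]
  refine (tendsto_integral_expQuot (integrable_conj_mul (g : L2R) _)).congr' ?_
  filter_upwards [self_mem_nhdsWithin] with τ hτ
  rw [inner_shift_sub_fraction, Real.coe_toNNReal τ (le_of_lt hτ)]

theorem exists_cauchyKernel :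
    ∃ k : hardySpace, (k : L2R) =ᵐ[volume] fun x : ℝ => 1 / ((x : ℂ) + I) := by
  have hq : ∀ z ∈ closedUpperHalf, (X - C (conj I)).eval z ≠ 0 := fun z =>
    eval_X_sub_C_conj_ne_zero (by simp)
  have hdeg : (1 : ℂ[X]).degree < (X - C (conj I)).degree := by
    rw [degree_X_sub_C, degree_one]
    norm_num
  refine ⟨⟨(memLp_two_eval_div hdeg hq).toLp, toLp_mem_hardySpace (isHardy_eval_div hdeg hq) _⟩, ?_⟩
  filter_upwards [(memLp_two_eval_div hdeg hq).coeFn_toLp] with x hx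
  rw [hx]
  simp

theorem ofReal_add_I_ne_zero (x : ℝ) : (x : ℂ) + I ≠ 0 := fun h => by
  have := congrArg Complex.im h
  simp at this

theorem ofReal_sub_I_ne_zero (x : ℝ) : (x : ℂ) - I ≠ 0 := fun h => by
  have := congrArg Complex.im h
  simp at this

/-- A fraction f is in general not integrable, but f - c(f)/(x + i) = (B f + i f)/(x + i) is a
product of two H² functions. -/
theorem integral_fraction_sub_kernel (p : degreeLT ℂ (Multiset.card s)) :
    Integrable (fun x : ℝ => (fraction s p : L2R) x - topCoeff s p / ((x : ℂ) + I)) ∧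
    ∫ x : ℝ, ((fraction s p : L2R) x - topCoeff s p / ((x : ℂ) + I)) = 0 := by
  obtain ⟨k, hk⟩ := exists_cauchyKernel
  set b : hardySpace := fraction s (mulXMod s p) + I • fraction s p with hb
  have hae : (fun x => (b : L2R) x * (k : L2R) x) =ᵐ[volume]
      fun x : ℝ => (fraction s p : L2R) x - topCoeff s p / ((x : ℂ) + I) := by
    filter_upwards [hk, mul_fraction s p,
      Lp.coeFn_add (fraction s (mulXMod s p) : L2R) (I • (fraction s p : L2R)),
      Lp.coeFn_smul I (fraction s p : L2R)] with x h1 h2 h3 h4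
    have h5 : (b : L2R) x = (fraction s (mulXMod s p) : L2R) x + I * (fraction s p : L2R) x := by
      refine h3.trans ?_
      rw [Pi.add_apply, h4]
      rfl
    have := ofReal_add_I_ne_zero x
    rw [h5, h1]
    field_simp
    linear_combination -h2
  refine ⟨(integrable_mul_hardySpace (b : L2R) (k : L2R)).congr hae, ?_⟩
  rw [← integral_congr_ae hae]
  exact integral_mul_eq_zero b.2 k.2

/-- This differs from subtracting c/(x + i) by -2i c/(1 + x²), whose integral is -2πi c. -/
theorem integral_fraction_sub_conj_kernel (p : degreeLT ℂ (Multiset.card s)) :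
    Integrable (fun x : ℝ => (fraction s p : L2R) x - topCoeff s p / ((x : ℂ) - I)) ∧
    ∫ x : ℝ, ((fraction s p : L2R) x - topCoeff s p / ((x : ℂ) - I)) =
      -(2 * Real.pi * I) * topCoeff s p := by
  obtain ⟨h1, h2⟩ := integral_fraction_sub_kernel s p
  have h3 : Integrable fun x : ℝ => -(2 * I) * topCoeff s p * (((1 + x ^ 2)⁻¹ : ℝ) : ℂ) :=
    integrable_inv_one_add_sq.ofReal.const_mul _
  have e : (fun x : ℝ => (fraction s p : L2R) x - topCoeff s p / ((x : ℂ) - I)) =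
      fun x : ℝ => ((fraction s p : L2R) x - topCoeff s p / ((x : ℂ) + I)) +
        -(2 * I) * topCoeff s p * (((1 + x ^ 2)⁻¹ : ℝ) : ℂ) := by
    funext x
    have h4 := ofReal_add_I_ne_zero x
    have h5 := ofReal_sub_I_ne_zero x
    have h6 : (((1 + x ^ 2)⁻¹ : ℝ) : ℂ) = (((x : ℂ) + I) * (x - I))⁻¹ := by
      push_cast
      congr 1
      linear_combination I_sq
    rw [h6]
    field_simp
    ring
  rw [e]
  refine ⟨h1.add h3, ?_⟩
  rw [integral_add h1 h3, h2, integral_const_mul, integral_complex_ofReal,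
    integral_univ_inv_one_add_sq]
  ring

theorem inner_mulXMod_sub (p q : degreeLT ℂ (Multiset.card s)) :
    ⟪fraction s q, fraction s (mulXMod s p)⟫_ℂ - ⟪fraction s (mulXMod s q), fraction s p⟫_ℂ =
      -(2 * Real.pi * I) * (topCoeff s p * conj (topCoeff s q)) := by
  obtain ⟨h1, h2⟩ := integral_fraction_sub_conj_kernel s p
  obtain ⟨h3, h4⟩ := integral_fraction_sub_kernel s q
  have h5 : Integrable fun x : ℝ =>
      conj ((fraction s q : L2R) x - topCoeff s q / ((x : ℂ) + I)) :=
    (conjCLE : ℂ →L[ℝ] ℂ).integrable_comp h3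
  rw [inner_hardySpace, inner_hardySpace, ← integral_sub (integrable_conj_mul _ _)
    (integrable_conj_mul _ _)]
  -- The terms containing x cancel and leave conj(c_q) f_p - c_p conj(f_q). The kernels subtracted
  -- to make each summand integrable cancel each other, and only the one with x - i has a nonzero
  -- integral.
  calc _ = ∫ x : ℝ, (conj (topCoeff s q) *
        ((fraction s p : L2R) x - topCoeff s p / ((x : ℂ) - I)) - topCoeff s p *
        conj ((fraction s q : L2R) x - topCoeff s q / ((x : ℂ) + I))) := by
        refine integral_congr_ae ?_
        filter_upwards [mul_fraction s p, mul_fraction s q] with x h6 h7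
        have h8 := congrArg conj h7
        simp only [map_mul, map_add, conj_ofReal] at h8
        simp only [map_sub, map_div₀, map_add, conj_ofReal, conj_I, ← sub_eq_add_neg]
        linear_combination (fraction s p : L2R) x * h8 - conj ((fraction s q : L2R) x) * h6
    _ = _ := by
        rw [integral_sub (h1.const_mul _) (h5.const_mul _), integral_const_mul, integral_const_mul,
          integral_conj, h2, h4, map_zero]
        ring

/-- Subtracting c/(x - i) makes the fraction integrable without changing the integral, since
conj(e)/(x - i) is the conjugate of a product of H² functions. -/
theorem tendsto_integral_expQuot_fraction (p : degreeLT ℂ (Multiset.card s)) :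
    Tendsto (fun τ : ℝ => (τ : ℂ)⁻¹ * ∫ x : ℝ, conj (expQuot τ x) * (fraction s p : L2R) x) (𝓝[>] 0)
      (𝓝 (-(2 * Real.pi) * topCoeff s p)) := by
  obtain ⟨h1, h2⟩ := integral_fraction_sub_conj_kernel s p
  have h3 := tendsto_integral_expQuot h1
  rw [h2, show -I * (-(2 * Real.pi * I) * topCoeff s p) = -(2 * Real.pi) * topCoeff s p by
    linear_combination (2 * Real.pi * topCoeff s p) * I_sq] at h3
  refine h3.congr' ?_
  filter_upwards [self_mem_nhdsWithin] with τ hτ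
  obtain ⟨e, he⟩ := exists_expQuot_hardySpace (le_of_lt hτ)
  obtain ⟨k, hk⟩ := exists_cauchyKernel
  congr 1
  have h0 : ∫ x, conj ((e : L2R) x * (k : L2R) x) = 0 := by
    rw [integral_conj, integral_mul_eq_zero e.2 k.2, map_zero]
  have hint0 : Integrable fun x => conj ((e : L2R) x * (k : L2R) x) :=
    (conjCLE : ℂ →L[ℝ] ℂ).integrable_comp (integrable_mul_hardySpace (e : L2R) (k : L2R))
  calc _ = ∫ x, (conj ((e : L2R) x) * (fraction s p : L2R) x -
        topCoeff s p * conj ((e : L2R) x * (k : L2R) x)) := by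
        refine integral_congr_ae ?_
        filter_upwards [he, hk] with x h4 h5
        rw [h4, h5]
        simp only [map_mul, map_div₀, map_add, conj_ofReal, conj_I, map_one, ← sub_eq_add_neg]
        ring
    _ = ∫ x, conj ((e : L2R) x) * (fraction s p : L2R) x := by
        rw [integral_sub (integrable_conj_mul _ _) (hint0.const_mul _), integral_const_mul, h0,
          mul_zero, sub_zero]
    _ = _ := by
        refine integral_congr_ae ?_
        filter_upwards [he] with x h4
        rw [h4]

/-- With e the difference quotient, τ⁻¹⟪e, H f⟫ has two limits as τ → 0: -2π c(H f), and -i ⟪f, u⟫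
from the integral defining H. -/
theorem topCoeff_of_hankel_eq {u : RationalSymbol} {f : hardySpace}
    {p : degreeLT ℂ (Multiset.card s)} (hp : hankel u.toLinf f = fraction s p) :
    topCoeff s p = I / (2 * Real.pi) * ⟪f, u.toHardy⟫_ℂ := by
  have hu : (u.toHardy : L2R) =ᵐ[volume] u.toLinf := by
    filter_upwards [u.memLp_two.coeFn_toLp, u.memLp_top.coeFn_toLp] with x h1 h2
    exact h1.trans h2.symm
  have h1 := tendsto_integral_expQuot (integrable_conj_mul (f : L2R) u.toHardy)
  rw [← inner_hardySpace] at h1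
  have h2 := tendsto_nhds_unique (h1.congr' ?_) (tendsto_integral_expQuot_fraction s p)
  · have hpi : (Real.pi : ℂ) ≠ 0 := by exact_mod_cast Real.pi_ne_zero
    field_simp
    linear_combination h2
  · filter_upwards [self_mem_nhdsWithin] with τ hτ
    obtain ⟨e, he⟩ := exists_expQuot_hardySpace (le_of_lt hτ)
    congr 1
    calc _ = ⟪e, hankel u.toLinf f⟫_ℂ := by
          rw [inner_hankel]
          refine integral_congr_ae ?_
          filter_upwards [he, hu] with x h4 h5
          rw [h4, h5]
          ring
      _ = _ := by
          rw [hp, inner_hardySpace]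
          refine integral_congr_ae ?_
          filter_upwards [he] with x h4
          rw [h4]

theorem inner_shift_hankel_comm (φ : LinfR) (τ : ℝ≥0) (f g : hardySpace) :
    ⟪shift τ f, hankel φ g⟫_ℂ = ⟪shift τ g, hankel φ f⟫_ℂ := by
  rw [inner_hankel, inner_hankel]
  refine integral_congr_ae ?_
  filter_upwards [coeFn_shift τ f, coeFn_shift τ g] with x h1 h2
  rw [h1, h2]
  simp only [map_mul]
  ring

/-- ⟪S(τ)f, H g⟫ is symmetric in f and g, and its derivative at τ = 0 inherits the symmetry. -/
theorem inner_mulXMod_hankel_comm {u : RationalSymbol} {f g : hardySpace}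
    {p q : degreeLT ℂ (Multiset.card s)} (hp : hankel u.toLinf f = fraction s p)
    (hq : hankel u.toLinf g = fraction s q) :
    ⟪f, fraction s (mulXMod s q)⟫_ℂ = ⟪g, fraction s (mulXMod s p)⟫_ℂ := by
  have h1 := tendsto_nhds_unique (tendsto_shift_sub s f q)
    ((tendsto_shift_sub s g p).congr fun τ => ?_)
  · exact mul_left_cancel₀ (neg_ne_zero.2 I_ne_zero) h1
  · rw [← hp, ← hq, inner_sub_left, inner_sub_left, inner_shift_hankel_comm,
      inner_hankel_comm _ g f]

end ModelSpace

/-! ### Exponentials and their weak derivatives. -/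

section Semigroups

variable {E : Type*} [NormedAddCommGroup E] [InnerProductSpace ℂ E] [CompleteSpace E]

theorem hasDerivAt_exp_smul_apply (A : E →L[ℂ] E) (f : E) (t : ℝ) :
    HasDerivAt (fun τ : ℝ => NormedSpace.exp ((I * (τ : ℂ)) • A) f)
      ((I • A) (NormedSpace.exp ((I * (t : ℂ)) • A) f)) t := by
  have h1 := (hasDerivAt_exp_smul_const' (𝕂 := ℂ) (I • A) (t : ℂ)).scomp t ofRealCLM.hasDerivAt
  have h2 := ((ContinuousLinearMap.apply ℂ E f).restrictScalars ℝ).hasFDerivAt.comp_hasDerivAt t h1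
  convert h2 using 1
  · funext τ
    simp [smul_smul, mul_comm I]
  · simp [smul_smul, mul_comm I]

theorem IsSemigroupGenerator.tendsto_inner {T : ℝ≥0 → E →L[ℂ] E} {A : E →L[ℂ] E}
    (hA : IsSemigroupGenerator T A) (f g : E) :
    Tendsto (fun τ : ℝ => (τ : ℂ)⁻¹ * (⟪T τ.toNNReal f, g⟫_ℂ - ⟪f, g⟫_ℂ)) (𝓝[>] 0)
      (𝓝 (-I * ⟪A f, g⟫_ℂ)) := by
  have h1 := ((hasDerivAt_exp_smul_apply A f 0).tendsto_slope_zero_right).inner (𝕜 := ℂ)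
    (tendsto_const_nhds (x := g))
  simp only [ofReal_zero, mul_zero, zero_smul, NormedSpace.exp_zero, one_apply_eq_self,
    smul_apply, inner_smul_left, conj_I, zero_add] at h1
  refine h1.congr' ?_
  filter_upwards [self_mem_nhdsWithin] with τ hτ
  have h3 := hA τ.toNNReal (Real.toNNReal_pos.2 hτ)
  rw [Real.coe_toNNReal τ (le_of_lt hτ)] at h3
  rw [h3, ← Complex.coe_smul, inner_smul_left, inner_sub_left, conj_ofReal, ofReal_inv]

/-- A family of operators on a finite-dimensional space with the weak right derivative of an
exponential is an exponential. -/
theorem exists_isSemigroupGenerator [FiniteDimensional ℂ E] {T : ℝ≥0 → E →L[ℂ] E} {B : E →ₗ[ℂ] E}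
    (h0 : ∀ f g, ⟪T 0 f, g⟫_ℂ = ⟪f, g⟫_ℂ)
    (hc : ∀ f g, Continuous fun τ : ℝ => ⟪T τ.toNNReal f, g⟫_ℂ)
    (hd : ∀ f g (t : ℝ), 0 ≤ t → HasDerivWithinAt (fun τ : ℝ => ⟪T τ.toNNReal f, g⟫_ℂ)
      (-I * ⟪T t.toNNReal f, B g⟫_ℂ) (Ici t) t) :
    ∃ A : E →L[ℂ] E, IsSemigroupGenerator T A := by
  -- The weak derivative places B on the test vector, so the orbit itself satisfies γ' = i B* γ.
  -- Uniqueness for this linear equation identifies it with the exponential.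
  set A := ContinuousLinearMap.adjoint (LinearMap.toContinuousLinearMap B) with hA
  have hAi : ∀ f g, ⟪A f, g⟫_ℂ = ⟪f, B g⟫_ℂ := fun f g =>
    ContinuousLinearMap.adjoint_inner_left _ _ _
  refine ⟨A, fun τ₀ _ => ContinuousLinearMap.ext fun f => ?_⟩
  set γ : ℝ → E := fun τ => T τ.toNNReal f with hγ
  set b := stdOrthonormalBasis ℂ E
  have hsum : γ = fun τ => ∑ i, conj ⟪T τ.toNNReal f, b i⟫_ℂ • b i := by
    funext τ
    rw [← b.sum_repr' (γ τ)]
    refine Finset.sum_congr rfl fun i _ => ?_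
    rw [inner_conj_symm]
  have hcont : Continuous γ := by
    rw [hsum]
    exact continuous_finsetSum _ fun i _ =>
      (continuous_conj.comp (hc _ _)).smul continuous_const
  have hderiv : ∀ t : ℝ, 0 ≤ t → HasDerivWithinAt γ ((I • A) (γ t)) (Ici t) t := by
    intro t ht
    have h1 : ∀ i, HasDerivWithinAt (fun τ : ℝ => conj ⟪T τ.toNNReal f, b i⟫_ℂ)
        ⟪b i, (I • A) (γ t)⟫_ℂ (Ici t) t := by
      intro i
      have h3 := (conjCLE : ℂ →L[ℝ] ℂ).hasFDerivAt.comp_hasDerivWithinAt t (hd f (b i) t ht)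
      have e : ⟪b i, (I • A) (γ t)⟫_ℂ = conj (-I * ⟪T t.toNNReal f, B (b i)⟫_ℂ) := by
        rw [smul_apply, inner_smul_right, ← inner_conj_symm, hAi]
        simp [hγ]
      rw [e]
      exact h3
    have h2 := HasDerivWithinAt.fun_sum (u := Finset.univ) fun i _ => (h1 i).smul_const (b i)
    rw [b.sum_repr'] at h2
    rwa [← hsum] at h2
  have huniq := ODE_solution_unique (v := fun _ y => (I • A) y) (a := 0) (b := (τ₀ : ℝ))
    (fun _ => (I • A).lipschitz) hcont.continuousOn (fun t ht => hderiv t ht.1)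
    (g := fun τ : ℝ => NormedSpace.exp ((I * (τ : ℂ)) • A) f)
    (fun t _ => (hasDerivAt_exp_smul_apply A f t).continuousAt.continuousWithinAt)
    (fun t _ => (hasDerivAt_exp_smul_apply A f t).hasDerivWithinAt) ?_
  · have h1 := huniq (right_mem_Icc.2 τ₀.coe_nonneg)
    simpa [hγ] using h1
  · refine ext_inner_right ℂ fun g => ?_
    simp only [hγ, Real.toNNReal_zero, h0, ofReal_zero, mul_zero, zero_smul, NormedSpace.exp_zero,
      one_apply_eq_self]

end Semigroups

/-! ### The shift semigroup on the Hardy space. -/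

theorem shift_add (σ τ : ℝ≥0) (f : hardySpace) : shift (σ + τ) f = shift σ (shift τ f) := by
  refine Subtype.ext (Lp.ext ?_)
  filter_upwards [coeFn_shift (σ + τ) f, coeFn_shift σ (shift τ f), coeFn_shift τ f]
    with x h1 h2 h3
  rw [h1, h2, h3, ← mul_assoc]
  congr 1
  rw [expFun, expFun, expFun, ← Complex.exp_add]
  congr 1
  push_cast
  ring

theorem shift_zero (f : hardySpace) : shift 0 f = f := by
  refine Subtype.ext (Lp.ext ?_)
  filter_upwards [coeFn_shift 0 f] with x h1
  rw [h1, expFun]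
  simp

theorem continuous_inner_shift (f g : hardySpace) :
    Continuous fun τ : ℝ => ⟪shift τ.toNNReal f, g⟫_ℂ := by
  have e : (fun τ : ℝ => ⟪shift τ.toNNReal f, g⟫_ℂ) = fun τ : ℝ =>
      ∫ x, conj (expFun τ.toNNReal x) * (conj ((f : L2R) x) * (g : L2R) x) := by
    funext τ
    rw [inner_hardySpace]
    refine integral_congr_ae ?_
    filter_upwards [coeFn_shift τ.toNNReal f] with x h1
    rw [h1, map_mul, mul_assoc]
  rw [e]
  refine continuous_of_dominated (bound := fun x => ‖conj ((f : L2R) x) * (g : L2R) x‖)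
    (fun τ => ?_) (fun τ => Eventually.of_forall fun x => ?_)
    (integrable_conj_mul (f : L2R) (g : L2R)).norm (Eventually.of_forall fun x => ?_)
  · refine AEStronglyMeasurable.mul (Continuous.aestronglyMeasurable ?_)
      (integrable_conj_mul (f : L2R) (g : L2R)).1
    unfold expFun
    fun_prop
  · rw [norm_mul, RCLike.norm_conj, expFun, ← Complex.ofReal_mul, Complex.norm_exp_ofReal_mul_I,
      one_mul]
  · unfold expFun
    have : Continuous fun τ : ℝ => ((τ.toNNReal : ℝ) : ℂ) :=
      continuous_ofReal.comp (NNReal.continuous_coe.comp continuous_real_toNNReal)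
    fun_prop

/-! ### The concrete Hankel model and the generator of the compressed semigroup. -/

section ModelSpace

open Polynomial

variable {s : Multiset UpperHalfPlane}

/-- The semigroup law carries the one-sided derivative at 0 to time t, with f replaced by S(t) f. -/
theorem hasDerivWithinAt_inner_shift (f : hardySpace) (p : degreeLT ℂ (Multiset.card s)) {t : ℝ}
    (ht : 0 ≤ t) :
    HasDerivWithinAt (fun τ : ℝ => ⟪shift τ.toNNReal f, fraction s p⟫_ℂ)
      (-I * ⟪shift t.toNNReal f, fraction s (mulXMod s p)⟫_ℂ) (Ici t) t := by
  rw [← hasDerivWithinAt_Ioi_iff_Ici, hasDerivWithinAt_iff_tendsto_slope' (by simp)]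
  have h1 : Tendsto (fun τ : ℝ => τ - t) (𝓝[>] t) (𝓝[>] 0) := by
    refine tendsto_nhdsWithin_iff.2 ⟨?_, ?_⟩
    · exact (Continuous.tendsto' (by fun_prop) _ _ (by simp)).mono_left nhdsWithin_le_nhds
    · filter_upwards [self_mem_nhdsWithin] with τ hτ
      exact sub_pos.2 (mem_Ioi.1 hτ)
  refine ((tendsto_shift_sub s (shift t.toNNReal f) p).comp h1).congr' ?_
  filter_upwards [self_mem_nhdsWithin] with τ hτ
  have hτ' : 0 ≤ τ - t := (sub_pos.2 hτ).le
  have h2 : τ.toNNReal = (τ - t).toNNReal + t.toNNReal := by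
    rw [← Real.toNNReal_add hτ' ht, sub_add_cancel]
  rw [Function.comp_apply, slope_def_module, h2, shift_add, inner_sub_left, real_smul, ofReal_inv]

instance : FiniteDimensional ℂ (degreeLT ℂ (Multiset.card s)) :=
  Module.Finite.equiv (degreeLTEquiv ℂ (Multiset.card s)).symm

variable {V : Submodule ℂ hardySpace}

/-- The parametrisation of a space of proper fractions by the numerators. -/
noncomputable def fractionEquiv (hV : LinearMap.range (fraction s) = V) :
    degreeLT ℂ (Multiset.card s) ≃ₗ[ℂ] V :=
  (LinearEquiv.ofInjective (fraction s) (fraction_injective s)).trans (LinearEquiv.ofEq _ _ hV)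

theorem coe_fractionEquiv (hV : LinearMap.range (fraction s) = V)
    (p : degreeLT ℂ (Multiset.card s)) : (fractionEquiv hV p : hardySpace) = fraction s p := rfl

/-- The operator `f ↦ x f - c(f)` on a space of proper fractions. -/
noncomputable def fractionOp (hV : LinearMap.range (fraction s) = V) : V →ₗ[ℂ] V :=
  ((fractionEquiv hV).toLinearMap.comp (mulXMod s)).comp (fractionEquiv hV).symm.toLinearMap

/-- The coefficient `c(f)` of a proper fraction `f(x) = c(f) / x + O(1 / x²)`. -/
noncomputable def fractionCoeff (hV : LinearMap.range (fraction s) = V) : V →ₗ[ℂ] ℂ :=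
  (topCoeff s).comp (fractionEquiv hV).symm.toLinearMap

theorem fractionOp_apply (hV : LinearMap.range (fraction s) = V)
    (p : degreeLT ℂ (Multiset.card s)) :
    fractionOp hV (fractionEquiv hV p) = fractionEquiv hV (mulXMod s p) := by
  simp [fractionOp]

theorem fractionCoeff_apply (hV : LinearMap.range (fraction s) = V)
    (p : degreeLT ℂ (Multiset.card s)) :
    fractionCoeff hV (fractionEquiv hV p) = topCoeff s p := by
  simp [fractionCoeff]

theorem finiteDimensional_of_range_fraction (hV : LinearMap.range (fraction s) = V) :
    FiniteDimensional ℂ V :=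
  Module.Finite.equiv (fractionEquiv hV)

/-- A Hankel operator restricted to its range. -/
noncomputable def hankelRestrict (u : RationalSymbol) (hH : (hankel u.toLinf).range = V) :
    V →ₗ⋆[ℂ] V where
  toFun f := ⟨hankel u.toLinf f, hH.le ⟨(f : hardySpace), rfl⟩⟩
  map_add' f g := Subtype.ext (map_add (hankel u.toLinf) (f : hardySpace) g)
  map_smul' c f := Subtype.ext ((hankel u.toLinf).map_smulₛₗ c (f : hardySpace))

/-- The space V is left as a variable so that the model can be read on Ran H_u and again on K_θ for
any associated θ, avoiding transport between equal subspaces. -/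
theorem hankelModel {u : RationalSymbol} (hV : LinearMap.range (fraction s) = V)
    (hH : (hankel u.toLinf).range = V) {v : V} (hv : (v : hardySpace) = u.toHardy) :
    HankelModel (hankelRestrict u hH) (fractionOp hV) (fractionCoeff hV) v where
  symm f g := by
    have h1 := congrArg conj (inner_hankel_comm u.toLinf (g : hardySpace) f)
    exact (inner_conj_symm (E := hardySpace) _ _).symm.trans
      (h1.trans (inner_conj_symm (E := hardySpace) _ _))
  im_part f g := by
    obtain ⟨p, rfl⟩ := (fractionEquiv hV).surjective f
    obtain ⟨q, rfl⟩ := (fractionEquiv hV).surjective g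
    rw [fractionOp_apply, fractionOp_apply, fractionCoeff_apply, fractionCoeff_apply]
    exact inner_mulXMod_sub s p q
  coeff_hankel f := by
    obtain ⟨p, hp⟩ := (fractionEquiv hV).surjective (hankelRestrict u hH f)
    rw [← hp, fractionCoeff_apply,
      topCoeff_of_hankel_eq s (u := u) (f := f) (congrArg Subtype.val hp.symm), ← hv]
    rfl
  intertwine f g := by
    obtain ⟨p, hp⟩ := (fractionEquiv hV).surjective (hankelRestrict u hH f)
    obtain ⟨q, hq⟩ := (fractionEquiv hV).surjective (hankelRestrict u hH g)
    rw [← hp, ← hq, fractionOp_apply, fractionOp_apply]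
    exact inner_mulXMod_hankel_comm s (congrArg Subtype.val hp.symm) (congrArg Subtype.val hq.symm)
  coeff_ne_zero f μ hf hc := by
    obtain ⟨p, rfl⟩ := (fractionEquiv hV).surjective f
    rw [fractionOp_apply, ← map_smul] at hf
    rw [fractionCoeff_apply] at hc
    rw [eq_zero_of_mulXMod_eq_smul s ((fractionEquiv hV).injective hf) hc, map_zero]

namespace FiniteBlaschke

variable {θ : FiniteBlaschke}

theorem inner_modelShift (τ : ℝ≥0) (f g : θ.modelSpace) :
    ⟪θ.modelShift τ f, g⟫_ℂ = ⟪shift τ (f : hardySpace), (g : hardySpace)⟫_ℂ :=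
  Submodule.inner_orthogonalProjectionOnto_eq_of_mem_right g _

/-- The generator is the adjoint of the operator `f ↦ x f - c(f)`. -/
theorem IsGenerator.inner_eq {A : θ.modelSpace →L[ℂ] θ.modelSpace} (hA : θ.IsGenerator A)
    (hV : LinearMap.range (fraction s) = θ.modelSpace) (f g : θ.modelSpace) :
    ⟪A f, g⟫_ℂ = ⟪f, fractionOp hV g⟫_ℂ := by
  obtain ⟨p, rfl⟩ := (fractionEquiv hV).surjective g
  rw [fractionOp_apply]
  have h1 := IsSemigroupGenerator.tendsto_inner hA f (fractionEquiv hV p)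
  have h2 := tendsto_nhds_unique (h1.congr fun τ => ?_) (tendsto_shift_sub s (f : hardySpace) p)
  · exact mul_left_cancel₀ (neg_ne_zero.2 I_ne_zero) h2
  · rw [inner_modelShift, inner_sub_left]
    rfl

/-- Against vectors of K_θ the compression is invisible, so the weak derivatives are those of the
shift on H². The semigroup law of the compressed family is not needed. -/
theorem exists_isGenerator (θ : FiniteBlaschke) :
    ∃ A : θ.modelSpace →L[ℂ] θ.modelSpace, θ.IsGenerator A := by
  have hV := θ.modelSpace_eq.symm
  have := finiteDimensional_of_range_fraction hV
  refine exists_isSemigroupGenerator (E := θ.modelSpace) (B := fractionOp hV) (fun f g => ?_)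
    (fun f g => ?_) fun f g t ht => ?_
  · rw [inner_modelShift, shift_zero]
    rfl
  · simp only [inner_modelShift]
    exact continuous_inner_shift _ _
  · obtain ⟨p, rfl⟩ := (fractionEquiv hV).surjective g
    simp only [inner_modelShift, fractionOp_apply, coe_fractionEquiv]
    exact hasDerivWithinAt_inner_shift _ p ht

theorem isNormalized_of_const_eq_one (h : θ.const = 1) : θ.IsNormalized := by
  have h1 : ∀ a : ℂ, Tendsto (fun z : ℂ => (z - a) / (z - conj a)) (Bornology.cobounded ℂ)
      (𝓝 1) := fun a => by
    have h2 : Tendsto (fun z : ℂ => z - conj a) (Bornology.cobounded ℂ) (Bornology.cobounded ℂ) :=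
      tendsto_sub_const_cobounded _
    have h3 : Tendsto (fun z : ℂ => 1 + (conj a - a) * (z - conj a)⁻¹) (Bornology.cobounded ℂ)
        (𝓝 (1 + (conj a - a) * 0)) :=
      ((tendsto_inv₀_cobounded.comp h2).const_mul _).const_add _
    rw [mul_zero, add_zero] at h3
    refine h3.congr' ?_
    filter_upwards [h2.eventually (Bornology.eventually_ne_cobounded 0)] with z hz
    field_simp
    ring
  have h2 := tendsto_multiset_prod (f := fun (a : UpperHalfPlane) (z : ℂ) =>
    (z - (a : ℂ)) / (z - conj (a : ℂ))) (a := fun _ => 1) θ.zeros fun a _ => h1 a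
  unfold IsNormalized
  have e : θ.eval = fun z => (θ.zeros.map fun a : UpperHalfPlane =>
      (z - (a : ℂ)) / (z - conj (a : ℂ))).prod := by
    funext z
    rw [FiniteBlaschke.eval, h, Circle.coe_one, one_mul]
  rw [e]
  simpa only [Multiset.map_const', Multiset.prod_replicate, one_pow] using h2

end FiniteBlaschke

end ModelSpace

/-! ### Schmidt subspaces inside the range, and finiteness of the singular values. -/

section SchmidtSubspaces

theorem mem_schmidtSpace {φ : LinfR} {lam : ℝ} {f : hardySpace} :
    f ∈ schmidtSpace φ lam ↔ hankel φ (hankel φ f) = ((lam : ℂ) ^ 2) • f :=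
  sub_eq_zero (a := hankel φ (hankel φ f)) (b := ((lam : ℂ) ^ 2) • f)

theorem schmidtSpace_le_range {φ : LinfR} {lam : ℝ} (hlam : lam ≠ 0) :
    schmidtSpace φ lam ≤ (hankel φ).range := fun f hf => by
  have hl : (lam : ℂ) ^ 2 ≠ 0 := pow_ne_zero _ (by exact_mod_cast hlam)
  have h1 : f = ((lam : ℂ) ^ 2)⁻¹ • hankel φ (hankel φ f) := by
    rw [mem_schmidtSpace.1 hf, inv_smul_smul₀ hl]
  rw [h1]
  exact Submodule.smul_mem _ _ ⟨_, rfl⟩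

theorem finite_singularValues {φ : LinfR} [FiniteDimensional ℂ (hankel φ).range] :
    {lam : ℝ | IsSingularValue φ lam}.Finite := by
  set W := (hankel φ).range with hW
  -- Squares of singular values are eigenvalues of the linear operator H² on the finite-dimensional
  -- range, and squaring is injective on positive numbers.
  let T : Module.End ℂ W := (((hankel φ).comp (hankel φ)).toLinearMap.comp W.subtype).codRestrict W
      fun f => ⟨_, rfl⟩
  refine Set.Finite.of_finite_image (f := fun lam : ℝ => (lam : ℂ) ^ 2)
    ((Module.End.finite_hasEigenvalue T).subset ?_) ?_
  · rintro _ ⟨lam, ⟨hlam, hne⟩, rfl⟩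
    obtain ⟨f, hf, hf0⟩ := Submodule.exists_mem_ne_zero_of_ne_bot hne
    refine Module.End.hasEigenvalue_of_hasEigenvector
      (x := ⟨f, schmidtSpace_le_range hlam.ne' hf⟩) ⟨Module.End.mem_eigenspace_iff.2 ?_, fun h =>
        hf0
        (congrArg Subtype.val h)⟩
    exact Subtype.ext (mem_schmidtSpace.1 hf)
  · intro a ha b hb hab
    have h0 : (a : ℂ) ^ 2 = (b : ℂ) ^ 2 := hab
    have h1 : a ^ 2 = b ^ 2 := by exact_mod_cast h0
    exact (pow_left_inj₀ ha.1.le hb.1.le (by norm_num)).1 h1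

end SchmidtSubspaces

namespace RationalSymbol

theorem component_mem (u : RationalSymbol) (lam : ℝ) :
    u.component lam ∈ schmidtSpace u.toLinf lam :=
  Submodule.starProjection_apply_mem _ _

theorem inner_component (u : RationalSymbol) {lam : ℝ} {f : hardySpace}
    (hf : f ∈ schmidtSpace u.toLinf lam) : ⟪f, u.component lam⟫_ℂ = ⟪f, u.toHardy⟫_ℂ := by
  rw [component, ← Submodule.inner_starProjection_left_eq_right,
    Submodule.starProjection_eq_self_iff.2 hf]

end RationalSymbol

end Szego

/-! ### The theorem. -/

theorem theorem1p3 (u : RationalSymbol) :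
    {lam : ℝ | IsSingularValue u.toLinf lam}.Finite ∧
    (∃ (θ : FiniteBlaschke) (A : θ.modelSpace →L[ℂ] θ.modelSpace),
      u.IsAssociated θ ∧ θ.IsGenerator A) ∧
    ∀ lam : ℝ, IsSingularValue u.toLinf lam →
      u.toHardy ∉ (schmidtSpace u.toLinf lam)ᗮ ∧
      (∃ φ : ℝ, hankel u.toLinf (u.component lam) =
        ((lam : ℂ) * Complex.exp (φ * Complex.I)) • u.component lam) ∧
      ∀ (θ : FiniteBlaschke) (A : θ.modelSpace →L[ℂ] θ.modelSpace),
        u.IsAssociated θ → θ.IsGenerator A →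
        ∃ h : u.component lam ∈ θ.modelSpace,
          0 < (inner ℂ (⟨u.component lam, h⟩ : θ.modelSpace) (A ⟨u.component lam, h⟩)).im := by
  obtain ⟨s, hs⟩ := u.exists_blaschkeDenom_eq
  have hH := RationalSymbol.range_hankel hs
  have hfin : FiniteDimensional ℂ (hankel u.toLinf).range :=
    finiteDimensional_of_range_fraction hH.symm
  refine ⟨finite_singularValues, ?_, fun lam hlam => ?_⟩
  · obtain ⟨A, hA⟩ := FiniteBlaschke.exists_isGenerator ⟨1, s⟩
    exact ⟨⟨1, s⟩, A, ⟨FiniteBlaschke.isNormalized_of_const_eq_one rfl,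
      hH.trans (FiniteBlaschke.modelSpace_eq ⟨1, s⟩).symm⟩, hA⟩
  · set E := schmidtSpace u.toLinf lam with hE
    have huH : u.toHardy ∈ (hankel u.toLinf).range := by
      rw [hH, RationalSymbol.toHardy_eq_fraction hs]
      exact ⟨_, rfl⟩
    have hmodel := hankelModel hH.symm rfl (v := ⟨u.toHardy, huH⟩) rfl
    have hEle := schmidtSpace_le_range (φ := u.toLinf) hlam.1.ne'
    have hnot : u.toHardy ∉ Eᗮ := by
      intro hmem
      obtain ⟨f, hf, hf0⟩ := Submodule.exists_mem_ne_zero_of_ne_bot hlam.2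
      obtain ⟨g, hg, hg0⟩ := hmodel.exists_inner_ne_zero hlam.1.ne' (f₀ := ⟨f, hEle hf⟩)
        (Subtype.ext (mem_schmidtSpace.1 hf)) fun h => hf0 (congrArg Subtype.val h)
      exact hg0 ((Submodule.mem_orthogonal _ _).1 hmem g
        (mem_schmidtSpace.2 (congrArg Subtype.val hg)))
    have hmem := u.component_mem lam
    have hne : u.component lam ≠ 0 := fun h0 => hnot <| (Submodule.mem_orthogonal _ _).2
      fun f hf => by rw [← u.inner_component hf, h0, inner_zero_right]
    obtain ⟨-, φ, hφ⟩ := hmodel.component_spec hlam.1 (v := ⟨u.component lam, hEle hmem⟩)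
      (Subtype.ext (mem_schmidtSpace.1 hmem))
      (fun f hf => u.inner_component (mem_schmidtSpace.2 (congrArg Subtype.val hf)))
      fun h => hne (congrArg Subtype.val h)
    refine ⟨hnot, ⟨φ, congrArg Subtype.val hφ⟩, fun θ A hθ hA => ?_⟩
    -- Only equality of the subspaces is used: the fractions keep the denominator of u, and the
    -- zeros of θ need not be compared with it.
    have hV := hH.symm.trans hθ.2
    have h : u.component lam ∈ θ.modelSpace := hθ.2 ▸ hEle hmem
    refine ⟨h, ?_⟩
    have hmodel' := hankelModel hV hθ.2 (v := ⟨u.toHardy, hθ.2 ▸ huH⟩) rfl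
    have hc' := (hmodel'.component_spec hlam.1 (v := ⟨u.component lam, h⟩)
      (Subtype.ext (mem_schmidtSpace.1 hmem))
      (fun f hf => u.inner_component (mem_schmidtSpace.2 (congrArg Subtype.val hf)))
      fun h => hne (congrArg Subtype.val h)).1
    have him := hmodel'.im_inner ⟨u.component lam, h⟩
    -- Conjugating A = B* on the diagonal gives ⟪v, A v⟫ = ⟪B v, v⟫, whose imaginary part is π
    -- |c(v)|². As `inner` is linear in its second argument, this is ⟨A v, v⟩ in the convention
    -- linear in the first.
    have hinner := congrArg (starRingEnd ℂ)
      (hA.inner_eq hV ⟨u.component lam, h⟩ ⟨u.component lam, h⟩)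
    rw [inner_conj_symm, inner_conj_symm] at hinner
    rw [hinner, him]
    have := norm_pos_iff.2 hc'
    have := Real.pi_pos
    positivity
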